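/- Let $G$ be a finitely generated group. A subgroup $H\le G$ is called \emph{exponentially distorted} if $H$ is finitely generated and there are finite generating sets $S_0$ of $G$ and $T$ of $H$ and a constant $C>0$ such that, for every $h\in H$, $$\tfrac1C\log(1+|h|_T)-C\;\le\;|h|_{S_0}\;\le\;C\log(1+|h|_T)+C ,$$ where $|\cdot|_{S_0}$ and $|\cdot|_T$ denote word length. Suppose that either (a) $G$ is an HNN extension $\langle A,t\mid tht^{-1}=\varphi(h)\ (h\in H)\rangle$, where $\varphi\colon H\to K$ is an isomorphism between subgroups of a group $A$, and the associated subgroups $H$ and $K$ are exponentially distorted in $G$; or (b) $G$ is an amalgamated product $A_1 *_{H} A_2$ of two groups along a common subgroup $H$ that is proper in $A_1$ and proper in $A_2$, and $H$ is exponentially distorted in $G$. Let $S$ be any finite generating set of $G$, with word metric $d_S$, let $\omega$ be any ultrafilter on $\mathbb N$, let $(d_n)$ be any sequence of positive real numbers that tends to $\infty$ along $\omega$, and let $e=(e_n)$ be any sequence in $G$. Let $\operatorname{Con}^\omega(G,e,d)$ be the corresponding asymptotic cone: the set of sequences $(x_n)$ in $G$ with $\lim^\omega d_S(x_n,e_n)/d_n<\infty$,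 with the metric $\lim^\omega d_S(x_n,y_n)/d_n$, sequences at distance $0$ being identified. Then $\operatorname{Con}^\omega(G,e,d)$ is simply connected, or its fundamental group (at every base point) is uncountable. -/

import Mathlib

open Filter Topology

/-! ### Word metrics -/

/-- The word length of `g` with respect to `S`: the least length of a word in the letters
`S ∪ S⁻¹` that represents `g`. -/
noncomputable def wordLength {G : Type*} [Group G] (S : Set G) (g : G) : ℕ :=
  sInf {n | ∃ l : List G, (∀ x ∈ l, x ∈ S ∨ x⁻¹ ∈ S) ∧ l.prod = g ∧ l.length = n}

section WordLength

variable {G : Type*} [Group G] {S : Set G}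

theorem wordLength_le {l : List G} (hl : ∀ x ∈ l, x ∈ S ∨ x⁻¹ ∈ S) :
    wordLength S l.prod ≤ l.length :=
  Nat.sInf_le ⟨l, hl, rfl, rfl⟩

theorem exists_word (hS : Subgroup.closure S = ⊤) (g : G) :
    ∃ l : List G, (∀ x ∈ l, x ∈ S ∨ x⁻¹ ∈ S) ∧ l.prod = g ∧ l.length = wordLength S g := by
  have hne : {n | ∃ l : List G, (∀ x ∈ l, x ∈ S ∨ x⁻¹ ∈ S) ∧ l.prod = g ∧ l.length = n}.Nonempty := by
    have hg : g ∈ (Subgroup.closure S).toSubmonoid := by rw [hS]; trivial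
    rw [Subgroup.closure_toSubmonoid] at hg
    obtain ⟨l, hl, rfl⟩ := Submonoid.exists_list_of_mem_closure hg
    exact ⟨l.length, l, fun x hx => hl x hx, rfl, rfl⟩
  exact Nat.sInf_mem hne

theorem wordLength_one : wordLength S (1 : G) = 0 := by
  have h := wordLength_le (S := S) (l := []) (by simp)
  simpa using h

theorem eq_one_of_wordLength (hS : Subgroup.closure S = ⊤) {g : G} (h : wordLength S g = 0) :
    g = 1 := by
  obtain ⟨l, -, rfl, hlen⟩ := exists_word hS g
  rw [h, List.length_eq_zero_iff] at hlen
  simp [hlen]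

theorem wordLength_mul_le (hS : Subgroup.closure S = ⊤) (g h : G) :
    wordLength S (g * h) ≤ wordLength S g + wordLength S h := by
  obtain ⟨l, hl, hlp, hll⟩ := exists_word hS g
  obtain ⟨m, hm, hmp, hml⟩ := exists_word hS h
  have := wordLength_le (S := S) (l := l ++ m) (by
    intro x hx
    rcases List.mem_append.1 hx with hx | hx
    exacts [hl x hx, hm x hx])
  rwa [List.prod_append, List.length_append, hlp, hmp, hll, hml] at this

theorem wordLength_inv_le (hS : Subgroup.closure S = ⊤) (g : G) :
    wordLength S g⁻¹ ≤ wordLength S g := by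
  obtain ⟨l, hl, hlp, hll⟩ := exists_word hS g
  have := wordLength_le (S := S) (l := (l.map (·⁻¹)).reverse) (by
    intro x hx
    simp only [List.mem_reverse, List.mem_map] at hx
    obtain ⟨y, hy, rfl⟩ := hx
    rcases hl y hy with h | h
    · exact Or.inr (by simpa using h)
    · exact Or.inl h)
  rwa [← List.prod_inv_reverse, hlp, List.length_reverse, List.length_map, hll] at this

end WordLength

/-- The group `G` regarded as a metric space with the word metric of the generating set `S`. (This
is the vertex set of the Cayley graph; every point of the Cayley graph is at distance at most `1/2`
from it, so that both have the same asymptotic cones.) -/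
def WordMetricSpace {G : Type*} [Group G] (S : Set G) (_ : Subgroup.closure S = ⊤) : Type _ := G

/-- The word metric `d(g, h) = |g⁻¹ h|_S`. -/
noncomputable instance WordMetricSpace.instMetricSpace {G : Type*} [Group G] (S : Set G)
    (hS : Subgroup.closure S = ⊤) : MetricSpace (WordMetricSpace S hS) where
  dist (g h : G) := (wordLength S (g⁻¹ * h) : ℝ)
  dist_self (g : G) := by
    simp [wordLength_one]
  dist_comm (g h : G) := by
    have h₁ := wordLength_inv_le hS (g⁻¹ * h)
    have h₂ := wordLength_inv_le hS (h⁻¹ * g)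
    simp only [mul_inv_rev, inv_inv] at h₁ h₂
    exact_mod_cast le_antisymm h₂ h₁
  dist_triangle (g h k : G) := by
    have := wordLength_mul_le hS (g⁻¹ * h) (h⁻¹ * k)
    have e : g⁻¹ * h * (h⁻¹ * k) = g⁻¹ * k := by group
    rw [e] at this
    exact_mod_cast this
  eq_of_dist_eq_zero := by
    intro (g : G) (h : G) (hgh : (wordLength S (g⁻¹ * h) : ℝ) = 0)
    exact (inv_mul_eq_one (G := G)).1 (eq_one_of_wordLength hS (by exact_mod_cast hgh))

/-! ### Asymptotic cones -/

/-- A scaling sequence for `ω`: an `ω`-divergent sequence of positive real numbers. -/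
structure ScalingSequence (ω : Ultrafilter ℕ) where
  toFun : ℕ → ℝ
  pos : ∀ n, 0 < toFun n
  divergent : Tendsto toFun ω atTop

/-- A real sequence is `ω`-bounded if it is bounded above on a set of `ω`-measure one. (It is used
for sequences of nonnegative numbers only.) -/
def OmegaBounded (ω : Ultrafilter ℕ) (c : ℕ → ℝ) : Prop := ∃ M : ℝ, ∀ᶠ n in ω, c n < M

/-- The `ω`-limit of a real sequence. -/
noncomputable def omegaLim (ω : Ultrafilter ℕ) (c : ℕ → ℝ) : ℝ := limUnder (ω : Filter ℕ) c

theorem OmegaBounded.tendsto {ω : Ultrafilter ℕ} {c : ℕ → ℝ} (h : OmegaBounded ω c)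
    (h0 : ∀ n, 0 ≤ c n) : Tendsto c ω (𝓝 (omegaLim ω c)) := by
  obtain ⟨M, hM⟩ := h
  have hmem : (ω.map c : Filter ℝ) ≤ 𝓟 (Set.Icc 0 M) := by
    rw [le_principal_iff, Ultrafilter.coe_map, Filter.mem_map]
    filter_upwards [hM] with n hn
    exact ⟨h0 n, hn.le⟩
  obtain ⟨x, -, hx⟩ := isCompact_Icc.ultrafilter_le_nhds (ω.map c) hmem
  exact tendsto_nhds_limUnder ⟨x, hx⟩

theorem OmegaBounded.add {ω : Ultrafilter ℕ} {c c' : ℕ → ℝ} (h : OmegaBounded ω c)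
    (h' : OmegaBounded ω c') : OmegaBounded ω (fun n => c n + c' n) := by
  obtain ⟨M, hM⟩ := h
  obtain ⟨M', hM'⟩ := h'
  exact ⟨M + M', by filter_upwards [hM, hM'] with n h₁ h₂ using add_lt_add h₁ h₂⟩

theorem OmegaBounded.mono {ω : Ultrafilter ℕ} {c c' : ℕ → ℝ} (h : OmegaBounded ω c)
    (h' : ∀ n, c' n ≤ c n) : OmegaBounded ω c' := by
  obtain ⟨M, hM⟩ := h
  exact ⟨M, by filter_upwards [hM] with n hn using (h' n).trans_lt hn⟩

/-- The sequences `x` in `X` with `lim^ω d(x n, e n) / d n < ∞`, where `e` is the observation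
sequence and `d` the scaling sequence. -/
def PreCone (X : Type*) [MetricSpace X] (ω : Ultrafilter ℕ) (e : ℕ → X) (d : ScalingSequence ω) :
    Type _ :=
  {x : ℕ → X // OmegaBounded ω (fun n => dist (x n) (e n) / d.toFun n)}

section PreCone

variable {X : Type*} [MetricSpace X] {ω : Ultrafilter ℕ} {e : ℕ → X} {d : ScalingSequence ω}

theorem PreCone.bounded (x y : PreCone X ω e d) :
    OmegaBounded ω (fun n => dist (x.1 n) (y.1 n) / d.toFun n) := by
  refine (x.2.add y.2).mono fun n => ?_
  rw [← add_div]
  exact div_le_div_of_nonneg_right (dist_triangle_right _ _ _) (d.pos n).le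

theorem PreCone.tendsto (x y : PreCone X ω e d) :
    Tendsto (fun n => dist (x.1 n) (y.1 n) / d.toFun n) ω
      (𝓝 (omegaLim ω fun n => dist (x.1 n) (y.1 n) / d.toFun n)) :=
  (x.bounded y).tendsto fun n => div_nonneg dist_nonneg (d.pos n).le

/-- The pseudometric `d(x, y) = lim^ω d(x n, y n) / d n`. -/
noncomputable instance PreCone.instPseudoMetricSpace : PseudoMetricSpace (PreCone X ω e d) where
  dist x y := omegaLim ω fun n => dist (x.1 n) (y.1 n) / d.toFun n
  dist_self x := by
    refine tendsto_nhds_unique (x.tendsto x) ?_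
    simp
  dist_comm x y := by simp only [dist_comm]
  dist_triangle x y z := by
    refine le_of_tendsto_of_tendsto' (x.tendsto z) ((x.tendsto y).add (y.tendsto z)) fun n => ?_
    rw [← add_div]
    exact div_le_div_of_nonneg_right (dist_triangle _ _ _) (d.pos n).le

end PreCone

/-- The asymptotic cone `Con^ω(X, e, d)`: the quotient metric space that identifies sequences at
distance `0`. -/
abbrev AsymptoticCone (X : Type*) [MetricSpace X] (ω : Ultrafilter ℕ) (e : ℕ → X)
    (d : ScalingSequence ω) : Type _ :=
  SeparationQuotient (PreCone X ω e d)

/-! ### Exponentially distorted subgroups, HNN extensions and amalgamated products -/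

/-- `H` is exponentially distorted in `G`: both groups are finitely generated, and on `H` the word
length of `G` agrees with the logarithm of the word length of `H`, up to multiplicative and additive
constants. -/
def ExponentiallyDistorted {G : Type*} [Group G] (H : Subgroup G) : Prop :=
  ∃ (S : Set G) (T : Set H), S.Finite ∧ Subgroup.closure S = ⊤ ∧
    T.Finite ∧ Subgroup.closure T = ⊤ ∧
    ∃ C : ℝ, 0 < C ∧ ∀ h : H,
      Real.log (1 + wordLength T h) / C - C ≤ wordLength S (h : G) ∧
      wordLength S (h : G) ≤ C * Real.log (1 + wordLength T h) + C

/-- `G` is an HNN extension of a group `A` whose two associated subgroups (as subgroups of `G`)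
satisfy `P`. -/
def IsHNNExtensionWith.{u} (G : Type u) [Group G] (P : Subgroup G → Prop) : Prop :=
  ∃ (A : Type u) (_ : Group A) (H K : Subgroup A) (φ : H ≃* K) (f : HNNExtension A H K φ ≃* G),
    P (H.map (f.toMonoidHom.comp HNNExtension.of)) ∧
    P (K.map (f.toMonoidHom.comp HNNExtension.of))

/-- `G` is an amalgamated product of two groups `A 0` and `A 1` along a common subgroup `C` that is
proper in both of them, and `C` (as a subgroup of `G`) satisfies `P`. -/
def IsAmalgamatedProductWith.{u} (G : Type u) [Group G] (P : Subgroup G → Prop) : Prop :=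
  ∃ (A : Fin 2 → Type u) (_ : ∀ i, Group (A i)) (C : Type u) (_ : Group C) (φ : ∀ i, C →* A i)
    (f : Monoid.PushoutI φ ≃* G),
    (∀ i, Function.Injective (φ i)) ∧ (∀ i, (φ i).range ≠ ⊤) ∧
    P (f.toMonoidHom.comp (Monoid.PushoutI.base φ)).range

/-! In both cases an edge of the Bass–Serre tree cuts `G` into two sides whose common frontier is an
exponentially distorted subgroup `H`. The sides are given by a `ZMod 2`-valued function
(`IsWallFunction`), obtained from a cocycle that the universal property provides, so no normal forms
are needed. In the cone the sides become closed sets `A` and `B` that cover it, neither containing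
the other, and `A ∩ B` is the limit set of `H`. On `H` the ambient distance is comparable with the
logarithm of the intrinsic length, and the logarithm of a sum exceeds the larger of the logarithms
by at most `log 2`, up to the shift by one. After rescaling this error vanishes, so `A ∩ B` is
bi-Lipschitz to an ultrametric space. The cone is also complete, geodesic and homogeneous.

Suppose that the cone has no cut point. The ultrametric set `A ∩ B` splits into small uniformly
separated classes. A bump function of a class, cut off outside `B`, is a map to the circle. If none
of these maps told two paths from `a ∈ A \ B` to `b ∈ B \ A` apart, every class could be avoided by
a path on which its map has a lift with equal ends; adding up the lifts along one fixed path
contradicts that this path has to cross `A ∩ B` (`exists_sideMap_not_homotopic`). Since `A ∩ B` is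
not a point, `H` is infinite, and its exponential growth gives continuum many points that are
arbitrarily far apart. Translates of the detected loop to these points have different classes
(`uncountable_of_ultrametric_separation`).

Suppose that there is a cut point. The maximal sets that no point separates, the pieces, are then
proper. Every point has a gate in a piece (`Unseparated.exists_isGate`), the gate map is a
1-Lipschitz retraction, and it is constant on every other piece. By Baire's theorem and homogeneity
every ball meets uncountably many pieces (`not_countable_pieces`). Consider core pairs, that is,
pairs of paths that bound inside one piece. If some core pair is not homotopic, its translates to
uncountably many pieces give different loops, as retractions show
(`uncountable_of_corePair_not_homotopic`). If small core pairs need large homotopies, infinite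
concatenations of shrinking loops, indexed by sets of natural numbers, are homotopic only if the
sets differ finitely (`uncountable_of_no_small_filling`). Otherwise small core pairs have small
fillings. A geodesic triangle is a simple triangle, hence a core pair, up to backtracking, so small
triangles have small fillings, and a limit of inscribed polygons deforms every path to a geodesic
(`simplyConnectedSpace_of_corePair_homotopic`). -/

/-! ### Geodesics -/

section Pieces

open Set unitInterval

variable {X : Type*} [MetricSpace X]

/-- A path whose length between any two of its points is their distance. The parametrisation is
arbitrary. -/
def IsGeodesicPath {a b : X} (γ : Path a b) : Prop :=
  ∀ s t u : I, s ≤ t → t ≤ u → dist (γ s) (γ t) + dist (γ t) (γ u) = dist (γ s) (γ u)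

/-- Any two points are joined by a geodesic. -/
def IsGeodesicSpace (X : Type*) [MetricSpace X] : Prop :=
  ∀ a b : X, ∃ γ : Path a b, IsGeodesicPath γ

theorem IsGeodesicPath.eq_of_between {a b : X} {γ : Path a b} (h : IsGeodesicPath γ) {s t u : I}
    (hst : s ≤ t) (htu : t ≤ u) (hsu : γ s = γ u) : γ t = γ s := by
  have := h s t u hst htu
  rw [hsu, dist_self] at this
  rw [hsu]
  have h1 := dist_nonneg (x := γ u) (y := γ t)
  have h2 := dist_nonneg (x := γ t) (y := γ u)
  exact dist_le_zero.1 (by linarith)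

theorem IsGeodesicPath.dist_source_le {a b : X} {γ : Path a b} (h : IsGeodesicPath γ) (t : I) :
    dist a (γ t) ≤ dist a b := by
  have := h 0 t 1 bot_le le_top
  rw [γ.source, γ.target] at this
  linarith [dist_nonneg (x := γ t) (y := b)]

theorem IsGeodesicPath.dist_add {a b : X} {γ : Path a b} (h : IsGeodesicPath γ) (t : I) :
    dist a (γ t) + dist (γ t) b = dist a b := by
  have := h 0 t 1 bot_le le_top
  rwa [γ.source, γ.target] at this

theorem IsGeodesicSpace.joined (hX : IsGeodesicSpace X) (a b : X) : Joined a b :=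
  ⟨(hX a b).choose⟩

theorem JoinedIn.of_subpath {a b : X} (γ : Path a b) {F : Set X} {s t : I} (hst : s ≤ t)
    (h : ∀ u, s ≤ u → u ≤ t → γ u ∈ F) : JoinedIn F (γ s) (γ t) := by
  refine ⟨γ.subpath s t, fun u => ?_⟩
  have : γ.subpath s t u ∈ range (γ.subpath s t) := mem_range_self u
  rw [Path.range_subpath_of_le _ _ _ hst] at this
  obtain ⟨v, hv, hvu⟩ := this
  rw [← hvu]
  exact h v hv.1 hv.2

/-- A path that ends in a closed set meets it for a first time. -/
theorem Path.exists_first_hit {M : Set X} (hM : IsClosed M) {w m : X} (f : Path w m) (hm : m ∈ M) :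
    ∃ t : I, f t ∈ M ∧ ∀ s < t, f s ∉ M := by
  have hcl : IsClosed (f ⁻¹' M) := hM.preimage f.continuous
  obtain ⟨t, ht⟩ := hcl.isCompact.exists_isLeast ⟨1, by simpa using hm⟩
  exact ⟨t, ht.1, fun s hs hsM => not_le_of_gt hs (ht.2 hsM)⟩

/-- A path that starts in a closed set meets it for a last time. -/
theorem Path.exists_last_hit {M : Set X} (hM : IsClosed M) {w m : X} (f : Path w m) (hw : w ∈ M) :
    ∃ t : I, f t ∈ M ∧ ∀ s, t < s → f s ∉ M := by
  have hcl : IsClosed (f ⁻¹' M) := hM.preimage f.continuous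
  obtain ⟨t, ht⟩ := hcl.isCompact.exists_isGreatest ⟨0, by simpa using hw⟩
  exact ⟨t, ht.1, fun s hs hsM => not_le_of_gt hs (ht.2 hsM)⟩

/-! ### Sets that no point separates, and the pieces they span -/

/-- No point of the space separates two other points of `K`. -/
def Unseparated (K : Set X) : Prop :=
  ∀ z, ∀ k ∈ K, ∀ k' ∈ K, k ≠ z → k' ≠ z → JoinedIn {z}ᶜ k k'

/-- The points that no other point separates from `K`. -/
def piece (K : Set X) : Set X :=
  {y | ∀ z, y ≠ z → ∀ k ∈ K, k ≠ z → JoinedIn {z}ᶜ y k}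

theorem Unseparated.mono {K K' : Set X} (h : Unseparated K) (hK : K' ⊆ K) : Unseparated K' :=
  fun z k hk k' hk' => h z k (hK hk) k' (hK hk')

theorem Unseparated.subset_piece {K : Set X} (h : Unseparated K) : K ⊆ piece K :=
  fun y hy z hyz k hk hkz => h z y hy k hk hyz hkz

theorem Unseparated.subset_piece_of_subset {K K' : Set X} (h : Unseparated K) (hK : K' ⊆ K) :
    K ⊆ piece K' :=
  fun y hy z hyz k hk hkz => h z y hy k (hK hk) hyz hkz

theorem unseparated_piece {K : Set X} (hK : K.Nontrivial) : Unseparated (piece K) := by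
  intro z y hy y' hy' hyz hyz'
  obtain ⟨k, hk, hkz⟩ := hK.exists_ne z
  exact (hy z hyz k hk hkz).trans (hy' z hyz' k hk hkz).symm

/-- `c` lies in `M`, and every path from `w` to `M` passes through `c`. -/
def IsGate (M : Set X) (w c : X) : Prop :=
  c ∈ M ∧ ∀ m ∈ M, ∀ f : Path w m, c ∈ range f

theorem isGate_self {M : Set X} {w : X} (h : w ∈ M) : IsGate M w w :=
  ⟨h, fun _ _ f => ⟨0, f.source⟩⟩

/-- The points that separate `w` from all of `K` lie on every path from `w` to `K` and form,
together with `w`, a closed set. The last of them on a geodesic is the gate. -/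
theorem Unseparated.exists_isGate (hX : IsGeodesicSpace X) {K : Set X} (hK : Unseparated K)
    (hK' : K.Nontrivial) (w : X) : ∃ c, IsGate (piece K) w c := by
  by_cases hw : w ∈ piece K
  · exact ⟨w, isGate_self hw⟩
  set S : Set X := {z | z ≠ w ∧ ∀ k ∈ K, k ≠ z → ¬ JoinedIn {z}ᶜ w k} with hS
  obtain ⟨z₀, hz₀⟩ : S.Nonempty := by
    simp only [piece, mem_ofPred_eq, not_forall] at hw
    obtain ⟨z, hwz, k, hk, hkz, hj⟩ := hw
    exact ⟨z, hwz.symm, fun k' hk' hkz' hj' => hj (hj'.trans (hK z k' hk' k hk hkz' hkz))⟩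
  have hclosed : IsClosed (S ∪ {w}) := by
    rw [← isOpen_compl_iff, isOpen_iff_mem_nhds]
    intro z hz
    simp only [mem_compl_iff, mem_union, mem_singleton_iff, not_or] at hz
    obtain ⟨hzS, hzw⟩ := hz
    simp only [hS, mem_ofPred_eq, not_and, not_forall, not_not] at hzS
    obtain ⟨k, hk, hkz, f, hf⟩ := hzS hzw
    have hcl : IsClosed (range f) := (isCompact_range f.continuous).isClosed
    have hzf : z ∈ (range f)ᶜ := by
      rintro ⟨t, ht⟩
      exact hf t ht
    filter_upwards [hcl.isOpen_compl.mem_nhds hzf] with z' hz'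
    have hne : ∀ t, f t ≠ z' := fun t ht => hz' ⟨t, ht⟩
    rintro (h | h)
    · refine h.2 k hk ?_ ⟨f, hne⟩
      simpa using hne 1
    · exact hne 0 (by simpa using h.symm)
  obtain ⟨p, hp⟩ := hK'.nonempty
  obtain ⟨γ, hγ⟩ := hX w p
  have hsep : ∀ z ∈ S, z ∈ range γ := by
    intro z hz
    by_contra hzγ
    have hne : ∀ t, γ t ≠ z := fun t ht => hzγ ⟨t, ht⟩
    exact hz.2 p hp (by simpa using hne 1) ⟨γ, hne⟩
  obtain ⟨t₀, ht₀⟩ := hsep z₀ hz₀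
  obtain ⟨t, ht, htmax⟩ := γ.exists_last_hit hclosed (by simp)
  have htmax : ∀ s, γ s ∈ S → s ≤ t := fun s hs => by
    by_contra! h
    exact htmax s h (Or.inl hs)
  have htS : γ t ∈ S := by
    rcases ht with h | h
    · exact h
    · exfalso
      have := hγ.eq_of_between (s := 0) (t := t₀) (u := t) bot_le (htmax t₀ (ht₀ ▸ hz₀))
        (by rw [γ.source]; exact h.symm)
      rw [γ.source, ht₀] at this
      exact hz₀.1 this
  -- A point `y` that separates `γ t` from `K` lies on `γ` after time `t`. The geodesic cannot have
  -- met it before, so `y` separates `w` from `K` too, against the choice of `t`.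
  have hmem : γ t ∈ piece K := by
    intro y hy k hk hky
    by_contra hj
    have hjall : ∀ k' ∈ K, k' ≠ y → ¬ JoinedIn {y}ᶜ (γ t) k' := fun k' hk' hky' hj' =>
      hj (hj'.trans (hK y k' hk' k hk hky' hky))
    obtain ⟨u, htu, hu⟩ : ∃ u, t ≤ u ∧ γ u = y := by
      by_contra! hno
      refine hjall p hp (by simpa using hno 1 le_top) ?_
      have := JoinedIn.of_subpath γ (F := {y}ᶜ) (s := t) (t := 1) le_top
        (fun u h1 _ => hno u h1)
      rwa [γ.target] at this
    have hwy : JoinedIn {y}ᶜ w (γ t) := by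
      have := JoinedIn.of_subpath γ (F := {y}ᶜ) (s := 0) (t := t) bot_le (fun s _ h2 hs => by
        have hs : γ s = y := hs
        have := hγ.eq_of_between h2 htu (hs.trans hu.symm)
        exact hy (this.trans hs))
      rwa [γ.source] at this
    have hyS : y ∈ S := by
      refine ⟨fun h => ?_, fun k' hk' hky' hj' => hjall k' hk' hky' (hwy.symm.trans hj')⟩
      exact hwy.source_mem h.symm
    have := le_antisymm htu (htmax u (hu ▸ hyS))
    exact hy (this ▸ hu)
  refine ⟨γ t, hmem, fun m hm f => ?_⟩
  by_contra hf
  have hne : ∀ s, f s ≠ γ t := fun s hs => hf ⟨s, hs⟩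
  obtain ⟨k, hk, hkz⟩ := hK'.exists_ne (γ t)
  have hmz : m ≠ γ t := by simpa using hne 1
  have hj : JoinedIn {γ t}ᶜ w m := ⟨f, hne⟩
  exact htS.2 k hk hkz (hj.trans (hm _ hmz k hk hkz))

/-! ### Gated sets and the retractions onto them -/

variable {M : Set X}

/-- Every point has a gate in `M`. -/
def IsGated (M : Set X) : Prop := ∀ w, ∃ c, IsGate M w c

/-- A geodesic from `w` to `M` passes through the gate, so no point of `M` is closer to `w` than the
gate. -/
theorem IsGated.isClosed (hX : IsGeodesicSpace X) (hM : IsGated M) : IsClosed M := by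
  rw [← isOpen_compl_iff, Metric.isOpen_iff]
  intro w hw
  obtain ⟨c, hc, hcw⟩ := hM w
  have hne : w ≠ c := fun h => hw (h ▸ hc)
  refine ⟨dist w c, dist_pos.2 hne, fun w' hw' hw'M => ?_⟩
  obtain ⟨γ, hγ⟩ := hX w w'
  obtain ⟨t, ht⟩ := hcw w' hw'M γ
  have := hγ.dist_source_le t
  rw [ht] at this
  rw [Metric.mem_ball, dist_comm] at hw'
  linarith

theorem IsGate.eq_first_hit {w c m : X} (h : IsGate M w c) (f : Path w m) {t : I} (ht : f t ∈ M)
    (hmin : ∀ s < t, f s ∉ M) : f t = c := by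
  have := h.2 _ ht ((f.subpath 0 t).cast (by simp) rfl)
  obtain ⟨s, hs⟩ := this
  have hmem : c ∈ range (f.subpath 0 t) := ⟨s, hs⟩
  rw [Path.range_subpath_of_le _ 0 _ bot_le] at hmem
  obtain ⟨u, hu, huc⟩ := hmem
  rcases hu.2.lt_or_eq with h' | h'
  · exact absurd (huc ▸ h.1) (hmin u h')
  · rw [← h', huc]

/-- The gate of a point in a gated set. -/
noncomputable def gate (hM : IsGated M) (w : X) : X := (hM w).choose

theorem isGate_gate (hM : IsGated M) (w : X) : IsGate M w (gate hM w) := (hM w).choose_spec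

theorem gate_mem (hM : IsGated M) (w : X) : gate hM w ∈ M := (isGate_gate hM w).1

theorem gate_eq_self (hM : IsGated M) {w : X} (hw : w ∈ M) : gate hM w = w := by
  obtain ⟨t, ht⟩ := (isGate_gate hM w).2 w hw (Path.refl w)
  simpa using ht.symm

theorem gate_eq_first_hit (hM : IsGated M) {w m : X} (f : Path w m) {t : I} (ht : f t ∈ M)
    (hmin : ∀ s < t, f s ∉ M) : f t = gate hM w :=
  (isGate_gate hM w).eq_first_hit f ht hmin

theorem gate_eq_last_hit (hM : IsGated M) {w m : X} (f : Path w m) {t : I} (ht : f t ∈ M)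
    (hmax : ∀ s, t < s → f s ∉ M) : f t = gate hM m := by
  have := gate_eq_first_hit hM f.symm (t := σ t) (by simpa using ht) (fun s hs => by
    have := hmax (σ s) (by
      have := (unitInterval.strictAnti_symm.lt_iff_gt (a := σ s) (b := t)).1 (by simpa using hs)
      exact this)
    simpa using this)
  simpa using this

/-- A path that misses `M` does not change the gate. -/
theorem gate_eq_of_disjoint (hX : IsGeodesicSpace X) (hM : IsGated M) {w w' : X} (f : Path w w')
    (hf : ∀ t, f t ∉ M) : gate hM w = gate hM w' := by
  obtain ⟨g, -⟩ := hX w' (gate hM w')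
  obtain ⟨t, ht, hmin⟩ := g.exists_first_hit (hM.isClosed hX) (gate_mem hM w')
  have h1 := gate_eq_first_hit hM g ht hmin
  obtain ⟨s, hs⟩ := (isGate_gate hM w).2 _ ht (f.trans ((g.subpath 0 t).cast (by simp) rfl))
  have : gate hM w ∈ range (f.trans ((g.subpath 0 t).cast (by simp) rfl)) := ⟨s, hs⟩
  rw [Path.trans_range] at this
  rcases this with ⟨u, hu⟩ | ⟨u, hu⟩
  · exact absurd (hu ▸ gate_mem hM w) (hf u)
  · have hmem : gate hM w ∈ range (g.subpath 0 t) := ⟨u, hu⟩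
    rw [Path.range_subpath_of_le _ 0 _ bot_le] at hmem
    obtain ⟨v, hv, hvw⟩ := hmem
    rcases hv.2.lt_or_eq with h' | h'
    · exact absurd (hvw ▸ gate_mem hM w) (hmin v h')
    · rw [← h1, ← hvw, h']

/-- A geodesic from `w` to `w'` that meets `M` enters it at the gate of `w` and leaves it for good
at the gate of `w'`. If it misses `M`, the gates agree. -/
theorem dist_gate_le (hX : IsGeodesicSpace X) (hM : IsGated M) (w w' : X) :
    dist (gate hM w) (gate hM w') ≤ dist w w' := by
  obtain ⟨f, hf⟩ := hX w w'
  by_cases h : ∀ t, f t ∉ M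
  · rw [gate_eq_of_disjoint hX hM f h, dist_self]
    exact dist_nonneg
  push Not at h
  have hcpt : IsCompact (f ⁻¹' M) := ((hM.isClosed hX).preimage f.continuous).isCompact
  obtain ⟨t, ht⟩ := hcpt.exists_isLeast h
  obtain ⟨u, hu⟩ := hcpt.exists_isGreatest h
  have h1 := gate_eq_first_hit hM f ht.1 (fun s hs hsM => not_le_of_gt hs (ht.2 hsM))
  have h2 := gate_eq_last_hit hM f hu.1 (fun s hs hsM => not_le_of_gt hs (hu.2 hsM))
  rw [← h1, ← h2]
  have htu : t ≤ u := ht.2 hu.1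
  have e1 := hf 0 t u bot_le htu
  have e2 := hf.dist_source_le u
  rw [f.source] at e1
  linarith [dist_nonneg (x := w) (y := f t)]

/-- The retraction onto a gated set. -/
noncomputable def gateMap (hX : IsGeodesicSpace X) (hM : IsGated M) : C(X, X) where
  toFun := gate hM
  continuous_toFun := (LipschitzWith.of_dist_le_mul (K := 1) (fun x y => by
    simpa using dist_gate_le hX hM x y)).continuous

/-- A gated set has a constant gate along an unseparated set that meets it in at most one point. -/
theorem gate_eq_of_unseparated (hX : IsGeodesicSpace X) (hM : IsGated M) {N : Set X}
    (hN : Unseparated N) (hMN : (M ∩ N).Subsingleton) {y y' : X} (hy : y ∈ N) (hy' : y' ∈ N) :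
    gate hM y = gate hM y' := by
  -- A path that starts at `y` and misses the gate of `y` cannot meet `M` at all.
  have key : ∀ y ∈ N, ∀ y' ∈ N, gate hM y ≠ y → gate hM y ≠ y' → gate hM y = gate hM y' := by
    intro y hy y' hy' h1 h2
    obtain ⟨f, hf⟩ := hN (gate hM y) y hy y' hy' h1.symm h2.symm
    refine gate_eq_of_disjoint hX hM f fun t ht => ?_
    obtain ⟨s, hs⟩ := (isGate_gate hM y).2 _ ht ((f.subpath 0 t).cast (by simp) rfl)
    have hmem : gate hM y ∈ range (f.subpath 0 t) := ⟨s, hs⟩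
    rw [Path.range_subpath_of_le _ 0 _ bot_le] at hmem
    obtain ⟨u, -, hu⟩ := hmem
    exact hf u hu
  by_cases h1 : gate hM y = y
  · by_cases h2 : gate hM y' = y'
    · rw [h1, h2]
      exact hMN ⟨h1 ▸ gate_mem hM y, hy⟩ ⟨h2 ▸ gate_mem hM y', hy'⟩
    · by_cases h3 : gate hM y' = y
      · rw [h1, h3]
      · exact (key y' hy' y hy h2 h3).symm
  · by_cases h2 : gate hM y = y'
    · rw [h2, gate_eq_self hM (h2 ▸ gate_mem hM y)]
    · exact key y hy y' hy' h1 h2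

/-- For every `z`, one of two common points differs from `z`; points of both pieces can be joined
through it in the complement of `z`. -/
theorem piece_subset_of_nontrivial_inter {K K' : Set X} (hK' : K'.Nontrivial)
    (h : (piece K ∩ piece K').Nontrivial) : piece K' ⊆ piece K := by
  intro y hy z hyz k hk hkz
  obtain ⟨x, ⟨hx1, hx2⟩, hxz⟩ := h.exists_ne z
  exact (unseparated_piece hK' z y hy x hx2 hyz hxz).trans (hx1 z hxz k hk hkz)

theorem subsingleton_inter_of_piece_ne {K K' : Set X} (hK : K.Nontrivial) (hK' : K'.Nontrivial)
    (h : piece K ≠ piece K') : (piece K ∩ piece K').Subsingleton := by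
  by_contra hs
  rw [not_subsingleton_iff] at hs
  exact h ((piece_subset_of_nontrivial_inter hK (by rwa [inter_comm])).antisymm
    (piece_subset_of_nontrivial_inter hK' hs))

theorem JoinedIn.image_isometryEquiv (g : X ≃ᵢ X) {z x y : X} (h : JoinedIn {z}ᶜ x y) :
    JoinedIn {g z}ᶜ (g x) (g y) := by
  obtain ⟨f, hf⟩ := h
  exact ⟨f.map g.continuous, fun t ht => hf t (g.injective ht)⟩

theorem Unseparated.image {K : Set X} (hK : Unseparated K) (g : X ≃ᵢ X) : Unseparated (g '' K) := by
  rintro z _ ⟨k, hk, rfl⟩ _ ⟨k', hk', rfl⟩ h1 h2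
  have := (hK (g.symm z) k hk k' hk' (fun h => h1 (by simp [h]))
    (fun h => h2 (by simp [h]))).image_isometryEquiv g
  simpa using this

theorem image_piece (g : X ≃ᵢ X) (K : Set X) : g '' piece K = piece (g '' K) := by
  have key : ∀ (g : X ≃ᵢ X) (K : Set X), g '' piece K ⊆ piece (g '' K) := by
    rintro g K _ ⟨y, hy, rfl⟩ z hyz _ ⟨k, hk, rfl⟩ hkz
    have := (hy (g.symm z) (fun h => hyz (by simp [h])) k hk
      (fun h => hkz (by simp [h]))).image_isometryEquiv g
    simpa using this
  refine (key g K).antisymm fun y hy => ?_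
  have := key g.symm (g '' K) ⟨y, hy, rfl⟩
  rw [← image_comp] at this
  refine ⟨g.symm y, by simpa using this, by simp⟩

end Pieces


/-! ### Abundance of pieces in a homogeneous space; core pairs -/

section ManyPieces

open Set unitInterval

variable {X : Type*} [MetricSpace X]

/-- Isometries act transitively. -/
def IsHomogeneousMetric (X : Type*) [MetricSpace X] : Prop := ∀ x y : X, ∃ g : X ≃ᵢ X, g x = y

theorem IsGeodesicSpace.pathConnectedSpace [Nonempty X] (hX : IsGeodesicSpace X) :
    PathConnectedSpace X := ⟨inferInstance, hX.joined⟩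

theorem IsGeodesicSpace.isGated_piece (hX : IsGeodesicSpace X) {K : Set X} (hK : Unseparated K)
    (hK' : K.Nontrivial) : IsGated (piece K) := fun w => hK.exists_isGate hX hK' w

/-- If there were countably many, Baire's theorem would give a piece with interior points. By
homogeneity every point would be the centre of a ball of one fixed radius inside a piece, and
overlapping pieces of this kind coincide, so connectedness would make one piece the whole space. -/
theorem not_countable_pieces [CompleteSpace X] (hX : IsGeodesicSpace X)
    (hhom : IsHomogeneousMetric X) {K : Set X} (hK : Unseparated K) (hK' : K.Nontrivial)
    (hne : piece K ≠ univ) {p : X} (hp : p ∈ K) (o : X) {δ : ℝ} (hδ : 0 < δ) :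
    ¬ {S : Set X | ∃ g : X ≃ᵢ X, g p ∈ Metric.ball o δ ∧ S = piece (g '' K)}.Countable := by
  intro hc
  have hclosed : ∀ g : X ≃ᵢ X, IsClosed (piece (g '' K)) := fun g =>
    (hX.isGated_piece (hK.image g) (hK'.image g.injective)).isClosed hX
  set 𝒮 := {S : Set X | ∃ g : X ≃ᵢ X, g p ∈ Metric.ball o δ ∧ S = piece (g '' K)} with h𝒮
  have hdense := dense_sUnion_interior_of_closed (S := insert (Metric.ball o δ)ᶜ 𝒮)
    (by
      rintro S (rfl | ⟨g, -, rfl⟩)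
      · exact Metric.isOpen_ball.isClosed_compl
      · exact hclosed g)
    (hc.insert _)
    (by
      refine eq_univ_of_forall fun z => ?_
      by_cases hz : z ∈ Metric.ball o δ
      · obtain ⟨g, rfl⟩ := hhom p z
        exact ⟨_, Or.inr ⟨g, hz, rfl⟩, (hK.image g).subset_piece (mem_image_of_mem g hp)⟩
      · exact ⟨_, Or.inl rfl, hz⟩)
  obtain ⟨v, hvo, hv⟩ := hdense.exists_mem_open Metric.isOpen_ball ⟨o, Metric.mem_ball_self hδ⟩
  simp only [mem_iUnion] at hvo
  obtain ⟨S, hS, hvS⟩ := hvo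
  rcases hS with rfl | ⟨g, -, rfl⟩
  · exact (interior_subset hvS) hv
  obtain ⟨ρ, hρ, hball⟩ := Metric.isOpen_iff.1 isOpen_interior v hvS
  choose h hh using fun z => hhom v z
  -- The isometry `h z` carries `v` to `z`, hence the ball in the piece around `v` to one around
  -- `z`.
  have hbig : ∀ z, Metric.ball z ρ ⊆ piece (h z '' (g '' K)) := by
    intro z w hw
    rw [← image_piece]
    refine ⟨(h z).symm w, interior_subset (hball ?_), by simp⟩
    rw [Metric.mem_ball, ← (h z).dist_eq]
    simpa [hh] using hw
  -- For close `z ≠ z'` both balls contain both points, and different pieces share at most one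
  -- point.
  have hloc : IsLocallyConstant fun z => piece (h z '' (g '' K)) := by
    rw [IsLocallyConstant.iff_exists_open]
    refine fun z => ⟨Metric.ball z ρ, Metric.isOpen_ball, Metric.mem_ball_self hρ, fun z' hz' => ?_⟩
    by_contra hne'
    have hzz : z' ≠ z := by
      rintro rfl
      exact hne' rfl
    have := subsingleton_inter_of_piece_ne ((hK'.image g.injective).image (h z').injective)
      ((hK'.image g.injective).image (h z).injective) hne'
    refine hzz (this ⟨hbig z' (Metric.mem_ball_self hρ), hbig z hz'⟩
      ⟨hbig z' ?_, hbig z (Metric.mem_ball_self hρ)⟩)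
    rw [Metric.mem_ball, dist_comm]
    exact hz'
  have : Nonempty X := ⟨o⟩
  have := hX.pathConnectedSpace
  apply hne
  have huniv : piece (h o '' (g '' K)) = univ := by
    refine eq_univ_of_forall fun z => ?_
    rw [hloc.apply_eq_of_preconnectedSpace o z]
    exact hbig z (Metric.mem_ball_self hρ)
  rw [← image_piece, ← image_piece] at huniv
  refine eq_univ_of_forall fun z => ?_
  obtain ⟨_, ⟨w, hw, rfl⟩, e⟩ : h o (g z) ∈ h o '' (g '' piece K) := huniv ▸ mem_univ _
  rwa [← g.injective ((h o).injective e)]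

/-- Two paths with the same distinct end points whose points no point separates. -/
def IsCorePair {x y : X} (p q : Path x y) : Prop :=
  x ≠ y ∧ Unseparated (range p ∪ range q)

namespace IsCorePair

variable {x y : X} {p q : Path x y}

theorem nontrivial (h : IsCorePair p q) : ({x, y} : Set X).Nontrivial :=
  ⟨x, by simp, y, by simp, h.1⟩

theorem pair_subset (p q : Path x y) : ({x, y} : Set X) ⊆ range p ∪ range q := by
  rintro _ (rfl | rfl)
  · exact Or.inl ⟨0, p.source⟩
  · exact Or.inl ⟨1, p.target⟩

theorem unseparated (h : IsCorePair p q) : Unseparated ({x, y} : Set X) :=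
  h.2.mono (pair_subset p q)

theorem left_mem (h : IsCorePair p q) (t : I) : p t ∈ piece {x, y} :=
  h.2.subset_piece_of_subset (pair_subset p q) (Or.inl ⟨t, rfl⟩)

theorem right_mem (h : IsCorePair p q) (t : I) : q t ∈ piece {x, y} :=
  h.2.subset_piece_of_subset (pair_subset p q) (Or.inr ⟨t, rfl⟩)

theorem left_mem_image (h : IsCorePair p q) (g : X ≃ᵢ X) (t : I) :
    g (p t) ∈ piece (g '' {x, y}) := by
  rw [← image_piece]
  exact mem_image_of_mem g (h.left_mem t)

theorem right_mem_image (h : IsCorePair p q) (g : X ≃ᵢ X) (t : I) :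
    g (q t) ∈ piece (g '' {x, y}) := by
  rw [← image_piece]
  exact mem_image_of_mem g (h.right_mem t)

theorem unseparated_image (h : IsCorePair p q) (g : X ≃ᵢ X) :
    Unseparated (g '' {x, y}) := h.unseparated.image g

theorem nontrivial_image (h : IsCorePair p q) (g : X ≃ᵢ X) :
    (g '' {x, y}).Nontrivial := h.nontrivial.image g.injective

theorem isGated (hX : IsGeodesicSpace X) (h : IsCorePair p q) (g : X ≃ᵢ X) :
    IsGated (piece (g '' {x, y})) :=
  hX.isGated_piece (h.unseparated_image g) (h.nontrivial_image g)

end IsCorePair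

theorem gate_eq_of_piece_ne (hX : IsGeodesicSpace X) {K K' : Set X} (hK : K.Nontrivial)
    (hK' : K'.Nontrivial) (hM : IsGated (piece K)) (hne : piece K ≠ piece K') {y y' : X}
    (hy : y ∈ piece K') (hy' : y' ∈ piece K') : gate hM y = gate hM y' :=
  gate_eq_of_unseparated hX hM (unseparated_piece hK') (subsingleton_inter_of_piece_ne hK hK' hne)
    hy hy'

end ManyPieces

/-! ### Lassos -/

section Loops

open Set unitInterval

variable {X Y : Type*} [TopologicalSpace X] [TopologicalSpace Y]

theorem Path.Homotopic.Quotient.eq_of_conj {o x y : X} {a : Path.Homotopic.Quotient o x}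
    {b c : Path.Homotopic.Quotient x y}
    (h : a.trans ((b.trans c.symm).trans a.symm) = .refl o) : b = c := by
  have cancel (u : Path.Homotopic.Quotient x x) : (u.trans a.symm).trans a = u := by
    simp [Path.Homotopic.Quotient.trans_assoc]
  have h1 : b.trans c.symm = .refl x := by
    have := congrArg (fun u => (a.symm.trans u).trans a) h
    simpa [← Path.Homotopic.Quotient.trans_assoc, cancel] using this
  have := congrArg (fun u => u.trans c) h1
  simpa [Path.Homotopic.Quotient.trans_assoc] using this

/-- The loop that runs along `s`, along `p`, back along `q`, and back along `s`. -/
noncomputable def lassoPath {o x y : X} (s : Path o x) (p q : Path x y) : Path o o :=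
  s.trans ((p.trans q.symm).trans s.symm)

theorem lassoPath_map {o x y : X} (s : Path o x) (p q : Path x y) {f : X → Y} (hf : Continuous f) :
    (lassoPath s p q).map hf = lassoPath (s.map hf) (p.map hf) (q.map hf) := by
  simp [lassoPath, Path.map_trans, Path.map_symm]

theorem lassoPath_homotopic_refl_iff {o x y : X} (s : Path o x) (p q : Path x y) :
    (lassoPath s p q).Homotopic (Path.refl o) ↔ p.Homotopic q := by
  rw [← Path.Homotopic.Quotient.eq, ← Path.Homotopic.Quotient.eq]
  simp only [lassoPath, Path.Homotopic.Quotient.mk_trans, Path.Homotopic.Quotient.mk_symm,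
    Path.Homotopic.Quotient.mk_refl]
  constructor
  · exact Path.Homotopic.Quotient.eq_of_conj
  · intro h
    simp [h]

theorem Path.Homotopic.of_map {x y : X} {p q : Path x y} {f : X → X} (hf : Continuous f)
    (hp : ∀ t, f (p t) = p t) (hq : ∀ t, f (q t) = q t) (h : (p.map hf).Homotopic (q.map hf)) :
    p.Homotopic q := by
  have hx : x = f x := by simpa using (hp 0).symm
  have hy : y = f y := by simpa using (hp 1).symm
  have := h.pathCast hx hy
  have e1 : (p.map hf).cast hx hy = p := by
    ext t
    exact hp t
  have e2 : (q.map hf).cast hx hy = q := by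
    ext t
    exact hq t
  rwa [e1, e2] at this

end Loops


/-! ### Lassos in different pieces -/

section ManyPieces

open Set unitInterval

variable {X : Type*} [MetricSpace X]

/-- The retraction onto a piece kills a lasso around a core pair in another piece. -/
theorem IsCorePair.map_eq_of_piece_ne (hX : IsGeodesicSpace X) {x y : X} {p q : Path x y}
    (h : IsCorePair p q) (g : X ≃ᵢ X) {K : Set X} (hK : K.Nontrivial) (hM : IsGated (piece K))
    (hne : piece K ≠ piece (g '' {x, y})) :
    ((p.map g.continuous).map (gateMap hX hM).continuous) =
      ((q.map g.continuous).map (gateMap hX hM).continuous) := by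
  ext t
  exact gate_eq_of_piece_ne hX hK (h.nontrivial_image g) hM hne (h.left_mem_image g t)
    (h.right_mem_image g t)

theorem IsCorePair.homotopic_of_map (hX : IsGeodesicSpace X) {x y : X} {p q : Path x y}
    (h : IsCorePair p q) (g : X ≃ᵢ X)
    (hh : ((p.map g.continuous).map (gateMap hX (h.isGated hX g)).continuous).Homotopic
      ((q.map g.continuous).map (gateMap hX (h.isGated hX g)).continuous)) : p.Homotopic q := by
  have h1 := Path.Homotopic.of_map (gateMap hX (h.isGated hX g)).continuous
    (p := p.map g.continuous) (q := q.map g.continuous)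
    (fun t => gate_eq_self _ (h.left_mem_image g t))
    (fun t => gate_eq_self _ (h.right_mem_image g t)) hh
  have h2 := h1.map ⟨g.symm, g.symm.continuous⟩
  refine Path.Homotopic.of_map (f := g.symm ∘ g) (g.symm.continuous.comp g.continuous)
    (fun t => by simp) (fun t => by simp) ?_
  exact h2

/-- One lasso is run around a translated core pair in each of uncountably many pieces. The
retraction onto one of the pieces fixes the core pair there and makes the two sides of any other
equal, so a homotopy between two lassos would fill the core pair. -/
theorem uncountable_of_corePair_not_homotopic [CompleteSpace X] (hX : IsGeodesicSpace X)
    (hhom : IsHomogeneousMetric X)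
    (hcut : ∀ K : Set X, Unseparated K → K.Nontrivial → piece K ≠ univ)
    {x y : X} {p q : Path x y} (h : IsCorePair p q) (hpq : ¬ p.Homotopic q) (o : X) :
    Uncountable (FundamentalGroup X o) := by
  rw [← not_countable_iff]
  intro hc
  apply not_countable_pieces hX hhom h.unseparated h.nontrivial
    (hcut _ h.unseparated h.nontrivial) (p := x) (by simp) o one_pos
  set 𝒮 := {S : Set X | ∃ g : X ≃ᵢ X, g x ∈ Metric.ball o 1 ∧ S = piece (g '' {x, y})}
  choose g _ hg using fun S : 𝒮 => S.2
  let s : ∀ S : 𝒮, Path o (g S x) := fun S => (hX o (g S x)).choose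
  let F : 𝒮 → FundamentalGroup X o := fun S => Path.Homotopic.Quotient.mk
    (lassoPath (s S) (p.map (g S).continuous) (q.map (g S).continuous))
  have hF : Function.Injective F := by
    intro S S' hSS
    by_contra hne
    have hne' : piece (g S '' {x, y}) ≠ piece (g S' '' {x, y}) := by
      rw [← hg, ← hg]
      exact fun e => hne (Subtype.ext e)
    have hhom' := (Path.Homotopic.Quotient.exact hSS).map (gateMap hX (h.isGated hX (g S)))
    rw [lassoPath_map, lassoPath_map] at hhom'
    have h2 := (lassoPath_homotopic_refl_iff
      ((s S').map (gateMap hX (h.isGated hX (g S))).continuous)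
      ((p.map (g S').continuous).map (gateMap hX (h.isGated hX (g S))).continuous)
      ((q.map (g S').continuous).map (gateMap hX (h.isGated hX (g S))).continuous)).2 (by
        rw [h.map_eq_of_piece_ne hX (g S') (h.nontrivial_image (g S)) (h.isGated hX (g S)) hne'])
    have h3 := (lassoPath_homotopic_refl_iff _ _ _).1 (hhom'.trans h2)
    exact hpq (h.homotopic_of_map hX (g S) h3)
  exact hF.countable

end ManyPieces


/-! ### Infinite concatenation -/

section InfiniteConcatenation

open Set unitInterval

variable {Y : Type*}

/-- The concatenation of the first `n` terms of a sequence of paths, the `k`-th of which is run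
through on `[1 - 2⁻ᵏ, 1 - 2⁻ᵏ⁻¹]`. -/
noncomputable def concatAux : ℕ → (ℕ → ℝ → Y) → ℝ → Y
  | 0, f, t => f 0 (min (2 * t) 1)
  | n + 1, f, t => if t ≤ 1 / 2 then f 0 (2 * t) else concatAux n (fun k => f (k + 1)) (2 * t - 1)

theorem concatAux_succ (f : ℕ → ℝ → Y) (n : ℕ) {t : ℝ} (ht : t < 1 - (1 / 2) ^ n) :
    concatAux n f t = concatAux (n + 1) f t := by
  induction n generalizing f t with
  | zero =>
    simp only [pow_zero, sub_self] at ht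
    rw [concatAux, concatAux, if_pos (by linarith), min_eq_left (by linarith)]
  | succ n ih =>
    rw [concatAux, concatAux]
    split_ifs with h
    · rfl
    · refine ih _ ?_
      rw [pow_succ] at ht
      linarith

theorem concatAux_eq (f : ℕ → ℝ → Y) {m n : ℕ} {t : ℝ} (hm : t < 1 - (1 / 2) ^ m)
    (hmn : m ≤ n) : concatAux n f t = concatAux m f t := by
  induction n, hmn using Nat.le_induction with
  | base => rfl
  | succ n hmn ih =>
    rw [← ih, concatAux_succ f n]
    refine hm.trans_le ?_
    have := pow_le_pow_of_le_one (a := (1 / 2 : ℝ)) (by norm_num) (by norm_num) hmn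
    linarith

theorem exists_lt_one_sub_pow {t : ℝ} (ht : t < 1) : ∃ n : ℕ, t < 1 - (1 / 2) ^ n := by
  obtain ⟨n, hn⟩ := exists_pow_lt_of_lt_one (sub_pos.2 ht) (by norm_num : (1 / 2 : ℝ) < 1)
  exact ⟨n, by linarith⟩

open Classical in
/-- The infinite concatenation of a sequence of paths that converges to `y`. -/
noncomputable def concatFun (f : ℕ → ℝ → Y) (y : Y) (t : ℝ) : Y :=
  if h : t < 1 then concatAux (exists_lt_one_sub_pow h).choose f t else y

theorem concatFun_eq_concatAux (f : ℕ → ℝ → Y) (y : Y) {n : ℕ} {t : ℝ}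
    (ht : t < 1 - (1 / 2) ^ n) : concatFun f y t = concatAux n f t := by
  have h1 : t < 1 := ht.trans_le (by linarith [pow_pos (by norm_num : (0 : ℝ) < 1 / 2) n])
  rw [concatFun, dif_pos h1]
  have h2 := (exists_lt_one_sub_pow h1).choose_spec
  rcases le_total n (exists_lt_one_sub_pow h1).choose with h | h
  · exact concatAux_eq f ht h
  · exact (concatAux_eq f h2 h).symm

theorem concatFun_of_one_le (f : ℕ → ℝ → Y) (y : Y) {t : ℝ} (ht : 1 ≤ t) :
    concatFun f y t = y := by
  rw [concatFun, dif_neg (not_lt.2 ht)]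

theorem concatFun_eq (f : ℕ → ℝ → Y) (y : Y) (t : ℝ) :
    concatFun f y t =
      if t ≤ 1 / 2 then f 0 (2 * t) else concatFun (fun k => f (k + 1)) y (2 * t - 1) := by
  by_cases h : t < 1
  · obtain ⟨n, hn⟩ := exists_lt_one_sub_pow h
    have hn' : t < 1 - (1 / 2) ^ (n + 1) := by
      rw [pow_succ]
      linarith [pow_pos (by norm_num : (0 : ℝ) < 1 / 2) n]
    rw [concatFun_eq_concatAux f y hn', concatAux]
    split_ifs with h'
    · rfl
    · rw [concatFun_eq_concatAux]
      rw [pow_succ] at hn'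
      linarith
  · rw [concatFun_of_one_le f y (not_lt.1 h), if_neg (by linarith),
      concatFun_of_one_le _ y (by linarith)]

theorem concatAux_mem {f : ℕ → ℝ → Y} {U : Set Y} (hf : ∀ k, ∀ s ∈ Icc (0 : ℝ) 1, f k s ∈ U)
    (n : ℕ) {t : ℝ} (ht : t ∈ Icc (0 : ℝ) 1) : concatAux n f t ∈ U := by
  induction n generalizing f t with
  | zero => exact hf 0 _ ⟨le_min (by linarith [ht.1]) zero_le_one, min_le_right _ _⟩
  | succ n ih =>
    rw [concatAux]
    split_ifs with h
    · exact hf 0 _ ⟨by linarith [ht.1], by linarith⟩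
    · exact ih (fun k => hf (k + 1)) ⟨by linarith, by linarith [ht.2]⟩

theorem concatFun_mem {f : ℕ → ℝ → Y} {y : Y} {U : Set Y} {n : ℕ}
    (hf : ∀ k, n ≤ k → ∀ s ∈ Icc (0 : ℝ) 1, f k s ∈ U) (hy : y ∈ U) {t : ℝ}
    (ht : 1 - (1 / 2) ^ n < t) (ht0 : 0 ≤ t) : concatFun f y t ∈ U := by
  induction n generalizing f t with
  | zero =>
    by_cases h : t < 1
    · rw [concatFun, dif_pos h]
      exact concatAux_mem (fun k => hf k k.zero_le) _ ⟨ht0, h.le⟩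
    · rwa [concatFun_of_one_le f y (not_lt.1 h)]
  | succ n ih =>
    rw [pow_succ] at ht
    have h1 : (1 / 2 : ℝ) ^ n ≤ 1 := pow_le_one₀ (by norm_num) (by norm_num)
    rw [concatFun_eq, if_neg (by linarith)]
    exact ih (fun k hk => hf (k + 1) (by lia)) (by linarith) (by linarith)

variable [TopologicalSpace Y]

/-- Stopped at time `1 - 2⁻ⁿ⁻¹`, the concatenation involves finitely many paths, and induction on
their number glues at `1 / 2`. -/
theorem continuous_concatFun_min {f : ℕ → ℝ → Y} (y : Y) (hf : ∀ k, Continuous (f k))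
    (h1 : ∀ k, f k 1 = f (k + 1) 0) (n : ℕ) :
    Continuous fun t : ℝ => concatFun f y (min t (1 - (1 / 2) ^ (n + 1))) := by
  induction n generalizing f with
  | zero =>
    have : (fun t : ℝ => concatFun f y (min t (1 - (1 / 2) ^ (0 + 1)))) =
        fun t => f 0 (2 * min t (1 / 2)) := by
      funext t
      rw [concatFun_eq, if_pos]
      · norm_num
      · refine (min_le_right _ _).trans (by norm_num)
    rw [this]
    have := hf 0
    fun_prop
  | succ n ih =>
    have : (fun t : ℝ => concatFun f y (min t (1 - (1 / 2) ^ (n + 1 + 1)))) =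
        fun t => if t ≤ 1 / 2 then f 0 (2 * t) else
          concatFun (fun k => f (k + 1)) y (min (2 * t - 1) (1 - (1 / 2) ^ (n + 1))) := by
      funext t
      have h2 : (1 / 2 : ℝ) ^ (n + 1) ≤ 1 / 2 := by
        rw [pow_succ]
        have : (1 / 2 : ℝ) ^ n ≤ 1 := pow_le_one₀ (by norm_num) (by norm_num)
        linarith
      rw [pow_succ _ (n + 1)]
      by_cases ht : t ≤ 1 / 2
      · rw [if_pos ht, concatFun_eq, min_eq_left (by linarith), if_pos ht]
      · rw [if_neg ht, concatFun_eq, if_neg]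
        · congr 1
          rcases le_total t (1 - (1 / 2) ^ (n + 1) * (1 / 2)) with h | h
          · rw [min_eq_left h, min_eq_left (by linarith)]
          · rw [min_eq_right h, min_eq_right (by linarith)]
            ring
        · rw [not_le, lt_min_iff]
          constructor <;> linarith
    rw [this]
    have h3 := ih (fun k => hf (k + 1)) (fun k => h1 (k + 1))
    refine Continuous.if_le (by have := hf 0; fun_prop) ?_ continuous_id continuous_const ?_
    · exact h3.comp (by fun_prop : Continuous fun t : ℝ => 2 * t - 1)
    · rintro t rfl
      rw [min_eq_left, concatFun_eq, if_pos (by norm_num)]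
      · norm_num [h1]
      · have : (1 / 2 : ℝ) ^ (n + 1) ≤ 1 := pow_le_one₀ (by norm_num) (by norm_num)
        linarith

theorem continuousOn_concatFun {f : ℕ → ℝ → Y} {y : Y} (hf : ∀ k, Continuous (f k))
    (h1 : ∀ k, f k 1 = f (k + 1) 0)
    (hy : ∀ U ∈ 𝓝 y, ∃ n, ∀ k, n ≤ k → ∀ s ∈ Icc (0 : ℝ) 1, f k s ∈ U) :
    ContinuousOn (concatFun f y) (Icc 0 1) := by
  intro t ht
  rcases ht.2.lt_or_eq with h | rfl
  · obtain ⟨n, hn⟩ := exists_lt_one_sub_pow h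
    have hn' : t < 1 - (1 / 2) ^ (n + 1) := by
      rw [pow_succ]
      linarith [pow_pos (by norm_num : (0 : ℝ) < 1 / 2) n]
    refine ((continuous_concatFun_min y hf h1 n).continuousAt.congr ?_).continuousWithinAt
    filter_upwards [gt_mem_nhds hn'] with s hs
    rw [min_eq_left hs.le]
  · intro U hU
    rw [concatFun_of_one_le f y le_rfl] at hU
    obtain ⟨n, hn⟩ := hy U hU
    rw [Filter.mem_map]
    have : Ioi (1 - (1 / 2 : ℝ) ^ n) ∈ 𝓝 (1 : ℝ) :=
      Ioi_mem_nhds (by linarith [pow_pos (by norm_num : (0 : ℝ) < 1 / 2) n])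
    filter_upwards [mem_nhdsWithin_of_mem_nhds this, self_mem_nhdsWithin] with s hs hs'
    exact concatFun_mem hn (mem_of_mem_nhds hU) hs hs'.1

end InfiniteConcatenation


/-! ### Infinite chains of homotopies -/

section DyadicFilling

open Set unitInterval

variable {X : Type*} [MetricSpace X]

theorem concatFun_zero {Y : Type*} (f : ℕ → ℝ → Y) (y : Y) : concatFun f y 0 = f 0 0 := by
  rw [concatFun_eq, if_pos (by norm_num), mul_zero]

/-- An infinite chain of homotopies that converges uniformly to a path. -/
theorem Path.Homotopic.of_tendsto {x y : X} (P : ℕ → Path x y) (τ : Path x y)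
    (H : ∀ k, (P k).Homotopy (P (k + 1)))
    (hH : ∀ ε > 0, ∃ n, ∀ k, n ≤ k → ∀ s t, dist (H k (s, t)) (τ t) ≤ ε) :
    (P 0).Homotopic τ := by
  -- A homotopy is a path in `C(I, X)` with the uniform metric. The infinite concatenation of these
  -- paths converges to `τ` and is the required homotopy.
  let f : ℕ → ℝ → C(I, X) := fun k s => (H k).toHomotopy.extend s
  have hfI : ∀ k (s : I) (t : I), f k s t = H k (s, t) := fun k s t => by
    simp only [f]
    rw [ContinuousMap.Homotopy.extend_apply_coe]
    rfl
  have hf : ∀ k, Continuous (f k) := fun k => (H k).toHomotopy.extend.continuous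
  have h1 : ∀ k, f k 1 = f (k + 1) 0 := by
    intro k
    ext t
    have e1 := hfI k 1 t
    have e2 := hfI (k + 1) 0 t
    simp only [Icc.coe_one, Icc.coe_zero] at e1 e2
    rw [e1, e2, ContinuousMap.HomotopyWith.apply_one, ContinuousMap.HomotopyWith.apply_zero]
  have hlim : ∀ U ∈ 𝓝 (τ : C(I, X)), ∃ n, ∀ k, n ≤ k → ∀ s ∈ Icc (0 : ℝ) 1, f k s ∈ U := by
    intro U hU
    obtain ⟨ε, hε, hball⟩ := Metric.mem_nhds_iff.1 hU
    obtain ⟨n, hn⟩ := hH (ε / 2) (half_pos hε)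
    refine ⟨n, fun k hk s hs => hball ?_⟩
    rw [Metric.mem_ball]
    refine lt_of_le_of_lt ((ContinuousMap.dist_le (half_pos hε).le).2 fun t => ?_) (half_lt_self hε)
    rw [hfI k ⟨s, hs⟩ t]
    exact hn k hk _ _
  have hcont := continuousOn_concatFun hf h1 hlim
  have hends : ∀ s : I, concatFun f (τ : C(I, X)) s ∈ {g : C(I, X) | g 0 = x ∧ g 1 = y} := by
    have hends' : ∀ k, ∀ s ∈ Icc (0 : ℝ) 1, f k s ∈ {g : C(I, X) | g 0 = x ∧ g 1 = y} := by
      intro k s hs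
      exact ⟨by rw [hfI k ⟨s, hs⟩, (H k).source], by rw [hfI k ⟨s, hs⟩, (H k).target]⟩
    intro s
    -- `concatFun_mem` with `n = 0` needs a positive time, so the start is treated apart.
    rcases s.2.1.eq_or_lt with h | h
    · rw [← h, concatFun_zero]
      exact hends' 0 0 (by simp)
    · exact concatFun_mem (n := 0) (fun k _ => hends' k) ⟨τ.source, τ.target⟩ (by simpa using h) h.le
  refine ⟨⟨⟨⟨fun z => concatFun f (τ : C(I, X)) z.1 z.2, ?_⟩, ?_, ?_⟩, ?_⟩⟩
  · have := continuousOn_iff_continuous_domRestrict.1 hcont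
    exact ContinuousMap.continuous_uncurry_of_continuous ⟨_, this⟩
  · intro t
    have : concatFun f (τ : C(I, X)) ((0 : I) : ℝ) t = f 0 ((0 : I) : ℝ) t := by
      rw [Icc.coe_zero, concatFun_zero]
    change concatFun f (τ : C(I, X)) ((0 : I) : ℝ) t = _
    rw [this, hfI 0 0 t, ContinuousMap.HomotopyWith.apply_zero]
  · intro t
    change concatFun f (τ : C(I, X)) ((1 : I) : ℝ) t = _
    rw [Icc.coe_one, concatFun_of_one_le f _ le_rfl]
    rfl
  · intro s t ht
    change concatFun f (τ : C(I, X)) (s : ℝ) t = _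
    rcases ht with rfl | ht
    · rw [(hends s).1]
      exact (P 0).source.symm
    · rw [mem_singleton_iff.1 ht, (hends s).2]
      exact (P 0).target.symm

/-! ### Dyadic filling -/

/-- The midpoint of the unit interval. -/
noncomputable def unitInterval.mid : I := ⟨1 / 2, by norm_num, by norm_num⟩

/-- The first half of a path. -/
noncomputable def Path.firstHalf {x y : X} (τ : Path x y) : Path x (τ unitInterval.mid) :=
  (τ.subpath 0 unitInterval.mid).cast τ.source.symm rfl

/-- The second half of a path. -/
noncomputable def Path.secondHalf {x y : X} (τ : Path x y) : Path (τ unitInterval.mid) y :=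
  (τ.subpath unitInterval.mid 1).cast rfl τ.target.symm

theorem Path.exists_firstHalf_eq {x y : X} (τ : Path x y) (t : I) :
    ∃ u : I, (u : ℝ) = t / 2 ∧ τ.firstHalf t = τ u :=
  ⟨Icc.convexComb 0 unitInterval.mid t, by simp [unitInterval.mid]; ring, rfl⟩

theorem Path.exists_secondHalf_eq {x y : X} (τ : Path x y) (t : I) :
    ∃ u : I, (u : ℝ) = (t + 1) / 2 ∧ τ.secondHalf t = τ u :=
  ⟨Icc.convexComb unitInterval.mid 1 t, by simp [unitInterval.mid]; ring, rfl⟩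

/-- Geodesic paths from `a` to `b`. -/
abbrev GeodesicPath (a b : X) : Type _ := {g : Path a b // IsGeodesicPath g}

/-- A choice, for every geodesic and every third point, of a filled geodesic triangle. -/
structure TriangleFilling (X : Type*) [MetricSpace X] where
  left : ∀ {a b : X}, GeodesicPath a b → ∀ m, GeodesicPath a m
  right : ∀ {a b : X}, GeodesicPath a b → ∀ m, GeodesicPath m b
  fill : ∀ {a b : X} (g : GeodesicPath a b) (m : X),
    g.1.Homotopy ((left g m).1.trans (right g m).1)

namespace TriangleFilling

variable (D : TriangleFilling X)

/-- The inscribed polygons of a path with `2 ^ n` sides. -/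
noncomputable def polygon : ℕ → ∀ {a b : X}, GeodesicPath a b → Path a b → Path a b
  | 0, _, _, g, _ => g.1
  | n + 1, _, _, g, τ =>
    (polygon n (D.left g (τ unitInterval.mid)) τ.firstHalf).trans
      (polygon n (D.right g (τ unitInterval.mid)) τ.secondHalf)

/-- The homotopies between consecutive inscribed polygons. -/
noncomputable def polygonHomotopy : ∀ (n : ℕ) {a b : X} (g : GeodesicPath a b) (τ : Path a b),
    (D.polygon n g τ).Homotopy (D.polygon (n + 1) g τ)
  | 0, _, _, g, τ => D.fill g (τ unitInterval.mid)
  | n + 1, _, _, g, τ =>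
    (polygonHomotopy n (D.left g (τ unitInterval.mid)) τ.firstHalf).hcomp
      (polygonHomotopy n (D.right g (τ unitInterval.mid)) τ.secondHalf)

/-- Halving a path doubles its modulus `η`. After `n` halvings `η` is at least `1`, so each
remaining subpath moves by at most `δ` and the bound for triangles applies. The factor `2` covers
the way from the filling to the vertex and from there to the path. -/
theorem dist_polygonHomotopy_le {ε δ : ℝ} (hδε : δ ≤ ε)
    (hD : ∀ {a b : X} (g : GeodesicPath a b) (m : X), dist a b ≤ δ → dist a m ≤ δ →
      dist m b ≤ δ → ∀ z, dist (D.fill g m z) a ≤ ε) (n : ℕ) {a b : X} (g : GeodesicPath a b)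
    (τ : Path a b) {η : ℝ} (hτ : ∀ s t : I, |(s : ℝ) - t| ≤ η → dist (τ s) (τ t) ≤ δ)
    (hη : 1 ≤ η * 2 ^ n) (z : I × I) : dist (D.polygonHomotopy n g τ z) (τ z.2) ≤ 2 * ε := by
  induction n generalizing a b τ η z with
  | zero =>
    have h : ∀ s t : I, dist (τ s) (τ t) ≤ δ := fun s t => hτ s t (by
      rw [pow_zero, mul_one] at hη
      refine le_trans ?_ hη
      rw [abs_le]
      constructor <;> linarith [s.2.1, s.2.2, t.2.1, t.2.2])
    have h1 := hD g (τ unitInterval.mid) (by simpa using h 0 1)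
      (by simpa using h 0 unitInterval.mid) (by simpa using h unitInterval.mid 1) z
    have h2 := h 0 z.2
    rw [τ.source] at h2
    calc dist (D.fill g (τ unitInterval.mid) z) (τ z.2)
        ≤ dist (D.fill g (τ unitInterval.mid) z) a + dist a (τ z.2) := dist_triangle _ _ _
      _ ≤ 2 * ε := by linarith
  | succ n ih =>
    have hη' : 1 ≤ (2 * η) * 2 ^ n := by
      rw [pow_succ] at hη
      linarith
    have key : D.polygonHomotopy (n + 1) g τ z = _ := Path.Homotopy.hcomp_apply
      (D.polygonHomotopy n (D.left g (τ unitInterval.mid)) τ.firstHalf)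
      (D.polygonHomotopy n (D.right g (τ unitInterval.mid)) τ.secondHalf) z
    rw [key]
    split_ifs with hz
    · have := ih (D.left g (τ unitInterval.mid)) τ.firstHalf (η := 2 * η) (fun s t hst => by
        obtain ⟨u, hu, hu'⟩ := τ.exists_firstHalf_eq s
        obtain ⟨v, hv, hv'⟩ := τ.exists_firstHalf_eq t
        rw [hu', hv']
        refine hτ u v ?_
        rw [hu, hv, ← sub_div, abs_div, abs_two]
        linarith) hη' (z.1, ⟨2 * z.2, (unitInterval.mul_pos_mem_iff zero_lt_two).2
          ⟨z.2.2.1, hz⟩⟩)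
      obtain ⟨u, hu, hu'⟩ := τ.exists_firstHalf_eq ⟨2 * z.2,
        (unitInterval.mul_pos_mem_iff zero_lt_two).2 ⟨z.2.2.1, hz⟩⟩
      have huz : u = z.2 := Subtype.ext (by rw [hu]; simp)
      rw [huz] at hu'
      rw [← hu']
      exact this
    · have hz' : 2 * (z.2 : ℝ) - 1 ∈ I :=
        unitInterval.two_mul_sub_one_mem_iff.2 ⟨(not_le.1 hz).le, z.2.2.2⟩
      have := ih (D.right g (τ unitInterval.mid)) τ.secondHalf (η := 2 * η) (fun s t hst => by
        obtain ⟨u, hu, hu'⟩ := τ.exists_secondHalf_eq s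
        obtain ⟨v, hv, hv'⟩ := τ.exists_secondHalf_eq t
        rw [hu', hv']
        refine hτ u v ?_
        rw [hu, hv, ← sub_div, abs_div, abs_two]
        have : (s : ℝ) + 1 - (t + 1) = s - t := by ring
        rw [this]
        linarith) hη' (z.1, ⟨2 * z.2 - 1, hz'⟩)
      obtain ⟨u, hu, hu'⟩ := τ.exists_secondHalf_eq ⟨2 * z.2 - 1, hz'⟩
      have huz : u = z.2 := Subtype.ext (by rw [hu]; simp)
      rw [huz] at hu'
      rw [← hu']
      exact this

/-- If small geodesic triangles have small fillings, then every path is homotopic to a geodesic. -/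
theorem homotopic (hD : ∀ ε > 0, ∃ δ > 0, ∀ {a b : X} (g : GeodesicPath a b) (m : X),
    dist a b ≤ δ → dist a m ≤ δ → dist m b ≤ δ → ∀ z, dist (D.fill g m z) a ≤ ε)
    {a b : X} (g : GeodesicPath a b) (τ : Path a b) : g.1.Homotopic τ := by
  refine Path.Homotopic.of_tendsto (fun n => D.polygon n g τ) τ
    (fun n => D.polygonHomotopy n g τ) fun ε hε => ?_
  obtain ⟨δ, hδ, hδD⟩ := hD (ε / 2) (half_pos hε)
  have huc := CompactSpace.uniformContinuous_of_continuous τ.continuous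
  obtain ⟨η, hη, hητ⟩ := Metric.uniformContinuous_iff.1 huc (min δ (ε / 2))
    (lt_min hδ (half_pos hε))
  -- The modulus used below is `η / 2`, since uniform continuity speaks of distances strictly below
  -- `η`; so `2 ^ n` has to exceed `2 / η`.
  obtain ⟨n, hn⟩ := pow_unbounded_of_one_lt (2 / η) (one_lt_two)
  refine ⟨n, fun k hk s t => ?_⟩
  have := D.dist_polygonHomotopy_le (ε := ε / 2) (δ := min δ (ε / 2)) (min_le_right _ _)
    (fun g m h1 h2 h3 => hδD g m (h1.trans (min_le_left _ _)) (h2.trans (min_le_left _ _))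
      (h3.trans (min_le_left _ _))) k g τ (η := η / 2)
    (fun s t hst => (hητ (by
      rw [Subtype.dist_eq, Real.dist_eq]
      linarith)).le) ?_ (s, t)
  · linarith
  · have h2 : (2 : ℝ) ^ n ≤ 2 ^ k := pow_le_pow_right₀ one_le_two hk
    rw [div_lt_iff₀ hη] at hn
    nlinarith

end TriangleFilling

end DyadicFilling


/-! ### Subpaths, detours, and homotopies inside a set -/

section Subpaths

open Set unitInterval

variable {X : Type*} [TopologicalSpace X]

/-- The part of a path before time `t`. -/
noncomputable def Path.init {x y : X} (γ : Path x y) (t : I) : Path x (γ t) :=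
  (γ.subpath 0 t).cast γ.source.symm rfl

/-- The part of a path after time `t`. -/
noncomputable def Path.tail {x y : X} (γ : Path x y) (t : I) : Path (γ t) y :=
  (γ.subpath t 1).cast rfl γ.target.symm

theorem Path.range_init {x y : X} (γ : Path x y) (t : I) : range (γ.init t) = γ '' Icc 0 t :=
  γ.range_subpath_of_le 0 t bot_le

theorem Path.range_tail {x y : X} (γ : Path x y) (t : I) : range (γ.tail t) = γ '' Icc t 1 :=
  γ.range_subpath_of_le t 1 le_top

namespace Path.Homotopic.Quotient

theorem init_trans_subpath {x y : X} (γ : Path x y) (s t : I) :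
    (mk (γ.init s)).trans (mk (γ.subpath s t)) = mk (γ.init t) := by
  rw [← mk_trans, Quotient.eq]
  have h : (γ.init s).trans (γ.subpath s t) =
      ((γ.subpath 0 s).trans (γ.subpath s t)).cast γ.source.symm rfl := by
    ext
    rfl
  rw [h]
  exact Path.Homotopic.pathCast ⟨Path.Homotopy.subpathTransSubpath γ 0 s t⟩ _ _

theorem init_trans_tail {x y : X} (γ : Path x y) (t : I) :
    (mk (γ.init t)).trans (mk (γ.tail t)) = mk γ := by
  rw [← mk_trans, Quotient.eq]
  have h : (γ.init t).trans (γ.tail t) =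
      ((γ.subpath 0 t).trans (γ.subpath t 1)).cast γ.source.symm γ.target.symm := by
    ext
    rfl
  rw [h]
  have h2 : γ = (γ.subpath 0 1).cast γ.source.symm γ.target.symm := by
    ext
    simp
  conv_rhs => rw [h2]
  exact Path.Homotopic.pathCast ⟨Path.Homotopy.subpathTransSubpath γ 0 t 1⟩ _ _

end Path.Homotopic.Quotient

open Path.Homotopic.Quotient in
/-- Replacing a subpath of `G` by a homotopic path that makes a detour along `E`. -/
theorem Path.Homotopic.detour {a b m : X} (G : Path a b) (u v : I) (E : Path (G u) m) (s : I)
    (C : Path (G v) (E s))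
    (h : (G.subpath u v).Homotopic ((E.init s).trans C.symm)) :
    G.Homotopic (((G.init u).trans E).trans
      ((E.tail s).symm.trans (C.symm.trans (G.tail v)))) := by
  rw [← Quotient.eq] at h ⊢
  rw [mk_trans, mk_symm] at h
  simp only [mk_trans, mk_symm]
  rw [← init_trans_tail G v, ← init_trans_subpath G u v, h, ← init_trans_tail E s]
  have cancel {x y z : X} (α : Path.Homotopic.Quotient x y) (β : Path.Homotopic.Quotient x z) :
      α.trans (α.symm.trans β) = β := by
    rw [← Path.Homotopic.Quotient.trans_assoc, Path.Homotopic.Quotient.trans_symm,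
      Path.Homotopic.Quotient.refl_trans]
  simp only [Path.Homotopic.Quotient.trans_assoc, cancel]

/-- Homotopic inside `U`. -/
def Path.HomotopicIn (U : Set X) {x y : X} (p q : Path x y) : Prop :=
  ∃ F : p.Homotopy q, ∀ z, F z ∈ U

/-- A path in `U` as a path of the subspace. -/
def Path.restrictTo {U : Set X} {x y : X} (p : Path x y) (h : ∀ t, p t ∈ U) :
    Path (⟨x, by simpa using h 0⟩ : U) ⟨y, by simpa using h 1⟩ where
  toFun t := ⟨p t, h t⟩
  continuous_toFun := by fun_prop
  source' := by simp
  target' := by simp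

theorem Path.HomotopicIn.restrictTo {U : Set X} {x y : X} {p q : Path x y}
    (h : p.HomotopicIn U q) (hp : ∀ t, p t ∈ U) (hq : ∀ t, q t ∈ U) :
    (p.restrictTo hp).Homotopic (q.restrictTo hq) := by
  obtain ⟨F, hF⟩ := h
  refine ⟨⟨⟨⟨fun z => ⟨F z, hF z⟩, by fun_prop⟩, ?_, ?_⟩, ?_⟩⟩
  · intro t
    exact Subtype.ext (F.apply_zero t)
  · intro t
    exact Subtype.ext (F.apply_one t)
  · intro s t ht
    exact Subtype.ext (F.prop' s t ht)

theorem Path.HomotopicIn.of_homotopic {U : Set X} {x y : U} {p q : Path x y}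
    (h : p.Homotopic q) :
    (p.map continuous_subtype_val).HomotopicIn U (q.map continuous_subtype_val) := by
  obtain ⟨F⟩ := h
  exact ⟨F.map ⟨_, continuous_subtype_val⟩, fun z => (F z).2⟩

theorem Path.HomotopicIn.mono {U V : Set X} {x y : X} {p q : Path x y}
    (h : p.HomotopicIn U q) (hUV : U ⊆ V) : p.HomotopicIn V q :=
  h.imp fun _ hF z => hUV (hF z)

theorem Path.HomotopicIn.left_mem {U : Set X} {x y : X} {p q : Path x y}
    (h : p.HomotopicIn U q) (t : I) : p t ∈ U := by
  obtain ⟨F, hF⟩ := h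
  simpa using hF (0, t)

theorem Path.HomotopicIn.right_mem {U : Set X} {x y : X} {p q : Path x y}
    (h : p.HomotopicIn U q) (t : I) : q t ∈ U := by
  obtain ⟨F, hF⟩ := h
  simpa using hF (1, t)

theorem Path.coe_trans_eq {U : Set X} {x y z : U} {x' y' z' : X} {p : Path x y} {q : Path y z}
    {p' : Path x' y'} {q' : Path y' z'} (hp : ∀ t, (p t : X) = p' t) (hq : ∀ t, (q t : X) = q' t)
    (t : I) : ((p.trans q) t : X) = (p'.trans q') t := by
  rw [Path.trans_apply, Path.trans_apply]
  split_ifs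
  · exact hp _
  · exact hq _

/-- The cancellation of `Path.Homotopic.detour` takes place in the fundamental groupoid, so it is
carried out in the subspace `U` and the homotopy is pushed forward. -/
theorem Path.HomotopicIn.detour {U : Set X} {a b m : X} (G : Path a b) (u v : I)
    (E : Path (G u) m) (s : I) (C : Path (G v) (E s)) (hG : ∀ t, G t ∈ U) (hE : ∀ t, E t ∈ U)
    (hC : ∀ t, C t ∈ U) (h : (G.subpath u v).HomotopicIn U ((E.init s).trans C.symm)) :
    G.HomotopicIn U (((G.init u).trans E).trans
      ((E.tail s).symm.trans (C.symm.trans (G.tail v)))) := by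
  have h' := h.restrictTo h.left_mem h.right_mem
  have e1 : ((E.init s).trans C.symm).restrictTo h.right_mem =
      ((E.restrictTo hE).init s).trans (C.restrictTo hC).symm := by
    ext t
    exact (Path.coe_trans_eq (fun _ => rfl) (fun _ => rfl) t).symm
  rw [e1] at h'
  have := Path.HomotopicIn.of_homotopic
    (Path.Homotopic.detour (G.restrictTo hG) u v (E.restrictTo hE) s (C.restrictTo hC) h')
  have e2 : (((G.init u).trans E).trans ((E.tail s).symm.trans (C.symm.trans (G.tail v)))) =
      ((((G.restrictTo hG).init u).trans (E.restrictTo hE)).trans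
        (((E.restrictTo hE).tail s).symm.trans ((C.restrictTo hC).symm.trans
          ((G.restrictTo hG).tail v)))).map continuous_subtype_val := by
    ext t
    exact (Path.coe_trans_eq (Path.coe_trans_eq (fun _ => rfl) fun _ => rfl)
      (Path.coe_trans_eq (fun _ => rfl) (Path.coe_trans_eq (fun _ => rfl) fun _ => rfl)) t).symm
  rw [e2]
  exact this

end Subpaths

/-! ### Geodesic paths and simple triangles -/

section Triangles

open Set unitInterval

variable {X : Type*} [MetricSpace X]

theorem isGeodesicPath_iff {a b : X} {γ : Path a b} :
    IsGeodesicPath γ ↔ ∃ f : I → ℝ, ∀ s t, s ≤ t → dist (γ s) (γ t) = f t - f s := by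
  constructor
  · intro h
    refine ⟨fun t => dist a (γ t), fun s t hst => ?_⟩
    have := h 0 s t bot_le hst
    rw [γ.source] at this
    linarith
  · rintro ⟨f, hf⟩ s t u hst htu
    rw [hf s t hst, hf t u htu, hf s u (hst.trans htu)]
    ring

theorem IsGeodesicPath.symm {a b : X} {γ : Path a b} (h : IsGeodesicPath γ) :
    IsGeodesicPath γ.symm := by
  intro s t u hst htu
  have := h (σ u) (σ t) (σ s) (by simpa using htu) (by simpa using hst)
  change dist (γ (σ s)) (γ (σ t)) + dist (γ (σ t)) (γ (σ u)) = dist (γ (σ s)) (γ (σ u))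
  rw [dist_comm (γ (σ s)) (γ (σ t)), dist_comm (γ (σ t)) (γ (σ u)), dist_comm (γ (σ s)) (γ (σ u))]
  linarith

theorem unitInterval.convexComb_mono {s t u v : I} (hst : s ≤ t) (huv : u ≤ v) :
    Icc.convexComb s t u ≤ Icc.convexComb s t v := by
  rw [← Subtype.coe_le_coe] at hst huv ⊢
  simp only [Icc.coe_convexComb]
  nlinarith

theorem IsGeodesicPath.subpath {a b : X} {γ : Path a b} (h : IsGeodesicPath γ) {s t : I}
    (hst : s ≤ t) : IsGeodesicPath (γ.subpath s t) := fun _ _ _ h1 h2 =>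
  h _ _ _ (unitInterval.convexComb_mono hst h1) (unitInterval.convexComb_mono hst h2)

theorem IsGeodesicPath.cast {a b a' b' : X} {γ : Path a b} (h : IsGeodesicPath γ) (ha : a' = a)
    (hb : b' = b) : IsGeodesicPath (γ.cast ha hb) := h

theorem IsGeodesicPath.init {a b : X} {γ : Path a b} (h : IsGeodesicPath γ) (t : I) :
    IsGeodesicPath (γ.init t) := (h.subpath bot_le).cast _ _

theorem IsGeodesicPath.tail {a b : X} {γ : Path a b} (h : IsGeodesicPath γ) (t : I) :
    IsGeodesicPath (γ.tail t) := (h.subpath le_top).cast _ _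

theorem IsGeodesicPath.trans {a b c : X} {γ : Path a b} {γ' : Path b c} (h : IsGeodesicPath γ)
    (h' : IsGeodesicPath γ') (hd : dist a b + dist b c = dist a c) :
    IsGeodesicPath (γ.trans γ') := by
  obtain ⟨f, hf⟩ := isGeodesicPath_iff.1 h
  obtain ⟨f', hf'⟩ := isGeodesicPath_iff.1 h'
  rw [isGeodesicPath_iff]
  refine ⟨fun t => if ht : (t : ℝ) ≤ 1 / 2
    then f ⟨2 * t, (unitInterval.mul_pos_mem_iff zero_lt_two).2 ⟨t.2.1, ht⟩⟩ - f 1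
    else f' ⟨2 * t - 1, unitInterval.two_mul_sub_one_mem_iff.2 ⟨(not_le.1 ht).le, t.2.2⟩⟩ - f' 0,
    fun s t hst => ?_⟩
  rw [Path.trans_apply, Path.trans_apply]
  have hst' : (s : ℝ) ≤ t := hst
  beta_reduce
  split_ifs with hs ht ht
  · rw [hf _ _ (by rw [Subtype.mk_le_mk]; linarith)]
    ring
  · set s' : I := ⟨2 * s, _⟩
    set t' : I := ⟨2 * t - 1, _⟩
    have e1 := hf s' 1 le_top
    have e2 := hf' 0 t' bot_le
    rw [γ.target] at e1
    rw [γ'.source] at e2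
    have e3 := h.dist_add s'
    have e4 := h'.dist_add t'
    have e5 := dist_triangle (γ s') b (γ' t')
    have e6 := dist_triangle4 a (γ s') (γ' t') c
    linarith
  · linarith
  · rw [hf' _ _ (by rw [Subtype.mk_le_mk]; linarith)]
    ring

/-- A geodesic that has left `w` does not come back, so it misses `w` either before or after time
`t`. -/
theorem IsGeodesicPath.joinedIn_source_or_target {a b : X} {γ : Path a b} (h : IsGeodesicPath γ)
    {w : X} {t : I} (hw : γ t ≠ w) : JoinedIn {w}ᶜ (γ t) a ∨ JoinedIn {w}ᶜ (γ t) b := by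
  by_cases h1 : ∃ s ≤ t, γ s = w
  · obtain ⟨s, hst, hs⟩ := h1
    right
    have := JoinedIn.of_subpath γ (F := {w}ᶜ) (s := t) (t := 1) le_top (fun u htu _ hu => by
      have hu : γ u = w := hu
      exact hw ((h.eq_of_between hst htu (hs.trans hu.symm)).trans hs))
    rwa [γ.target] at this
  · push Not at h1
    left
    have := JoinedIn.of_subpath γ (F := {w}ᶜ) (s := 0) (t := t) bot_le (fun u _ htu => h1 u htu)
    rw [γ.source] at this
    exact this.symm

theorem JoinedIn.of_notMem_range {a b w : X} (γ : Path a b) (h : w ∉ range γ) :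
    JoinedIn {w}ᶜ a b := ⟨γ, fun t ht => h ⟨t, ht⟩⟩

/-- A simple geodesic triangle is unseparated. -/
theorem unseparated_triangle {x y z : X} (hxy : x ≠ y) (hxz : x ≠ z) (hyz : y ≠ z)
    {c₁ : Path x y} {c₂ : Path x z} {c₃ : Path y z} (h₁ : IsGeodesicPath c₁)
    (h₂ : IsGeodesicPath c₂) (h₃ : IsGeodesicPath c₃) (h12 : range c₁ ∩ range c₂ ⊆ {x})
    (h13 : range c₁ ∩ range c₃ ⊆ {y}) (h23 : range c₂ ∩ range c₃ ⊆ {z}) :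
    Unseparated (range c₁ ∪ range (c₂.trans c₃.symm)) := by
  intro w
  -- A point on two sides is their common vertex, and the opposite side joins the two others. A
  -- point on at most one side leaves two sides, which connect all three vertices.
  have hv : (x ≠ w → y ≠ w → JoinedIn {w}ᶜ x y) ∧ (x ≠ w → z ≠ w → JoinedIn {w}ᶜ x z) ∧
      (y ≠ w → z ≠ w → JoinedIn {w}ᶜ y z) := by
    by_cases w1 : w ∈ range c₁
    · by_cases w2 : w ∈ range c₂
      · have hw : w = x := h12 ⟨w1, w2⟩
        subst hw
        refine ⟨fun h => absurd rfl h, fun h => absurd rfl h, fun _ _ =>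
          JoinedIn.of_notMem_range c₃ fun w3 => hxy (h13 ⟨w1, w3⟩)⟩
      · have j2 := JoinedIn.of_notMem_range c₂ w2
        by_cases w3 : w ∈ range c₃
        · have hw : w = y := h13 ⟨w1, w3⟩
          subst hw
          exact ⟨fun _ h => absurd rfl h, fun _ _ => j2, fun h => absurd rfl h⟩
        · have j3 := JoinedIn.of_notMem_range c₃ w3
          exact ⟨fun _ _ => j2.trans j3.symm, fun _ _ => j2, fun _ _ => j3⟩
    · have j1 := JoinedIn.of_notMem_range c₁ w1
      by_cases w2 : w ∈ range c₂
      · by_cases w3 : w ∈ range c₃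
        · have hw : w = z := h23 ⟨w2, w3⟩
          subst hw
          exact ⟨fun _ _ => j1, fun _ h => absurd rfl h, fun _ h => absurd rfl h⟩
        · have j3 := JoinedIn.of_notMem_range c₃ w3
          exact ⟨fun _ _ => j1, fun _ _ => j1.trans j3, fun _ _ => j3⟩
      · have j2 := JoinedIn.of_notMem_range c₂ w2
        exact ⟨fun _ _ => j1, fun _ _ => j2, fun _ _ => j1.symm.trans j2⟩
  obtain ⟨jxy, jxz, jyz⟩ := hv
  have hvertex : ∀ u ∈ range c₁ ∪ range (c₂.trans c₃.symm), u ≠ w →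
      JoinedIn {w}ᶜ u x ∨ JoinedIn {w}ᶜ u y ∨ JoinedIn {w}ᶜ u z := by
    rw [Path.trans_range, Path.symm_range]
    rintro _ (⟨t, rfl⟩ | ⟨t, rfl⟩ | ⟨t, rfl⟩) hu
    · rcases h₁.joinedIn_source_or_target hu with h | h <;> simp [h]
    · rcases h₂.joinedIn_source_or_target hu with h | h <;> simp [h]
    · rcases h₃.joinedIn_source_or_target hu with h | h <;> simp [h]
  intro u hu u' hu' huw huw'
  have hne : ∀ {u e : X}, JoinedIn {w}ᶜ u e → e ≠ w := fun h => h.target_mem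
  rcases hvertex u hu huw with h | h | h <;> rcases hvertex u' hu' huw' with h' | h' | h'
  · exact h.trans h'.symm
  · exact h.trans ((jxy (hne h) (hne h')).trans h'.symm)
  · exact h.trans ((jxz (hne h) (hne h')).trans h'.symm)
  · exact h.trans ((jxy (hne h') (hne h)).symm.trans h'.symm)
  · exact h.trans h'.symm
  · exact h.trans ((jyz (hne h) (hne h')).trans h'.symm)
  · exact h.trans ((jxz (hne h') (hne h)).symm.trans h'.symm)
  · exact h.trans ((jyz (hne h') (hne h)).symm.trans h'.symm)
  · exact h.trans h'.symm

end Triangles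


/-! ### Reduction to simple triangles, and simple connectedness -/

section Triangles

open Set unitInterval

variable {X : Type*} [MetricSpace X]

theorem Path.HomotopicIn.of_const {x y : X} {p q : Path x y} (hp : ∀ t, p t = x)
    (hq : ∀ t, q t = x) : p.HomotopicIn {x} q := by
  have : p = q := by
    ext t
    rw [hp, hq]
  subst this
  exact ⟨Path.Homotopy.refl p, fun z => hp z.2⟩

/-- A geodesic and a point span a geodesic triangle that is, up to backtracking, a simple one. -/
theorem IsGeodesicPath.exists_triangle (hX : IsGeodesicSpace X) {a b : X} {g : Path a b}
    (hg : IsGeodesicPath g) (m : X) :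
    ∃ (g₁ : Path a m) (g₂ : Path m b), IsGeodesicPath g₁ ∧ IsGeodesicPath g₂ ∧
      ∃ (x y : X) (p q : Path x y), (IsCorePair p q ∨ p.HomotopicIn {x} q) ∧ x ∈ range g ∧
        (∀ U, p.HomotopicIn U q → range g ⊆ U → range g₁ ⊆ U → range g₂ ⊆ U →
          g.HomotopicIn U (g₁.trans g₂)) ∧
        range p ∪ range q ⊆ range g ∪ range g₁ ∪ range g₂ := by
  have hcl : IsClosed (range g) := (isCompact_range g.continuous).isClosed
  obtain ⟨k, hk⟩ := hX a m
  obtain ⟨s₁, ⟨u, hu⟩, hs₁⟩ := k.exists_last_hit hcl ⟨0, g.source⟩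
  let E : Path (g u) m := (k.tail s₁).cast hu rfl
  have hE : IsGeodesicPath E := hk.tail s₁
  have hEr : range E = k '' Icc s₁ 1 := k.range_tail s₁
  have hEg : range E ∩ range g ⊆ {g u} := by
    rintro x ⟨hxE, hxg⟩
    rw [hEr] at hxE
    obtain ⟨r, hr, rfl⟩ := hxE
    rcases hr.1.eq_or_lt with h | h
    · rw [← h, mem_singleton_iff, hu]
    · exact absurd hxg (hs₁ r h)
  have hclE : IsClosed (range E) := (isCompact_range E.continuous).isClosed
  obtain ⟨l, hl⟩ := hX b m
  obtain ⟨τ, ⟨s, hs⟩, hτ⟩ := l.exists_first_hit hclE ⟨1, E.target⟩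
  -- The third side `C` leaves `g` at the last time before `τ` at which `l` is in the part of `g`
  -- after `u`. Restricting to that part ensures `u ≤ v`; its end point `b` is where `l` starts, so
  -- such a time exists.
  have hclM : IsClosed (g '' Icc u 1) := (isCompact_Icc.image g.continuous).isClosed
  obtain ⟨r, ⟨hrτ, v, hv, hvr⟩, hrmax⟩ :=
    ((hclM.preimage l.continuous).inter isClosed_Iic : IsClosed (l ⁻¹' (g '' Icc u 1) ∩ Iic τ)
      ).isCompact.exists_isGreatest ⟨0, ⟨1, ⟨le_top, le_rfl⟩, by simp⟩, (bot_le : (0 : I) ≤ τ)⟩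
      |>.imp fun r h => (⟨⟨h.1.2, h.1.1⟩, h.2⟩ : (r ≤ τ ∧ l r ∈ g '' Icc u 1) ∧ _)
  let C : Path (g v) (E s) := (l.subpath r τ).cast hvr hs
  have hC : IsGeodesicPath C := hl.subpath hrτ
  have hCr : range C = l '' Icc r τ := l.range_subpath_of_le r τ hrτ
  -- The geodesics `g` and `k` both start at `a` and pass through `g u`, so the initial part of `k`
  -- may be replaced by that of `g`.
  have hg1 : IsGeodesicPath ((g.init u).trans E) := by
    refine (hg.init u).trans hE ?_
    rw [hu]
    exact hk.dist_add s₁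
  have hCg : IsGeodesicPath (C.symm.trans (g.tail v)) := by
    refine hC.symm.trans (hg.tail v) ?_
    have := hl 0 r τ bot_le hrτ
    rw [l.source] at this
    rw [hs, hvr, dist_comm (l τ) (l r), dist_comm (l r) b, dist_comm (l τ) b]
    linarith
  have hg2 : IsGeodesicPath ((E.tail s).symm.trans (C.symm.trans (g.tail v))) := by
    refine (hE.tail s).symm.trans hCg ?_
    rw [hs, dist_comm m, dist_comm (l τ) b, dist_comm m]
    linarith [hl.dist_add τ]
  have hpq : range (g.subpath u v) ∪ range ((E.init s).trans C.symm) ⊆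
      range g ∪ range ((g.init u).trans E) ∪
        range ((E.tail s).symm.trans (C.symm.trans (g.tail v))) := by
    simp only [Path.trans_range, Path.symm_range, Path.range_init]
    rintro x (hx | ⟨t, -, rfl⟩ | hx)
    · rw [Path.range_subpath] at hx
      exact Or.inl (Or.inl (image_subset_range _ _ hx))
    · exact Or.inl (Or.inr (Or.inr ⟨t, rfl⟩))
    · exact Or.inr (Or.inr (Or.inl hx))
  refine ⟨(g.init u).trans E, (E.tail s).symm.trans (C.symm.trans (g.tail v)), hg1, hg2,
    g u, g v, g.subpath u v, (E.init s).trans C.symm, ?_, ⟨u, rfl⟩, ?_, hpq⟩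
  · have hpr : range (g.subpath u v) ⊆ range g := by
      rw [Path.range_subpath]
      exact image_subset_range _ _
    have hpu : range (g.subpath u v) ⊆ g '' Icc u 1 := by
      rw [Path.range_subpath_of_le _ _ _ hv.1]
      exact image_mono (Icc_subset_Icc_right le_top)
    have hpC : (g '' Icc u 1) ∩ range C ⊆ {g v} := by
      rintro x ⟨hx, hxC⟩
      rw [hCr] at hxC
      obtain ⟨w, hw, rfl⟩ := hxC
      have := le_antisymm hw.1 (hrmax ⟨hx, hw.2⟩)
      rw [← this, mem_singleton_iff, hvr]
    have hEC : range E ∩ range C ⊆ {E s} := by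
      rintro x ⟨hx, hxC⟩
      rw [hCr] at hxC
      obtain ⟨w, hw, rfl⟩ := hxC
      rcases hw.2.eq_or_lt with h | h
      · rw [h, mem_singleton_iff, hs]
      · exact absurd hx (hτ w h)
    have hEi : range (E.init s) ⊆ range E := by
      rw [Path.range_init]
      exact image_subset_range _ _
    have hguE : g u ∈ range E := ⟨0, E.source⟩
    have hgu : g u ∈ g '' Icc u 1 := ⟨u, ⟨le_rfl, le_top⟩, rfl⟩
    by_cases huv : g u = g v
    · right
      have hC0 : g v ∈ range C := ⟨0, C.source⟩
      have hgE : g u = E s := hEC ⟨hguE, mem_of_eq_of_mem huv hC0⟩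
      refine Path.HomotopicIn.of_const (fun t => ?_) (fun t => ?_)
      · have := (hg.subpath hv.1).dist_source_le t
        have h0 : dist (g u) (g v) = 0 := dist_eq_zero.2 huv
        exact (dist_le_zero.1 (this.trans h0.le)).symm
      · have hq : ((E.init s).trans C.symm) t ∈ range ((E.init s).trans C.symm) := ⟨t, rfl⟩
        rw [Path.trans_range, Path.symm_range] at hq
        rcases hq with ⟨w, hw⟩ | ⟨w, hw⟩
        · have := (hE.init s).dist_source_le w
          have h0 : dist (g u) (E s) = 0 := dist_eq_zero.2 hgE
          rw [hw] at this
          exact (dist_le_zero.1 (this.trans h0.le)).symm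
        · have := hC.dist_source_le w
          have h0 : dist (g v) (E s) = 0 := dist_eq_zero.2 (huv.symm.trans hgE)
          rw [hw] at this
          exact (dist_le_zero.1 (this.trans h0.le)).symm.trans huv.symm
    · left
      have hxz : g u ≠ E s := by
        intro h
        exact huv (hpC ⟨hgu, mem_of_eq_of_mem h ⟨1, C.target⟩⟩)
      have hyz : g v ≠ E s := by
        intro h
        exact huv (hEg ⟨mem_of_eq_of_mem h ⟨s, rfl⟩, ⟨v, rfl⟩⟩ : g v = g u).symm
      refine ⟨huv, unseparated_triangle huv hxz hyz (hg.subpath hv.1) (hE.init s) hC ?_ ?_ ?_⟩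
      · exact fun x hx => hEg ⟨hEi hx.2, hpr hx.1⟩
      · exact fun x hx => hpC ⟨hpu hx.1, hx.2⟩
      · exact fun x hx => hEC ⟨hEi hx.1, hx.2⟩
  · intro U h hgU hg1U hg2U
    simp only [Path.trans_range, Path.symm_range, union_subset_iff] at hg1U hg2U
    exact Path.HomotopicIn.detour g u v E s C (fun t => hgU ⟨t, rfl⟩) (fun t => hg1U.2 ⟨t, rfl⟩)
      (fun t => hg2U.2.1 ⟨t, rfl⟩) h

/-- One filling has to serve all `ε`, so it is chosen with radius below twice the infimum of the
possible radii. The infimum is positive because a filling contains both `x` and `y`, and these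
differ for a core pair. -/
theorem IsGeodesicPath.exists_filled_triangle (hX : IsGeodesicSpace X)
    (hfill : ∀ {x y : X} {p q : Path x y}, IsCorePair p q → p.Homotopic q) {a b : X} {g : Path a b}
    (hg : IsGeodesicPath g) (m : X) :
    ∃ (g₁ : Path a m) (g₂ : Path m b), IsGeodesicPath g₁ ∧ IsGeodesicPath g₂ ∧
      ∃ (x y : X) (p q : Path x y), (IsCorePair p q ∨ p.HomotopicIn {x} q) ∧ x ∈ range g ∧
        range p ∪ range q ⊆ range g ∪ range g₁ ∪ range g₂ ∧
        ∃ F : g.Homotopy (g₁.trans g₂), ∀ ε, p.HomotopicIn (Metric.closedBall x ε) q →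
          ∀ z, F z ∈ Metric.closedBall x (2 * ε) ∪ (range g ∪ range g₁ ∪ range g₂) := by
  obtain ⟨g₁, g₂, h₁, h₂, x, y, p, q, hpq, hx, hF, hr⟩ := hg.exists_triangle hX m
  refine ⟨g₁, g₂, h₁, h₂, x, y, p, q, hpq, hx, hr, ?_⟩
  have hF' : ∀ V, p.HomotopicIn V q → g.HomotopicIn (V ∪ (range g ∪ range g₁ ∪ range g₂))
      (g₁.trans g₂) := fun V hV =>
    hF _ (hV.mono subset_union_left) (fun z hz => Or.inr (Or.inl (Or.inl hz)))
      (fun z hz => Or.inr (Or.inl (Or.inr hz))) (fun z hz => Or.inr (Or.inr hz))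
  have hnn : ∀ {ε}, p.HomotopicIn (Metric.closedBall x ε) q → 0 ≤ ε := fun {ε} h => by
    have := h.left_mem 1
    exact dist_nonneg.trans this
  rcases hpq with hpq | hpq
  · obtain ⟨F₀⟩ := hfill hpq
    have hne : {ε | p.HomotopicIn (Metric.closedBall x ε) q}.Nonempty := by
      obtain ⟨R, hR⟩ := (isCompact_range F₀.continuous).isBounded.subset_closedBall x
      exact ⟨R, F₀, fun z => hR ⟨z, rfl⟩⟩
    have hlb : ∀ ε ∈ {ε | p.HomotopicIn (Metric.closedBall x ε) q}, dist x y ≤ ε := by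
      intro ε hε
      have := hε.left_mem 1
      rwa [p.target, Metric.mem_closedBall, dist_comm] at this
    have hpos : 0 < sInf {ε | p.HomotopicIn (Metric.closedBall x ε) q} :=
      (dist_pos.2 hpq.1).trans_le (le_csInf hne hlb)
    obtain ⟨r, hr, hr2⟩ := exists_lt_of_csInf_lt hne
      (lt_two_mul_self hpos)
    obtain ⟨F, hF⟩ := hF' _ hr
    refine ⟨F, fun ε hε z => ?_⟩
    have : sInf {ε | p.HomotopicIn (Metric.closedBall x ε) q} ≤ ε :=
      csInf_le ⟨dist x y, hlb⟩ hε
    exact union_subset_union_left _ (Metric.closedBall_subset_closedBall (by linarith)) (hF z)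
  · obtain ⟨F, hF⟩ := hF' _ hpq
    refine ⟨F, fun ε hε z => union_subset_union_left _ ?_ (hF z)⟩
    rintro _ rfl
    exact Metric.mem_closedBall_self (by linarith [hnn hε])

/-- If core pairs are homotopic, and uniformly so, then the space is simply connected. -/
theorem simplyConnectedSpace_of_corePair_homotopic [Nonempty X] (hX : IsGeodesicSpace X)
    (hfill : ∀ {x y : X} {p q : Path x y}, IsCorePair p q → p.Homotopic q)
    (hsmall : ∀ ε > 0, ∃ δ > 0, ∀ {x y : X} {p q : Path x y}, IsCorePair p q →
      range p ∪ range q ⊆ Metric.closedBall x δ → p.HomotopicIn (Metric.closedBall x ε) q) :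
    SimplyConnectedSpace X := by
  choose g₁ g₂ h₁ h₂ x y p q hpq hx hr F hF using
    fun (a b : X) (g : GeodesicPath a b) (m : X) => g.2.exists_filled_triangle hX hfill m
  let D : TriangleFilling X := ⟨fun {a b} g m => ⟨g₁ a b g m, h₁ a b g m⟩,
    fun {a b} g m => ⟨g₂ a b g m, h₂ a b g m⟩, fun {a b} g m => F a b g m⟩
  have hD : ∀ ε > 0, ∃ δ > 0, ∀ {a b : X} (g : GeodesicPath a b) (m : X),
      dist a b ≤ δ → dist a m ≤ δ → dist m b ≤ δ → ∀ z, dist (D.fill g m z) a ≤ ε := by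
    intro ε hε
    obtain ⟨δ, hδ, hδ'⟩ := hsmall (ε / 4) (by linarith)
    -- With `η` this minimum, the sides are within `2η` of `a` and `x` is within `η` of it, so the
    -- core lies within `3η ≤ δ` of `x`. The filling reaches at most `2 * (ε / 4) + η ≤ ε` from `a`.
    refine ⟨min (δ / 4) (ε / 4), lt_min (by linarith) (by linarith),
      fun {a b} g m hab ham hmb z => ?_⟩
    set η := min (δ / 4) (ε / 4) with hη
    have hη1 : η ≤ δ / 4 := min_le_left _ _
    have hη2 : η ≤ ε / 4 := min_le_right _ _
    have hgr : range g.1 ⊆ Metric.closedBall a η := by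
      rintro _ ⟨t, rfl⟩
      rw [Metric.mem_closedBall, dist_comm]
      exact (g.2.dist_source_le t).trans hab
    have hη0 : 0 ≤ η := dist_nonneg.trans hab
    have hsides : range g.1 ∪ range (g₁ a b g m) ∪ range (g₂ a b g m) ⊆
        Metric.closedBall a (2 * η) := by
      rintro _ ((hw | ⟨t, rfl⟩) | ⟨t, rfl⟩)
      · exact Metric.closedBall_subset_closedBall (by linarith) (hgr hw)
      · have := (h₁ a b g m).dist_source_le t
        rw [Metric.mem_closedBall, dist_comm]
        linarith
      · have := (h₂ a b g m).dist_source_le t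
        rw [Metric.mem_closedBall, dist_comm]
        linarith [dist_triangle a m (g₂ a b g m t)]
    have hxa := hgr (hx a b g m)
    rw [Metric.mem_closedBall] at hxa
    have hp : (p a b g m).HomotopicIn (Metric.closedBall (x a b g m) (ε / 4)) (q a b g m) := by
      rcases hpq a b g m with h | h
      · refine hδ' h fun w hw => ?_
        have := hsides (hr a b g m hw)
        rw [Metric.mem_closedBall] at this ⊢
        linarith [dist_triangle_right w (x a b g m) a]
      · exact h.mono (singleton_subset_iff.2 (Metric.mem_closedBall_self (by linarith)))
    rcases hF a b g m _ hp z with h | h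
    · rw [Metric.mem_closedBall] at h
      have := dist_triangle (F a b g m z) (x a b g m) a
      change dist (F a b g m z) a ≤ ε
      linarith
    · have := hsides h
      rw [Metric.mem_closedBall] at this
      change dist (F a b g m z) a ≤ ε
      linarith
  rw [simply_connected_iff_paths_homotopic']
  refine ⟨hX.pathConnectedSpace, fun {a b} τ τ' => ?_⟩
  obtain ⟨g, hg⟩ := hX a b
  exact (D.homotopic hD ⟨g, hg⟩ τ).symm.trans (D.homotopic hD ⟨g, hg⟩ τ')

end Triangles


/-! ### Cancellation in homotopies of concatenated paths -/

section Cancellation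

open Set unitInterval

variable {X : Type*} [TopologicalSpace X]

theorem Path.Homotopic.Quotient.trans_left_cancel {x y z : X} {a : Path.Homotopic.Quotient x y}
    {b c : Path.Homotopic.Quotient y z} (h : a.trans b = a.trans c) : b = c := by
  have := congrArg (fun u => a.symm.trans u) h
  simpa [← Path.Homotopic.Quotient.trans_assoc] using this

theorem Path.Homotopic.Quotient.trans_right_cancel {x y z : X} {a : Path.Homotopic.Quotient y z}
    {b c : Path.Homotopic.Quotient x y} (h : b.trans a = c.trans a) : b = c := by
  have := congrArg (fun u => u.trans a.symm) h
  simpa [Path.Homotopic.Quotient.trans_assoc] using this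

end Cancellation

section CancellationIn

open Set unitInterval

variable {X : Type*} [MetricSpace X] {U : Set X}

theorem Path.mem_of_trans_mem {x y z : X} {a : Path x y} {b : Path y z}
    (h : ∀ t, (a.trans b) t ∈ U) : (∀ t, a t ∈ U) ∧ ∀ t, b t ∈ U := by
  have := range_subset_iff.2 h
  rw [Path.trans_range, union_subset_iff] at this
  exact ⟨range_subset_iff.1 this.1, range_subset_iff.1 this.2⟩

theorem Path.restrictTo_trans {x y z : X} {a : Path x y} {b : Path y z}
    (h : ∀ t, (a.trans b) t ∈ U) (ha : ∀ t, a t ∈ U) (hb : ∀ t, b t ∈ U) :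
    (a.trans b).restrictTo h = (a.restrictTo ha).trans (b.restrictTo hb) := by
  ext t
  exact (Path.coe_trans_eq (p' := a) (q' := b) (fun _ => rfl) (fun _ => rfl) t).symm

theorem Path.HomotopicIn.trans_left_cancel {x y z : X} {a : Path x y} {b c : Path y z}
    (h : (a.trans b).HomotopicIn U (a.trans c)) : b.HomotopicIn U c := by
  obtain ⟨ha, hb⟩ := Path.mem_of_trans_mem h.left_mem
  obtain ⟨-, hc⟩ := Path.mem_of_trans_mem h.right_mem
  have := h.restrictTo h.left_mem h.right_mem
  rw [Path.restrictTo_trans _ ha hb, Path.restrictTo_trans _ ha hc, ← Path.Homotopic.Quotient.eq,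
    Path.Homotopic.Quotient.mk_trans, Path.Homotopic.Quotient.mk_trans] at this
  exact Path.HomotopicIn.of_homotopic (Path.Homotopic.Quotient.eq.1
    (Path.Homotopic.Quotient.trans_left_cancel this))

theorem Path.HomotopicIn.trans_right_cancel {x y z : X} {a b : Path x y} {c : Path y z}
    (h : (a.trans c).HomotopicIn U (b.trans c)) : a.HomotopicIn U b := by
  obtain ⟨ha, hc⟩ := Path.mem_of_trans_mem h.left_mem
  obtain ⟨hb, -⟩ := Path.mem_of_trans_mem h.right_mem
  have := h.restrictTo h.left_mem h.right_mem
  rw [Path.restrictTo_trans _ ha hc, Path.restrictTo_trans _ hb hc, ← Path.Homotopic.Quotient.eq,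
    Path.Homotopic.Quotient.mk_trans, Path.Homotopic.Quotient.mk_trans] at this
  exact Path.HomotopicIn.of_homotopic (Path.Homotopic.Quotient.eq.1
    (Path.Homotopic.Quotient.trans_right_cancel this))

theorem Path.HomotopicIn.inv {x y : X} {a b : Path x y} (h : a.HomotopicIn U b) :
    a.symm.HomotopicIn U b.symm := by
  obtain ⟨F, hF⟩ := h
  exact ⟨F.symm₂, fun z => hF _⟩

theorem Path.HomotopicIn.comm {x y : X} {a b : Path x y} (h : a.HomotopicIn U b) :
    b.HomotopicIn U a := by
  obtain ⟨F, hF⟩ := h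
  exact ⟨F.symm, fun z => hF _⟩

theorem Path.HomotopicIn.of_lassoPath {o x y : X} {s : Path o x} {p q q' : Path x y}
    (h : (lassoPath s p q).HomotopicIn U (lassoPath s p q')) : q.HomotopicIn U q' := by
  have := h.trans_left_cancel.trans_right_cancel.trans_left_cancel.inv
  simpa using this

/-- A homotopy in `V` that a map moves into `U`. -/
theorem Path.HomotopicIn.map {V : Set X} {x y : X} {a b : Path x y} (h : a.HomotopicIn V b)
    (f : C(X, X)) (hf : ∀ z ∈ V, f z ∈ U) :
    (a.map f.continuous).HomotopicIn U (b.map f.continuous) := by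
  obtain ⟨F, hF⟩ := h
  exact ⟨F.map f, fun z => hf _ (hF z)⟩

/-- A map that fixes two paths pointwise. -/
theorem Path.HomotopicIn.of_map {x y : X} {p q : Path x y} {f : C(X, X)}
    (hp : ∀ t, f (p t) = p t) (hq : ∀ t, f (q t) = q t)
    (h : (p.map f.continuous).HomotopicIn U (q.map f.continuous)) : p.HomotopicIn U q := by
  obtain ⟨F, hF⟩ := h
  have hx : x = f x := by simpa using (hp 0).symm
  have hy : y = f y := by simpa using (hp 1).symm
  refine ⟨⟨⟨F.toContinuousMap, fun t => ?_, fun t => ?_⟩, fun s t ht => ?_⟩, hF⟩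
  · exact (F.apply_zero t).trans (hp t)
  · exact (F.apply_one t).trans (hq t)
  · exact (F.prop' s t ht).trans (hp t)

end CancellationIn

/-! ### Infinite concatenations of loops -/

section ConcatLoop

open Set unitInterval

variable {X : Type*} [TopologicalSpace X] {o : X}

/-- A sequence of loops that converges to the base point. -/
def ShrinkingLoops (B : ℕ → Path o o) : Prop := ∀ U ∈ 𝓝 o, ∃ n, ∀ k, n ≤ k → ∀ t, B k t ∈ U

theorem ShrinkingLoops.tail {B : ℕ → Path o o} (h : ShrinkingLoops B) :
    ShrinkingLoops fun k => B (k + 1) := fun U hU => by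
  obtain ⟨n, hn⟩ := h U hU
  exact ⟨n, fun k hk => hn (k + 1) (by lia)⟩

/-- The infinite concatenation of loops. -/
noncomputable def concatLoop (B : ℕ → Path o o) (h : ShrinkingLoops B) : Path o o where
  toFun t := concatFun (fun k => (B k).extend) o t
  continuous_toFun := by
    refine continuousOn_iff_continuous_domRestrict.1 (continuousOn_concatFun
      (fun k => (B k).continuous_extend) (fun k => by simp) fun U hU => ?_)
    obtain ⟨n, hn⟩ := h U hU
    refine ⟨n, fun k hk s hs => ?_⟩
    rw [Path.extend_apply _ hs]
    exact hn k hk _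
  source' := by simp [concatFun_zero]
  target' := by simp [concatFun_of_one_le]

theorem concatLoop_eq (B : ℕ → Path o o) (h : ShrinkingLoops B) :
    concatLoop B h = (B 0).trans (concatLoop (fun k => B (k + 1)) h.tail) := by
  ext t
  rw [Path.trans_apply]
  change concatFun _ _ _ = _
  rw [concatFun_eq]
  split_ifs with ht
  · exact Path.extend_apply _ (unitInterval.mul_pos_mem_iff zero_lt_two |>.2 ⟨t.2.1, ht⟩)
  · rfl

end ConcatLoop


section ConcatMap

open Set unitInterval

theorem map_concatAux {Y Z : Type*} (φ : Y → Z) (n : ℕ) (f : ℕ → ℝ → Y) (t : ℝ) :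
    φ (concatAux n f t) = concatAux n (fun k s => φ (f k s)) t := by
  induction n generalizing f t with
  | zero => rfl
  | succ n ih =>
    rw [concatAux, concatAux, apply_ite φ, ih]

theorem map_concatFun {Y Z : Type*} (φ : Y → Z) (f : ℕ → ℝ → Y) (y : Y) (t : ℝ) :
    φ (concatFun f y t) = concatFun (fun k s => φ (f k s)) (φ y) t := by
  unfold concatFun
  split_ifs
  · exact map_concatAux φ _ f t
  · rfl

variable {X : Type*} [MetricSpace X] {o : X}

theorem concatLoop_map_congr {B B' : ℕ → Path o o} (h : ShrinkingLoops B) (h' : ShrinkingLoops B')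
    (f : C(X, X)) (hf : ∀ j, (B j).map f.continuous = (B' j).map f.continuous) :
    (concatLoop B h).map f.continuous = (concatLoop B' h').map f.continuous := by
  ext t
  change f (concatFun _ _ _) = f (concatFun _ _ _)
  rw [map_concatFun f, map_concatFun f]
  congr 1
  funext k s
  exact DFunLike.congr_fun (hf k) _

/-- After applying `f` the factors other than the `i`-th agree: the first `i` are cancelled one by
one on the left, the infinite remainder at once on the right. -/
theorem Path.HomotopicIn.of_concatLoop {U : Set X} {B B' : ℕ → Path o o} (h : ShrinkingLoops B)
    (h' : ShrinkingLoops B') (f : C(X, X)) (i : ℕ)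
    (hf : ∀ j, j ≠ i → (B j).map f.continuous = (B' j).map f.continuous)
    (hU : ((concatLoop B h).map f.continuous).HomotopicIn U
      ((concatLoop B' h').map f.continuous)) :
    ((B i).map f.continuous).HomotopicIn U ((B' i).map f.continuous) := by
  induction i generalizing B B' with
  | zero =>
    rw [concatLoop_eq B h, concatLoop_eq B' h', Path.map_trans, Path.map_trans,
      concatLoop_map_congr h.tail h'.tail f fun j => hf (j + 1) j.succ_ne_zero] at hU
    exact hU.trans_right_cancel
  | succ i ih =>
    rw [concatLoop_eq B h, concatLoop_eq B' h', Path.map_trans, Path.map_trans,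
      hf 0 i.succ_ne_zero.symm] at hU
    exact ih h.tail h'.tail (fun j hj => hf (j + 1) (by lia)) hU.trans_left_cancel

theorem range_subset_range_concatLoop (B : ℕ → Path o o) (h : ShrinkingLoops B) (i : ℕ) :
    range (B i) ⊆ range (concatLoop B h) := by
  induction i generalizing B with
  | zero =>
    rw [concatLoop_eq, Path.trans_range]
    exact subset_union_left
  | succ i ih =>
    rw [concatLoop_eq, Path.trans_range]
    exact (ih (fun k => B (k + 1)) h.tail).trans subset_union_right

end ConcatMap

/-! ### Shrinking core pairs, and the case of a cut point -/

section FarGates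

open Set unitInterval

variable {X : Type*} [MetricSpace X]

/-- Among infinitely many far gates in the compact set `K` there are two, `mi` and `mj`, that are
close to each other, with `x i` and `x j` close as well. All of `M j` has the same gate in `M i`; by
the Lipschitz property this gate is close to `mi` and to `x i`, so these are close. -/
theorem finite_far_gates (hX : IsGeodesicSpace X) {o : X} {x : ℕ → X} {M : ℕ → Set X}
    (hM : ∀ i, IsGated (M i)) (hx : ∀ i, x i ∈ M i)
    (hconst : ∀ i j, i ≠ j → ∀ y ∈ M j, ∀ y' ∈ M j, gate (hM i) y = gate (hM i) y')
    (hlim : Tendsto x atTop (𝓝 o)) {K : Set X} (hK : IsCompact K)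
    (hKM : ∀ i, ∀ z ∈ K, gate (hM i) z ∈ K) {ε : ℝ} (hε : 0 < ε) :
    {i | ¬ ∀ z ∈ K, dist (gate (hM i) z) (x i) ≤ ε}.Finite := by
  by_contra hinf
  obtain ⟨φ, hφ, hφ'⟩ := extraction_of_frequently_atTop
    (Nat.frequently_atTop_iff_infinite.2 hinf)
  simp only [not_forall, not_le, exists_prop] at hφ'
  choose z hz hzε using hφ'
  obtain ⟨a, -, ψ, hψ, hlim'⟩ := hK.tendsto_subseq fun n => hKM (φ n) _ (hz n)
  have h1 := (Metric.tendsto_nhds.1 hlim' (ε / 4) (by linarith))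
  have h2 := (Metric.tendsto_nhds.1 (hlim.comp (hφ.comp hψ).tendsto_atTop) (ε / 4) (by linarith))
  obtain ⟨N, hN⟩ := eventually_atTop.1 (h1.and h2)
  obtain ⟨hN1, hN2⟩ := hN N le_rfl
  obtain ⟨hN3, hN4⟩ := hN (N + 1) N.le_succ
  simp only [Function.comp_apply] at hN1 hN2 hN3 hN4
  have hij : φ (ψ N) ≠ φ (ψ (N + 1)) := (hφ (hψ N.lt_succ_self)).ne
  set i := φ (ψ N)
  set j := φ (ψ (N + 1))
  set mi := gate (hM i) (z (ψ N)) with hmi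
  set mj := gate (hM j) (z (ψ (N + 1))) with hmj
  have e1 : gate (hM i) mi = mi := gate_eq_self _ (gate_mem _ _)
  have e2 : gate (hM i) mj = gate (hM i) (x j) := hconst i j hij _ (gate_mem _ _) _ (hx j)
  have e3 : gate (hM i) (x i) = x i := gate_eq_self _ (hx i)
  have d1 := dist_gate_le hX (hM i) mj mi
  have d2 := dist_gate_le hX (hM i) (x j) (x i)
  rw [e1, e2] at d1
  rw [e3] at d2
  have := hzε (ψ N)
  linarith [dist_triangle_left mi (x i) (gate (hM i) (x j)), dist_triangle_right mj mi a,
    dist_triangle_right (x j) (x i) o]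

theorem gate_mem_of_joinedIn {M K : Set X} (hM : IsGated M) {z m : X} (hm : m ∈ M)
    (h : JoinedIn K z m) : gate hM z ∈ K := by
  obtain ⟨f, hf⟩ := h
  obtain ⟨t, ht⟩ := (isGate_gate hM z).2 m hm f
  rw [← ht]
  exact hf t

theorem countable_setOf_symmDiff_finite (S : Set ℕ) : {S' | (symmDiff S S').Finite}.Countable := by
  have h : {T : Set ℕ | T.Finite}.Countable := 
    (Set.countable_ofPred_finite_subset countable_univ).mono fun T (hT : T.Finite) => And.intro hT (subset_univ T)
  exact h.preimage (symmDiff_right_injective S)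

/-- Sets that differ finitely from a given one are countably many, so `f` has countable fibres; a
countable `Y` would contradict Cantor's theorem. -/
theorem uncountable_of_finite_symmDiff {Y : Type*} (f : Set ℕ → Y)
    (hf : ∀ S S', f S = f S' → (symmDiff S S').Finite) : Uncountable Y := by
  rw [← not_countable_iff]
  intro hc
  have : (univ : Set (Set ℕ)).Countable := by
    have h : (univ : Set (Set ℕ)) = ⋃ y : Y, f ⁻¹' {y} := by
      ext S
      simp
    rw [h]
    refine countable_iUnion fun y => ?_
    rcases (f ⁻¹' {y}).eq_empty_or_nonempty with h | ⟨S, hS⟩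
    · rw [h]
      exact countable_empty
    · refine (countable_setOf_symmDiff_finite S).mono fun S' hS' => hf S S' ?_
      rw [mem_preimage, mem_singleton_iff] at hS hS'
      rw [hS, hS']
  have hc' := countable_univ_iff.1 this
  obtain ⟨g, hg⟩ := exists_surjective_nat (Set ℕ)
  exact Function.cantor_surjective g hg

/-- A set `S` of indices gives the concatenation of lassos that return along `q i` for `i ∈ S` and
along `p i`, hence trivially, otherwise. A homotopy has compact image, so all but finitely many gate
maps carry it into the `ε`-ball around `x i`. If `S` and `S'` differ at such an `i`, the retracted
homotopy is a forbidden filling of the `i`-th core pair. -/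
theorem uncountable_of_shrinking_corePairs (hX : IsGeodesicSpace X) {o : X} {x y : ℕ → X}
    {p q : ∀ i, Path (x i) (y i)} (h : ∀ i, IsCorePair (p i) (q i))
    (hne : ∀ i j, i ≠ j → piece {x i, y i} ≠ piece {x j, y j}) {r : ℕ → ℝ}
    (hr : Tendsto r atTop (𝓝 0)) (hpr : ∀ i, range (p i) ∪ range (q i) ⊆ Metric.closedBall o (r i))
    {ε : ℝ} (hε : 0 < ε) (hpq : ∀ i, ¬ (p i).HomotopicIn (Metric.closedBall (x i) ε) (q i)) :
    Uncountable (FundamentalGroup X o) := by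
  classical
  choose s hs using fun i => hX o (x i)
  have hxo : ∀ i, x i ∈ Metric.closedBall o (r i) := fun i => hpr i (Or.inl ⟨0, (p i).source⟩)
  have hr0 : ∀ i, 0 ≤ r i := fun i => dist_nonneg.trans (hxo i)
  have hso : ∀ i, range (s i) ⊆ Metric.closedBall o (r i) := by
    rintro i _ ⟨t, rfl⟩
    rw [Metric.mem_closedBall, dist_comm]
    refine ((hs i).dist_source_le t).trans ?_
    rw [dist_comm]
    exact hxo i
  let Q : Set ℕ → ∀ i, Path (x i) (y i) := fun S i => if i ∈ S then q i else p i
  have hQ : ∀ S i, range (Q S i) ⊆ range (p i) ∪ range (q i) := by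
    intro S i
    simp only [Q]
    split_ifs
    exacts [subset_union_right, subset_union_left]
  let B : Set ℕ → ℕ → Path o o := fun S i => lassoPath (s i) (p i) (Q S i)
  have hBr : ∀ S i, range (B S i) ⊆ Metric.closedBall o (r i) := by
    intro S i
    simp only [B, lassoPath, Path.trans_range, Path.symm_range]
    exact union_subset (hso i) (union_subset (union_subset (subset_union_left.trans (hpr i))
      ((hQ S i).trans (hpr i))) (hso i))
  have hB : ∀ S, ShrinkingLoops (B S) := by
    intro S U hU
    obtain ⟨δ, hδ, hδU⟩ := Metric.nhds_basis_closedBall.mem_iff.1 hU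
    obtain ⟨n, hn⟩ := eventually_atTop.1 (hr.eventually (gt_mem_nhds hδ))
    exact ⟨n, fun k hk t => hδU (Metric.closedBall_subset_closedBall (hn k hk).le
      (hBr S k ⟨t, rfl⟩))⟩
  refine uncountable_of_finite_symmDiff (Y := FundamentalGroup X o)
    (fun S => Path.Homotopic.Quotient.mk (concatLoop (B S) (hB S))) fun S S' hSS => ?_
  obtain ⟨F⟩ := Path.Homotopic.Quotient.exact hSS
  have hM : ∀ i, IsGated (piece {x i, y i}) := fun i =>
    hX.isGated_piece (h i).unseparated (h i).nontrivial
  have hconst : ∀ i j, i ≠ j → ∀ w ∈ piece {x j, y j}, ∀ w' ∈ piece {x j, y j},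
      gate (hM i) w = gate (hM i) w' := fun i j hij w hw w' hw' =>
    gate_eq_of_piece_ne hX (h i).nontrivial (h j).nontrivial (hM i) (hne i j hij) hw hw'
  have hxM : ∀ i, x i ∈ piece {x i, y i} := fun i => by simpa using (h i).left_mem 0
  have hKc : IsCompact (range F) := isCompact_range F.continuous
  have hxK : ∀ i, x i ∈ range F := by
    intro i
    have h1 : x i ∈ range (B S i) := by
      simp only [B, lassoPath, Path.trans_range]
      exact Or.inl ⟨1, (s i).target⟩
    obtain ⟨t, ht⟩ := range_subset_range_concatLoop (B S) (hB S) i h1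
    exact ⟨(0, t), (F.apply_zero t).trans ht⟩
  have : PathConnectedSpace I := isPathConnected_iff_pathConnectedSpace.1
    ((convex_Icc (0 : ℝ) 1).isPathConnected ⟨0, by simp⟩)
  -- Path connectedness keeps the gates in the image: a path inside it from a point to `x i` passes
  -- through the gate of that point.
  have hKp : IsPathConnected (range F) := isPathConnected_range F.continuous
  have hfin := finite_far_gates hX hM hxM hconst (o := o) (tendsto_iff_dist_tendsto_zero.2
    (squeeze_zero (fun _ => dist_nonneg) hxo hr)) hKc
    (fun i z hz => gate_mem_of_joinedIn (hM i) (hxM i) (hKp.joinedIn z hz _ (hxK i))) hε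
  refine hfin.subset fun i hi hU => ?_
  have hH : (concatLoop (B S) (hB S)).HomotopicIn (range F) (concatLoop (B S') (hB S')) :=
    ⟨F, fun z => ⟨z, rfl⟩⟩
  have hH' := (hH.map (gateMap hX (hM i)) (U := Metric.closedBall (x i) ε) hU).of_concatLoop
    (hB S) (hB S') (gateMap hX (hM i)) i fun j hj => by
      simp only [B, lassoPath_map]
      congr 1
      ext t
      exact hconst i j hj.symm _ (by
        rcases hQ S j ⟨t, rfl⟩ with ⟨u, hu⟩ | ⟨u, hu⟩
        exacts [hu ▸ (h j).left_mem u, hu ▸ (h j).right_mem u]) _ (by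
        rcases hQ S' j ⟨t, rfl⟩ with ⟨u, hu⟩ | ⟨u, hu⟩
        exacts [hu ▸ (h j).left_mem u, hu ▸ (h j).right_mem u])
  simp only [B, lassoPath_map] at hH'
  have hH2 := hH'.of_lassoPath
  have hpf : ∀ t, gateMap hX (hM i) (p i t) = p i t := fun t =>
    gate_eq_self (hM i) ((h i).left_mem t)
  have hqf : ∀ t, gateMap hX (hM i) (q i t) = q i t := fun t =>
    gate_eq_self (hM i) ((h i).right_mem t)
  rcases hi with hi | hi
  · have e1 : Q S i = q i := if_pos hi.1
    have e2 : Q S' i = p i := if_neg hi.2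
    rw [e1, e2] at hH2
    exact hpq i (Path.HomotopicIn.of_map hpf hqf hH2.comm)
  · have e1 : Q S' i = q i := if_pos hi.1
    have e2 : Q S i = p i := if_neg hi.2
    rw [e1, e2] at hH2
    exact hpq i (Path.HomotopicIn.of_map hpf hqf hH2)

/-- Core pairs without small fillings produce an infinite concatenation of loops. -/
theorem uncountable_of_no_small_filling [CompleteSpace X] (hX : IsGeodesicSpace X)
    (hhom : IsHomogeneousMetric X)
    (hcut : ∀ K : Set X, Unseparated K → K.Nontrivial → piece K ≠ univ) {ε : ℝ} (hε : 0 < ε)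
    (hbad : ∀ δ > 0, ∃ (x y : X) (p q : Path x y), IsCorePair p q ∧
      range p ∪ range q ⊆ Metric.closedBall x δ ∧ ¬ p.HomotopicIn (Metric.closedBall x ε) q) (o : X) :
    Uncountable (FundamentalGroup X o) := by
  classical
  let α : Type _ := ℕ × Σ x y : X, Path x y × Path x y
  let good : α → Prop := fun a => IsCorePair a.2.2.2.1 a.2.2.2.2 ∧
    range a.2.2.2.1 ∪ range a.2.2.2.2 ⊆ Metric.closedBall o (2 * (1 / (a.1 + 1 : ℝ))) ∧
    ¬ a.2.2.2.1.HomotopicIn (Metric.closedBall a.2.1 ε) a.2.2.2.2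
  let r : α → α → Prop := fun a b => a.1 < b.1 ∧
    piece {a.2.1, a.2.2.1} ≠ piece {b.2.1, b.2.2.1}
  -- Bad core pairs are picked recursively, each closer to `o` and in a new piece: a bad pair can be
  -- moved by an isometry into uncountably many pieces near `o`, and only finitely many are taken.
  obtain ⟨f, hf, hfr⟩ := exists_seq_of_forall_finset_exists good r (by
    intro s _
    obtain ⟨N, hN⟩ : ∃ N, ∀ a ∈ s, a.1 < N :=
      ⟨s.sup Prod.fst + 1, fun a ha => Nat.lt_succ_of_le (Finset.le_sup (f := Prod.fst) ha)⟩
    have hδ : (0 : ℝ) < 1 / (N + 1) := by positivity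
    obtain ⟨x, y, p, q, hpq, hsub, hnot⟩ := hbad _ hδ
    have hinf := not_countable_pieces hX hhom hpq.unseparated hpq.nontrivial
      (hcut _ hpq.unseparated hpq.nontrivial) (p := x) (by simp) o hδ
    obtain ⟨_, ⟨g, hg, rfl⟩, hgs⟩ : ∃ S ∈ {S : Set X | ∃ g : X ≃ᵢ X,
        g x ∈ Metric.ball o (1 / (N + 1)) ∧ S = piece (g '' {x, y})},
        S ∉ s.image fun a => piece {a.2.1, a.2.2.1} := by
      by_contra! hcon
      exact hinf ((Finset.countable_toSet _).mono hcon)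
    rw [image_pair] at hgs
    refine ⟨⟨N, g x, g y, p.map g.continuous, q.map g.continuous⟩, ⟨⟨?_, ?_⟩, ?_, ?_⟩,
      fun a ha => ⟨hN a ha, fun e => hgs (Finset.mem_image.2 ⟨a, ha, e⟩)⟩⟩
    · exact fun e => hpq.1 (g.injective e)
    · have := hpq.2.image g
      rwa [image_union, ← range_comp, ← range_comp] at this
    · have key : ∀ z ∈ range p ∪ range q, g z ∈ Metric.closedBall o (2 * (1 / ((N : ℕ) + 1 : ℝ))) := by
        intro z hz
        have h1 := hsub hz
        rw [Metric.mem_closedBall, ← g.dist_eq] at h1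
        rw [Metric.mem_ball] at hg
        rw [Metric.mem_closedBall]
        linarith [dist_triangle (g z) (g x) o]
      rintro _ (⟨t, rfl⟩ | ⟨t, rfl⟩)
      exacts [key _ (Or.inl ⟨t, rfl⟩), key _ (Or.inr ⟨t, rfl⟩)]
    · intro hcon
      apply hnot
      have h1 := hcon.map (U := Metric.closedBall x ε) ⟨g.symm, g.symm.continuous⟩ (fun z hz => by
        rw [Metric.mem_closedBall] at hz ⊢
        rw [← g.dist_eq]
        simpa using hz)
      exact Path.HomotopicIn.of_map (f := ⟨g.symm ∘ g, g.symm.continuous.comp g.continuous⟩)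
        (fun t => by simp) (fun t => by simp) h1)
  have hmono : StrictMono fun i => (f i).1 := fun i j hij => (hfr i j hij).1
  refine uncountable_of_shrinking_corePairs hX (p := fun i => (f i).2.2.2.1)
    (q := fun i => (f i).2.2.2.2) (fun i => (hf i).1) (fun i j hij => ?_)
    (r := fun i => 2 * (1 / ((f i).1 + 1 : ℝ))) ?_ (fun i => (hf i).2.1) hε (fun i => (hf i).2.2)
  · rcases hij.lt_or_gt with h | h
    exacts [(hfr i j h).2, (hfr j i h).2.symm]
  · have := (tendsto_one_div_add_atTop_nhds_zero_nat (𝕜 := ℝ)).comp hmono.tendsto_atTop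
    simpa using this.const_mul 2

/-- With a countable fundamental group at one point, every core pair is homotopic and the homotopies
are uniformly small, which is what the dyadic filling needs. -/
theorem simplyConnectedSpace_or_uncountable_of_piece_ne_univ [Nonempty X] [CompleteSpace X]
    (hX : IsGeodesicSpace X) (hhom : IsHomogeneousMetric X)
    (hcut : ∀ K : Set X, Unseparated K → K.Nontrivial → piece K ≠ univ) :
    SimplyConnectedSpace X ∨ ∀ o : X, Uncountable (FundamentalGroup X o) := by
  by_contra! hcon
  obtain ⟨hsc, o, ho⟩ := hcon
  refine hsc (simplyConnectedSpace_of_corePair_homotopic hX (fun {x y p q} h => ?_) ?_)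
  · by_contra hpq
    have := uncountable_of_corePair_not_homotopic hX hhom hcut h hpq o
    exact not_countable ho
  · by_contra! hbad
    obtain ⟨ε, hε, hbad⟩ := hbad
    have := uncountable_of_no_small_filling hX hhom hcut hε hbad o
    exact not_countable ho

/-- A complete homogeneous geodesic space with a cut point is simply connected or has an
uncountable fundamental group. -/
theorem simplyConnectedSpace_or_uncountable_of_cutPoint [CompleteSpace X]
    (hX : IsGeodesicSpace X) (hhom : IsHomogeneousMetric X) {z a b : X} (ha : a ≠ z) (hb : b ≠ z)
    (hab : ¬ JoinedIn {z}ᶜ a b) :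
    SimplyConnectedSpace X ∨ ∀ o : X, Uncountable (FundamentalGroup X o) := by
  have : Nonempty X := ⟨z⟩
  refine simplyConnectedSpace_or_uncountable_of_piece_ne_univ hX hhom fun K _ hK' he => hab ?_
  exact unseparated_piece hK' z a (he ▸ mem_univ a) b (he ▸ mem_univ b) ha hb

end FarGates


/-! ### Paths in the circle and their real lifts -/

section CircleLifts

open Set unitInterval

/-- A path in the circle that is homotopic to one with a real lift has a lift with the same ends. -/
theorem Path.Homotopic.exists_lift {x y : AddCircle (1 : ℝ)} {p q : Path x y} (h : p.Homotopic q)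
    {l : I → ℝ} (hl : Continuous l) (hlq : ∀ t, (l t : AddCircle (1 : ℝ)) = q t) :
    ∃ m : I → ℝ, Continuous m ∧ (∀ t, (m t : AddCircle (1 : ℝ)) = p t) ∧ m 0 = l 0 ∧ m 1 = l 1 := by
  have cov := AddCircle.isCoveringMap_coe (1 : ℝ)
  have hp0 : p.toContinuousMap 0 = ((l 0 : ℝ) : AddCircle (1 : ℝ)) := by
    rw [hlq]
    simp
  have hq0 : q.toContinuousMap 0 = ((l 0 : ℝ) : AddCircle (1 : ℝ)) := (hlq 0).symm
  refine ⟨cov.liftPath p.toContinuousMap (l 0) hp0, map_continuous _,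
    fun t => congrFun (cov.liftPath_lifts _ _ hp0) t, cov.liftPath_zero _ _ hp0, ?_⟩
  rw [cov.liftPath_apply_one_eq_of_homotopicRel (γ₁ := q.toContinuousMap) h (l 0) hp0 hq0]
  have : (⟨l, hl⟩ : C(I, ℝ)) = cov.liftPath q.toContinuousMap (l 0) hq0 :=
    (cov.eq_liftPath_iff' _).2 ⟨funext hlq, rfl⟩
  rw [← this]
  rfl

theorem Path.Homotopic.of_lifts {x y : AddCircle (1 : ℝ)} {p q : Path x y} {l m : I → ℝ}
    (hl : Continuous l) (hm : Continuous m) (hlp : ∀ t, (l t : AddCircle (1 : ℝ)) = p t)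
    (hmq : ∀ t, (m t : AddCircle (1 : ℝ)) = q t) (h0 : l 0 = m 0) (h1 : l 1 = m 1) :
    p.Homotopic q := by
  let L : Path (l 0) (l 1) := ⟨⟨l, hl⟩, rfl, rfl⟩
  let M : Path (l 0) (l 1) := ⟨⟨m, hm⟩, h0.symm, h1.symm⟩
  have hLM : L.Homotopic M := SimplyConnectedSpace.paths_homotopic L M
  have hx : x = ((l 0 : ℝ) : AddCircle (1 : ℝ)) := by rw [hlp]; simp
  have hy : y = ((l 1 : ℝ) : AddCircle (1 : ℝ)) := by rw [hlp]; simp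
  have key := (hLM.map ⟨((↑) : ℝ → AddCircle (1 : ℝ)), AddCircle.continuous_mk' 1⟩).pathCast hx hy
  convert key using 1
  · ext t
    exact (hlp t).symm
  · ext t
    exact (hmq t).symm

/-- Two real lifts of the same path differ by a constant. -/
theorem sub_eq_sub_of_lifts {l m : I → ℝ} (hl : Continuous l) (hm : Continuous m)
    (h : ∀ t, (l t : AddCircle (1 : ℝ)) = m t) : l 1 - m 1 = l 0 - m 0 := by
  have cov := AddCircle.isCoveringMap_coe (1 : ℝ)
  have hc : ((l 0 - m 0 : ℝ) : AddCircle (1 : ℝ)) = 0 := by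
    rw [AddCircle.coe_sub, h, sub_self]
  have hm' : Continuous fun t => m t + (l 0 - m 0) := hm.add continuous_const
  have := congrFun (cov.eq_of_comp_eq hl hm' (funext fun t => by
    simp only [Function.comp_apply, AddCircle.coe_add, hc, add_zero, h]) 0 (by simp)) 1
  rw [this]
  ring

end CircleLifts

/-! ### Spaces separated by an ultrametric set -/

section Separation

open Set unitInterval

/-- The function that is `u` on `B` and the constant `c` off `B`. -/
theorem continuous_ite_mem {T Y : Type*} [TopologicalSpace T] [TopologicalSpace Y] {A B : Set T}
    (hA : IsClosed A) (hB : IsClosed B) (hAB : A ∪ B = univ) [DecidablePred (· ∈ B)] {u : T → Y}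
    (hu : Continuous u) {c : Y} (h : ∀ t ∈ A ∩ B, u t = c) :
    Continuous fun t => if t ∈ B then u t else c := by
  refine Continuous.if (fun t ht => h t ⟨?_, ?_⟩) hu continuous_const
  · have h1 : t ∈ closure Bᶜ := by
      rw [frontier_eq_closure_inter_closure] at ht
      exact ht.2
    refine closure_minimal (fun s hs => ?_) hA h1
    exact (hAB ▸ mem_univ s : s ∈ A ∪ B).resolve_right hs
  · exact hB.frontier_subset ht

variable {X : Type*} [MetricSpace X]

/-- `Z` carries an ultrametric that is bi-Lipschitz to its metric. -/
def IsUltrametricSet (Z : Set X) : Prop :=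
  ∃ C > 0, ∃ ρ : X → X → ℝ, (∀ x ∈ Z, ∀ y ∈ Z, ρ x y ≤ C * dist x y ∧ dist x y ≤ C * ρ x y) ∧
    (∀ x ∈ Z, ∀ y ∈ Z, ρ x y = ρ y x) ∧
    ∀ x ∈ Z, ∀ y ∈ Z, ∀ z ∈ Z, ρ x z ≤ max (ρ x y) (ρ y z)

/-- Partition of an ultrametric set into small uniformly separated sets. -/
theorem IsUltrametricSet.exists_partition {Z : Set X} (hZ : IsUltrametricSet Z) {δ : ℝ}
    (hδ : 0 < δ) : ∃ η > 0, ∃ V : X → Set X, ∀ z ∈ Z, z ∈ V z ∧ V z ⊆ Z ∩ Metric.ball z δ ∧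
      (∀ w ∈ V z, ∀ w' ∈ Z, w' ∉ V z → η ≤ dist w w') ∧ ∀ w ∈ V z, V w = V z := by
  obtain ⟨C, hC, ρ, hρ, hsymm, hult⟩ := hZ
  have hself : ∀ z ∈ Z, ρ z z ≤ 0 := fun z hz => by simpa using (hρ z hz z hz).1
  -- The classes are the `ρ`-balls of radius `δ / C`. Points of different classes have `ρ`-distance
  -- at least `δ / C`; each comparison of `ρ` with the metric costs a factor `C`.
  refine ⟨δ / C / C, by positivity, fun z => {w ∈ Z | ρ w z < δ / C}, fun z hz => ⟨⟨hz, ?_⟩,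
    fun w hw => ⟨hw.1, ?_⟩, fun w hw w' hw' hww' => ?_, fun w hw => ?_⟩⟩
  · exact (hself z hz).trans_lt (by positivity)
  · rw [Metric.mem_ball]
    refine (hρ w hw.1 z hz).2.trans_lt ?_
    rw [mul_comm, ← lt_div_iff₀ hC]
    exact hw.2
  · by_contra! hlt
    refine hww' ⟨hw', (hult w' hw' w hw.1 z hz).trans_lt (max_lt ?_ hw.2)⟩
    rw [hsymm w' hw' w hw.1]
    refine (hρ w hw.1 w' hw').1.trans_lt ?_
    rwa [mul_comm, ← lt_div_iff₀ hC]
  · ext u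
    refine ⟨fun hu => ⟨hu.1, (hult u hu.1 w hw.1 z hz).trans_lt (max_lt hu.2 hw.2)⟩,
      fun hu => ⟨hu.1, (hult u hu.1 z hz w hw.1).trans_lt (max_lt hu.2 ?_)⟩⟩
    rw [hsymm z hz w hw.1]
    exact hw.2

/-- A function that is `1` on `V` and `0` at distance at least `η` from `V`. -/
noncomputable def bump (V : Set X) (η : ℝ) (x : X) : ℝ := max 0 (1 - Metric.infDist x V / η)

theorem continuous_bump (V : Set X) (η : ℝ) : Continuous (bump V η) := by
  unfold bump
  have := Metric.continuous_infDist_pt V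
  fun_prop

theorem bump_of_mem {V : Set X} (η : ℝ) {x : X} (hx : x ∈ V) : bump V η x = 1 := by
  simp [bump, Metric.infDist_zero_of_mem hx]

theorem bump_of_le_infDist {V : Set X} {η : ℝ} (hη : 0 < η) {x : X} (hx : η ≤ Metric.infDist x V) :
    bump V η x = 0 := by
  rw [bump, max_eq_left]
  rw [sub_nonpos, le_div_iff₀ hη]
  linarith

open Classical in
/-- The map to the circle that is `v` on `B` and trivial off `B`. -/
noncomputable def sideMap (B : Set X) (v : X → ℝ) (x : X) : AddCircle (1 : ℝ) :=
  if x ∈ B then (v x : AddCircle (1 : ℝ)) else 0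

theorem continuous_sideMap {A B : Set X} (hA : IsClosed A) (hB : IsClosed B) (hAB : A ∪ B = univ)
    {v : X → ℝ} (hv : Continuous v) (h : ∀ x ∈ A ∩ B, v x = 0 ∨ v x = 1) :
    Continuous (sideMap B v) := by
  classical
  refine continuous_ite_mem hA hB hAB ((AddCircle.continuous_mk' 1).comp hv) fun t ht => ?_
  rcases h t ht with h | h
  · simp [h]
  · simp only [Function.comp_apply, h]
    exact AddCircle.coe_period 1

theorem nonempty_inter_of_isPreconnected {T : Type*} [TopologicalSpace T] {S A B : Set T}
    (hS : IsPreconnected S) (hA : IsClosed A) (hB : IsClosed B) (hAB : A ∪ B = univ) {a b : T}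
    (ha : a ∈ S) (haA : a ∈ A) (hb : b ∈ S) (hbB : b ∈ B) : (S ∩ (A ∩ B)).Nonempty :=
  isPreconnected_closed_iff.1 hS A B hA hB (hAB ▸ subset_univ S) ⟨a, ha, haA⟩ ⟨b, hb, hbB⟩

/-- Two closed sides with an ultrametric intersection, in a space without cut points, give a map to
the circle that distinguishes two paths. -/
theorem exists_sideMap_not_homotopic [PathConnectedSpace X] {A B : Set X} (hA : IsClosed A)
    (hB : IsClosed B) (hAB : A ∪ B = univ) {a b : X} (ha : a ∉ B) (hb : b ∉ A)
    (hZ : IsUltrametricSet (A ∩ B)) (hcut : ∀ z x y : X, x ≠ z → y ≠ z → JoinedIn {z}ᶜ x y) :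
    ∃ (V : Set X) (v : X → ℝ) (hc : Continuous (sideMap B v)) (σ₀ σ₁ : Path a b), Continuous v ∧
      V ⊆ A ∩ B ∧ Bornology.IsBounded V ∧ (∀ x ∈ A ∩ B, x ∉ V → v x = 0) ∧
      ¬ (σ₀.map hc).Homotopic (σ₁.map hc) := by
  classical
  let σ₀ : Path a b := (PathConnectedSpace.joined a b).somePath
  have hbB : b ∈ B := (hAB ▸ mem_univ b : b ∈ A ∪ B).resolve_left hb
  have hZc : IsClosed (A ∩ B) := hA.inter hB
  have hK : IsCompact (range σ₀ ∩ (A ∩ B)) := (isCompact_range σ₀.continuous).inter_right hZc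
  -- paths that miss balls around the points of `K`
  have hmiss : ∀ z ∈ A ∩ B, ∃ f : Path a b, ∃ r > 0, ∀ t, f t ∉ Metric.ball z r := by
    intro z hz
    obtain ⟨f, hf⟩ := hcut z a b (fun e => ha (e ▸ hz.2)) (fun e => hb (e ▸ hz.1))
    obtain ⟨r, hr, hr'⟩ := Metric.mem_nhds_iff.1
      ((isCompact_range f.continuous).isClosed.isOpen_compl.mem_nhds
        (fun ⟨t, ht⟩ => hf t ht : z ∈ (range f)ᶜ))
    exact ⟨f, r, hr, fun t ht => hr' ht ⟨t, rfl⟩⟩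
  have : Nonempty (Path a b) := ⟨σ₀⟩
  choose! τ r hr hτ using hmiss
  -- Classes of size `δ`, a Lebesgue number, lie each in a ball that is missed by one of the paths
  -- `τ y`.
  obtain ⟨δ, hδ, hδ'⟩ := lebesgue_number_lemma_of_metric hK
    (c := fun z : (A ∩ B : Set X) => Metric.ball (z : X) (r z)) (fun z => Metric.isOpen_ball)
    (fun z hz => mem_iUnion.2 ⟨⟨z, hz.2⟩, Metric.mem_ball_self (hr z hz.2)⟩)
  obtain ⟨η₀, hη₀, V, hV⟩ := hZ.exists_partition hδ
  have hZne : (A ∩ B).Nonempty :=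
    (nonempty_inter_of_isPreconnected isPreconnected_univ hA hB hAB (mem_univ a)
      ((hAB ▸ mem_univ a : a ∈ A ∪ B).resolve_right ha) (mem_univ b) hbB).mono inter_subset_right
  have hbZ : 0 < Metric.infDist b (A ∩ B) :=
    (hZc.notMem_iff_infDist_pos hZne).1 fun h => hb h.1
  -- The bumps of width `η` vanish on the other classes and also at `b`.
  set η := min η₀ (Metric.infDist b (A ∩ B)) with hηdef
  have hη : 0 < η := lt_min hη₀ hbZ
  obtain ⟨T, hT, hTfin, hTK⟩ := hK.elim_finite_subcover_image
    (b := range σ₀ ∩ (A ∩ B)) (c := fun z => Metric.ball z η₀) (fun z _ => Metric.isOpen_ball)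
    (fun z hz => mem_biUnion hz (Metric.mem_ball_self hη₀))
  let 𝒱 : Finset (Set X) := hTfin.toFinset.image V
  have h𝒱 : ∀ W ∈ 𝒱, ∃ z ∈ range σ₀ ∩ (A ∩ B), W = V z := by
    intro W hW
    obtain ⟨z, hz, rfl⟩ := Finset.mem_image.1 hW
    exact ⟨z, hT (hTfin.mem_toFinset.1 hz), rfl⟩
  have hbump0 : ∀ W ∈ 𝒱, ∀ x ∈ A ∩ B, x ∉ W → bump W η x = 0 := by
    intro W hW x hx hxW
    obtain ⟨z, hz, rfl⟩ := h𝒱 W hW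
    refine bump_of_le_infDist hη ((min_le_left _ _).trans ?_)
    refine (Metric.le_infDist ⟨z, (hV z hz.2).1⟩).2 fun w hw => ?_
    rw [dist_comm]
    exact (hV z hz.2).2.2.1 w hw x hx hxW
  have hbumpb : ∀ W ∈ 𝒱, bump W η b = 0 := by
    intro W hW
    obtain ⟨z, hz, rfl⟩ := h𝒱 W hW
    refine bump_of_le_infDist hη ((min_le_right _ _).trans ?_)
    exact Metric.infDist_le_infDist_of_subset (fun w hw => ((hV z hz.2).2.1 hw).1)
      ⟨z, (hV z hz.2).1⟩
  have hbump01 : ∀ W ∈ 𝒱, ∀ x ∈ A ∩ B, bump W η x = 0 ∨ bump W η x = 1 := fun W hW x hx =>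
    if h : x ∈ W then Or.inr (bump_of_mem η h) else Or.inl (hbump0 W hW x hx h)
  -- The class of `x` is in the finite family `𝒱`, and exactly its bump is `1` at `x`.
  have hsum : ∀ x ∈ range σ₀ ∩ (A ∩ B), ∑ W ∈ 𝒱, bump W η x = 1 := by
    intro x hx
    obtain ⟨z, hzT, hz⟩ := mem_iUnion₂.1 (hTK hx)
    have hzZ := hT hzT
    have hxV : x ∈ V z := by
      by_contra hxV
      have := (hV z hzZ.2).2.2.1 z (hV z hzZ.2).1 x hx.2 hxV
      rw [Metric.mem_ball, dist_comm] at hz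
      linarith
    rw [Finset.sum_eq_single_of_mem (V z) (Finset.mem_image_of_mem V (hTfin.mem_toFinset.2 hzT)),
      bump_of_mem η hxV]
    intro W hW hne
    refine hbump0 W hW x hx.2 fun hxW => hne ?_
    obtain ⟨z', hz', rfl⟩ := h𝒱 W hW
    rw [← (hV z' hz'.2).2.2.2 x hxW, ← (hV z hzZ.2).2.2.2 x hxV]
  by_contra! hcon
  -- On `τ y`, which misses `W`, the bump vanishes at every crossing of `A ∩ B`. So it can be cut
  -- off continuously to a real lift with end values `0`, and by homotopy there is such a lift along
  -- `σ₀`.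
  have key : ∀ W ∈ 𝒱, ∃ m : I → ℝ, Continuous m ∧
      (∀ t, (m t : AddCircle (1 : ℝ)) = sideMap B (bump W η) (σ₀ t)) ∧ m 0 = 0 ∧ m 1 = 0 := by
    intro W hW
    obtain ⟨z, hz, hWz⟩ := h𝒱 W hW
    obtain ⟨y, hy⟩ := hδ' z hz
    have hWy : W ⊆ Metric.ball (y : X) (r y) := by
      rw [hWz]
      exact fun w hw => hy ((hV z hz.2).2.1 hw).2
    have hc := continuous_sideMap hA hB hAB (continuous_bump W η) (hbump01 W hW)
    have h1 := hcon W (bump W η) hc σ₀ (τ y) (continuous_bump W η)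
      (by rw [hWz]; exact fun w hw => ((hV z hz.2).2.1 hw).1)
      (Metric.isBounded_ball.subset hWy) (hbump0 W hW)
    have hl : Continuous fun t => if τ y t ∈ B then bump W η (τ y t) else 0 := by
      refine continuous_ite_mem (A := τ y ⁻¹' A) (B := τ y ⁻¹' B) (hA.preimage (τ y).continuous)
        (hB.preimage (τ y).continuous) (by rw [← preimage_union, hAB, preimage_univ])
        ((continuous_bump W η).comp (τ y).continuous) fun t ht => ?_
      exact hbump0 W hW _ ht fun h => hτ y y.2 t (hWy h)
    obtain ⟨m, hm, hm', hm0, hm1⟩ := h1.exists_lift hl (fun t => by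
      change _ = sideMap B (bump W η) (τ y t)
      rw [sideMap]
      split_ifs <;> simp)
    refine ⟨m, hm, hm', ?_, ?_⟩
    · rw [hm0, (τ y).source, if_neg ha]
    · rw [hm1, (τ y).target, if_pos hbB, hbumpb W hW]
  choose! m hm hm' hm0 hm1 using key
  -- A second lift of the sum of the maps: the bumps add up to `1` where `σ₀` crosses `A ∩ B`, so
  -- the value off `B` can be taken to be `1`. It runs from `1` to `0`, while the sum of the lifts
  -- `m W` runs from `0` to `0`.
  have hN : Continuous fun t => if σ₀ t ∈ B then ∑ W ∈ 𝒱, bump W η (σ₀ t) else 1 := by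
    refine continuous_ite_mem (A := σ₀ ⁻¹' A) (B := σ₀ ⁻¹' B) (hA.preimage σ₀.continuous)
      (hB.preimage σ₀.continuous) (by rw [← preimage_union, hAB, preimage_univ])
      (continuous_finsetSum _ fun W _ => (continuous_bump W η).comp σ₀.continuous) fun t ht => ?_
    exact hsum _ ⟨⟨t, rfl⟩, ht⟩
  have hM : Continuous fun t => ∑ W ∈ 𝒱, m W t := continuous_finsetSum _ fun W hW => hm W hW
  have := sub_eq_sub_of_lifts hM hN fun t => by
    have e : ((∑ W ∈ 𝒱, m W t : ℝ) : AddCircle (1 : ℝ)) =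
        ∑ W ∈ 𝒱, sideMap B (bump W η) (σ₀ t) := by
      rw [← Finset.sum_congr rfl fun W hW => hm' W hW t]
      exact map_sum (QuotientAddGroup.mk' _) _ _
    rw [e]
    simp only [sideMap]
    split_ifs
    · exact (map_sum (QuotientAddGroup.mk' (AddSubgroup.zmultiples (1 : ℝ))) _ _).symm
    · rw [Finset.sum_const_zero]
      exact (AddCircle.coe_period (1 : ℝ)).symm
  simp only [σ₀.source, σ₀.target, if_neg ha, if_pos hbB] at this
  rw [Finset.sum_congr rfl hm0, Finset.sum_congr rfl hm1, Finset.sum_congr rfl hbumpb] at this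
  simp at this

/-- Away from `V` the circle map has a real lift, `v` on `B` and `0` elsewhere. So the map, moved
along with one translate of the loop formed by `σ₀` and `σ₁`, detects this translate and kills those
that are far away. -/
theorem uncountable_of_ultrametric_separation [PathConnectedSpace X] {A B : Set X}
    (hA : IsClosed A) (hB : IsClosed B) (hAB : A ∪ B = univ) {a b : X} (ha : a ∉ B) (hb : b ∉ A)
    (hZ : IsUltrametricSet (A ∩ B)) (hcut : ∀ z x y : X, x ≠ z → y ≠ z → JoinedIn {z}ᶜ x y)
    (hhom : IsHomogeneousMetric X)
    (hsep : ∀ R : ℝ, ∃ u : I → X, ∀ r s, r ≠ s → R ≤ dist (u r) (u s)) (o : X) :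
    Uncountable (FundamentalGroup X o) := by
  classical
  obtain ⟨V, v, hf, σ₀, σ₁, hv, hVZ, hVb, hv0, hσ⟩ :=
    exists_sideMap_not_homotopic hA hB hAB ha hb hZ hcut
  let c : X := a
  obtain ⟨D, hD⟩ := (hVb.union ((isCompact_range σ₀.continuous).isBounded.union
    (isCompact_range σ₁.continuous).isBounded)).subset_ball c
  obtain ⟨u, hu⟩ := hsep (2 * D)
  choose φ hφu using fun r => hhom c (u r)
  have hφ : ∀ r s, r ≠ s → 2 * D ≤ dist (φ r c) (φ s c) := fun r s hrs => by
    rw [hφu, hφu]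
    exact hu r s hrs
  let s : ∀ r, Path o (φ r a) := fun r => (PathConnectedSpace.joined o (φ r a)).somePath
  let L : I → FundamentalGroup X o := fun r => Path.Homotopic.Quotient.mk
    (lassoPath (s r) (σ₀.map (φ r).continuous) (σ₁.map (φ r).continuous))
  have hL : Function.Injective L := by
    intro r r' hrr
    by_contra hne
    -- The set `V` and both paths lie in the ball of radius `D` around `c`. Centres at distance at
    -- least `2 * D` give disjoint translates of this ball, so the translate by `φ r'` misses that
    -- of `V` by `φ r`.
    let g : C(X, AddCircle (1 : ℝ)) := ⟨sideMap B v ∘ (φ r).symm, hf.comp (φ r).symm.continuous⟩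
    have h1 := (Path.Homotopic.Quotient.exact hrr).map g
    rw [lassoPath_map, lassoPath_map] at h1
    have hdisj : ∀ x ∈ Metric.ball c D, (φ r).symm (φ r' x) ∉ V := by
      intro x hx hxV
      have h2 := hD (Or.inl hxV)
      rw [Metric.mem_ball] at hx h2
      rw [← (φ r).dist_eq, IsometryEquiv.apply_symm_apply] at h2
      rw [← (φ r').dist_eq] at hx
      linarith [hφ r r' hne, dist_triangle_left (φ r c) (φ r' c) (φ r' x)]
    have hlift : ∀ f : Path a b, (∀ t, f t ∈ Metric.ball c D) →
        (Continuous fun t => if (φ r).symm (φ r' (f t)) ∈ B then v ((φ r).symm (φ r' (f t))) else 0) ∧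
        ∀ t, (((if (φ r).symm (φ r' (f t)) ∈ B then v ((φ r).symm (φ r' (f t))) else 0 : ℝ)) :
          AddCircle (1 : ℝ)) = g (φ r' (f t)) := by
      intro f hfD
      have hcont : Continuous fun t => (φ r).symm (φ r' (f t)) :=
        (φ r).symm.continuous.comp ((φ r').continuous.comp f.continuous)
      refine ⟨continuous_ite_mem (hA.preimage hcont) (hB.preimage hcont)
        (by rw [← preimage_union, hAB, preimage_univ]) (hv.comp hcont) fun t ht =>
          hv0 _ ht (hdisj _ (hfD t)), fun t => ?_⟩
      change _ = sideMap B v _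
      rw [sideMap]
      split_ifs <;> simp
    obtain ⟨hl₀, hl₀'⟩ := hlift σ₀ fun t => hD (Or.inr (Or.inl ⟨t, rfl⟩))
    obtain ⟨hl₁, hl₁'⟩ := hlift σ₁ fun t => hD (Or.inr (Or.inr ⟨t, rfl⟩))
    have h2 : ((σ₀.map (φ r').continuous).map g.continuous).Homotopic
        ((σ₁.map (φ r').continuous).map g.continuous) :=
      Path.Homotopic.of_lifts hl₀ hl₁ hl₀' hl₁' (by simp) (by simp)
    have h3 := (lassoPath_homotopic_refl_iff _ _ _).1
      (h1.trans ((lassoPath_homotopic_refl_iff _ _ _).2 h2))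
    have e : ∀ x, sideMap B v x = g (φ r x) := fun x => by
      change _ = sideMap B v ((φ r).symm (φ r x))
      rw [IsometryEquiv.symm_apply_apply]
    apply hσ
    convert h3.pathCast (e a) (e b) using 1
    · ext t
      exact e _
    · ext t
      exact e _
  have : Uncountable I := by
    rw [← not_countable_iff]
    intro h
    exact absurd (Cardinal.Real.Icc_countable_iff.1 (h : (Icc (0 : ℝ) 1).Countable)) (by norm_num)
  exact hL.uncountable

/-- If there is no cut point, `A ∩ B` is nontrivial: a path from `a` to `b` that avoids one point of
it still has to cross it. -/
theorem simplyConnectedSpace_or_uncountable_of_ultrametric_separation [CompleteSpace X]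
    (hX : IsGeodesicSpace X) (hhom : IsHomogeneousMetric X) {A B : Set X} (hA : IsClosed A)
    (hB : IsClosed B) (hAB : A ∪ B = univ) {a b : X} (ha : a ∉ B) (hb : b ∉ A)
    (hZ : IsUltrametricSet (A ∩ B))
    (hsep : (A ∩ B).Nontrivial → ∀ R : ℝ, ∃ u : I → X, ∀ r s, r ≠ s → R ≤ dist (u r) (u s)) :
    SimplyConnectedSpace X ∨ ∀ o : X, Uncountable (FundamentalGroup X o) := by
  have : Nonempty X := ⟨a⟩
  have := hX.pathConnectedSpace
  by_cases hcut : ∀ z x y : X, x ≠ z → y ≠ z → JoinedIn {z}ᶜ x y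
  · refine Or.inr fun o => uncountable_of_ultrametric_separation hA hB hAB ha hb hZ hcut hhom
      (hsep ?_) o
    have haA : a ∈ A := (hAB ▸ mem_univ a : a ∈ A ∪ B).resolve_right ha
    have hbB : b ∈ B := (hAB ▸ mem_univ b : b ∈ A ∪ B).resolve_left hb
    obtain ⟨z, -, hz⟩ := nonempty_inter_of_isPreconnected isPreconnected_univ hA hB hAB
      (mem_univ a) haA (mem_univ b) hbB
    obtain ⟨f, hf⟩ := hcut z a b (fun e => ha (e ▸ hz.2)) (fun e => hb (e ▸ hz.1))
    obtain ⟨_, ⟨t, rfl⟩, ht⟩ := nonempty_inter_of_isPreconnected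
      (isPreconnected_range f.continuous) hA hB hAB ⟨0, f.source⟩ haA ⟨1, f.target⟩ hbB
    exact ⟨f t, ht, z, hz, hf t⟩
  · push Not at hcut
    obtain ⟨z, x, y, hx, hy, hxy⟩ := hcut
    exact simplyConnectedSpace_or_uncountable_of_cutPoint hX hhom hx hy hxy

end Separation


/-! ### Word metrics are discretely geodesic -/

section WordLength

variable {G : Type*} [Group G] {S : Set G}

theorem wordLength_inv (hS : Subgroup.closure S = ⊤) (g : G) :
    wordLength S g⁻¹ = wordLength S g :=
  le_antisymm (wordLength_inv_le hS g) (by simpa using wordLength_inv_le hS g⁻¹)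

/-- The prefixes of a geodesic word. -/
theorem exists_geodesic_prefixes (hS : Subgroup.closure S = ⊤) (g : G) :
    ∃ c : ℕ → G, c 0 = 1 ∧ c (wordLength S g) = g ∧
      ∀ i j, i ≤ j → j ≤ wordLength S g → wordLength S ((c i)⁻¹ * c j) = j - i := by
  obtain ⟨l, hl, hlp, hll⟩ := exists_word hS g
  have hle : ∀ i j, i ≤ j → j ≤ wordLength S g →
      wordLength S ((l.take i).prod⁻¹ * (l.take j).prod) ≤ j - i := by
    intro i j hij hj
    have e : (l.take i).prod⁻¹ * (l.take j).prod = ((l.take j).drop i).prod := by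
      rw [inv_mul_eq_iff_eq_mul, ← List.prod_append]
      congr 1
      conv_lhs => rw [← List.take_append_drop i (l.take j)]
      rw [List.take_take, min_eq_left hij]
    rw [e]
    refine (wordLength_le fun x hx => hl x ?_).trans ?_
    · exact List.mem_of_mem_take (List.mem_of_mem_drop hx)
    · rw [List.length_drop, List.length_take]
      omega
  have hfull : (l.take (wordLength S g)).prod = g := by
    rw [← hll, List.take_length, hlp]
  refine ⟨fun i => (l.take i).prod, by simp, hfull, fun i j hij hj =>
    le_antisymm (hle i j hij hj) ?_⟩
  change j - i ≤ wordLength S ((l.take i).prod⁻¹ * (l.take j).prod)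
  have h1 := hle 0 i i.zero_le (hij.trans hj)
  have h2 := hle j _ hj le_rfl
  rw [hfull] at h2
  have h3 := wordLength_mul_le hS ((l.take 0).prod⁻¹ * (l.take i).prod)
    ((l.take i).prod⁻¹ * (l.take j).prod)
  have h4 := wordLength_mul_le hS ((l.take 0).prod⁻¹ * (l.take i).prod *
    ((l.take i).prod⁻¹ * (l.take j).prod)) ((l.take j).prod⁻¹ * g)
  have e : (l.take 0).prod⁻¹ * (l.take i).prod * ((l.take i).prod⁻¹ * (l.take j).prod) *
    ((l.take j).prod⁻¹ * g) = g := by simp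
  rw [e] at h4
  omega

/-- A subadditive function is at most linear in the word length. -/
theorem le_mul_wordLength (hS : Subgroup.closure S = ⊤) {f : G → ℝ} {c : ℝ} (h1 : f 1 ≤ 0)
    (hmul : ∀ g h, f (g * h) ≤ f g + f h) (hc : ∀ x, x ∈ S ∨ x⁻¹ ∈ S → f x ≤ c) (g : G) :
    f g ≤ c * wordLength S g := by
  obtain ⟨l, hl, rfl, hll⟩ := exists_word hS g
  rw [← hll]
  clear hll
  induction l with
  | nil => simpa using h1
  | cons x l ih =>
    have h2 := ih fun y hy => hl y (List.mem_cons_of_mem x hy)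
    have h3 := hmul x l.prod
    have h4 := hc x (hl x List.mem_cons_self)
    rw [List.prod_cons, List.length_cons]
    push_cast
    linarith

theorem exists_bound_on_letters {S : Set G} (hS : S.Finite) (f : G → ℝ) :
    ∃ c, 0 < c ∧ ∀ x, x ∈ S ∨ x⁻¹ ∈ S → f x ≤ c := by
  obtain ⟨c, hc⟩ := ((hS.union hS.inv).image f).bddAbove
  exact ⟨max c 1, by positivity, fun x hx => le_max_of_le_left (hc ⟨x, hx, rfl⟩)⟩

theorem exists_wordLength_le_mul (hS : Subgroup.closure S = ⊤) {S' : Set G} (hS' : S'.Finite)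
    (hS'g : Subgroup.closure S' = ⊤) :
    ∃ c : ℝ, 0 < c ∧ ∀ g, (wordLength S g : ℝ) ≤ c * wordLength S' g := by
  obtain ⟨c, hc0, hc⟩ := exists_bound_on_letters hS' fun g => (wordLength S g : ℝ)
  refine ⟨c, hc0, le_mul_wordLength hS'g (f := fun g => (wordLength S g : ℝ)) ?_ ?_ hc⟩
  · simp [wordLength_one]
  · intro g h
    exact_mod_cast wordLength_mul_le hS g h

instance (S : Set G) (hS : Subgroup.closure S = ⊤) : Group (WordMetricSpace S hS) :=
  inferInstanceAs (Group G)

instance (S : Set G) (hS : Subgroup.closure S = ⊤) :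
    IsIsometricSMul (WordMetricSpace S hS) (WordMetricSpace S hS) where
  isometry_smul (c : G) := Isometry.of_dist_eq fun (x : G) (y : G) => by
    change (wordLength S ((c * x)⁻¹ * (c * y)) : ℝ) = (wordLength S (x⁻¹ * y) : ℝ)
    congr 2
    group

/-- A metric space in which any two points are joined by a discrete geodesic. -/
def IsDiscretelyGeodesic (W : Type*) [MetricSpace W] : Prop :=
  ∀ x y : W, ∃ (m : ℕ) (c : ℕ → W), c 0 = x ∧ c m = y ∧
    ∀ i j, i ≤ j → j ≤ m → dist (c i) (c j) = j - i

theorem WordMetricSpace.isDiscretelyGeodesic (S : Set G) (hS : Subgroup.closure S = ⊤) :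
    IsDiscretelyGeodesic (WordMetricSpace S hS) := by
  intro (x : G) (y : G)
  obtain ⟨c, hc0, hc1, hc⟩ := exists_geodesic_prefixes hS (x⁻¹ * y)
  refine ⟨wordLength S (x⁻¹ * y), fun i => (x * c i : G), ?_, ?_, fun i j hij hj => ?_⟩
  · change x * c 0 = x
    rw [hc0, mul_one]
  · change x * c _ = y
    rw [hc1, mul_inv_cancel_left]
  · change (wordLength S ((x * c i)⁻¹ * (x * c j)) : ℝ) = _
    rw [← Nat.cast_sub hij, ← hc i j hij hj]
    congr 2
    group

end WordLength


/-! ### Limit sets, completeness and geodesics in asymptotic cones -/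

section Cone

open Set unitInterval

variable {W : Type*} [MetricSpace W] {ω : Ultrafilter ℕ} {e : ℕ → W} {d : ScalingSequence ω}

/-- Divergence of `d` excludes principal ultrafilters: the first `k` values are bounded by their
sum. -/
theorem ScalingSequence.eventually_ge (d : ScalingSequence ω) (k : ℕ) : ∀ᶠ n in ω, k ≤ n := by
  have h := d.divergent.eventually_gt_atTop (∑ i ∈ Finset.range k, d.toFun i)
  filter_upwards [h] with n hn
  by_contra! hlt
  exact hn.not_ge (Finset.single_le_sum (f := d.toFun) (fun i _ => (d.pos i).le)
    (Finset.mem_range.2 hlt))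

/-- `κ n` is the largest `k ≤ n` for which `p 0, …, p k` all hold at `n`. -/
theorem ScalingSequence.exists_diagonal (d : ScalingSequence ω) {p : ℕ → ℕ → Prop}
    (hp : ∀ k, ∀ᶠ n in ω, p k n) : ∃ κ : ℕ → ℕ, Tendsto κ ω atTop ∧ ∀ᶠ n in ω, p (κ n) n := by
  classical
  obtain ⟨P, hP⟩ : ∃ P : ℕ → ℕ → Prop, ∀ n k, P n k ↔ ∀ j ∈ Finset.range (k + 1), p j n :=
    ⟨_, fun _ _ => Iff.rfl⟩
  have hp' : ∀ k, ∀ᶠ n in ω, P n k := fun k => by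
    simp only [hP]
    exact (eventually_all_finset _).2 fun j _ => hp j
  refine ⟨fun n => Nat.findGreatest (P n) n, tendsto_atTop.2 fun k => ?_, ?_⟩
  · filter_upwards [hp' k, d.eventually_ge k] with n hn hk
    exact Nat.le_findGreatest hk hn
  · filter_upwards [hp' 0] with n hn
    exact (hP _ _).1 (Nat.findGreatest_spec n.zero_le hn) _ (Finset.self_mem_range_succ _)

theorem ScalingSequence.tendsto_const_div (d : ScalingSequence ω) (c : ℝ) :
    Tendsto (fun n => c / d.toFun n) ω (𝓝 0) := d.divergent.const_div_atTop c

/-- A sequence that stays close to an element of the precone. -/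
def PreCone.ofNear (x : PreCone W ω e d) (y : ℕ → W)
    (h : OmegaBounded ω fun n => dist (y n) (x.1 n) / d.toFun n) : PreCone W ω e d :=
  ⟨y, (h.add x.2).mono fun n => by
    rw [← add_div]
    exact div_le_div_of_nonneg_right (dist_triangle _ _ _) (d.pos n).le⟩

theorem Filter.Tendsto.omegaBounded {c : ℕ → ℝ} {a : ℝ} (h : Tendsto c ω (𝓝 a)) :
    OmegaBounded ω c := ⟨a + 1, h.eventually (gt_mem_nhds (lt_add_one a))⟩

theorem PreCone.dist_eq_of_tendsto {x y : PreCone W ω e d} {a : ℝ}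
    (h : Tendsto (fun n => dist (x.1 n) (y.1 n) / d.toFun n) ω (𝓝 a)) : dist x y = a :=
  tendsto_nhds_unique (x.tendsto y) h

theorem PreCone.mk_eq_mk {x y : PreCone W ω e d}
    (h : Tendsto (fun n => dist (x.1 n) (y.1 n) / d.toFun n) ω (𝓝 0)) :
    (SeparationQuotient.mk x : AsymptoticCone W ω e d) = SeparationQuotient.mk y :=
  SeparationQuotient.mk_eq_mk.2 (Metric.inseparable_iff.2 (PreCone.dist_eq_of_tendsto h))

theorem PreCone.tendsto_of_mk_eq {x y : PreCone W ω e d}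
    (h : (SeparationQuotient.mk x : AsymptoticCone W ω e d) = SeparationQuotient.mk y) :
    Tendsto (fun n => dist (x.1 n) (y.1 n) / d.toFun n) ω (𝓝 0) := by
  have h1 := x.tendsto y
  have h2 : dist x y = 0 := Metric.inseparable_iff.1 (SeparationQuotient.mk_eq_mk.1 h)
  change Tendsto _ _ (𝓝 (dist x y)) at h1
  rwa [h2] at h1

/-- The limit is a diagonal `n ↦ u (κ n) n`, with `κ` growing so slowly that at `n` the terms up to
`κ n` already have their prescribed distances. -/
instance PreCone.instCompleteSpace : CompleteSpace (PreCone W ω e d) := by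
  refine Metric.complete_of_convergent_controlled_sequences (fun N => (1 / 2) ^ N)
    (fun N => by positivity) fun u hu => ?_
  have hp : ∀ k, ∀ᶠ n in ω, ∀ i ∈ Finset.range (k + 1),
      dist ((u i).1 n) ((u k).1 n) / d.toFun n < (1 / 2) ^ i := fun k =>
    (eventually_all_finset _).2 fun i hi => ((u i).tendsto (u k)).eventually
      (gt_mem_nhds (hu i i k le_rfl (Nat.lt_succ_iff.1 (Finset.mem_range.1 hi))))
  obtain ⟨κ, hκ, hκp⟩ := d.exists_diagonal hp
  have key : ∀ i, ∀ᶠ n in ω, dist ((u i).1 n) ((u (κ n)).1 n) / d.toFun n < (1 / 2) ^ i := by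
    intro i
    filter_upwards [hκp, hκ.eventually_ge_atTop i] with n hn hi
    exact hn i (Finset.mem_range.2 (Nat.lt_succ_iff.2 hi))
  let y : PreCone W ω e d := (u 0).ofNear (fun n => (u (κ n)).1 n) ⟨1, by
    filter_upwards [key 0] with n hn
    rw [dist_comm]
    simpa using hn⟩
  refine ⟨y, tendsto_iff_dist_tendsto_zero.2 ?_⟩
  refine squeeze_zero (fun _ => dist_nonneg) (fun i => ?_)
    (tendsto_pow_atTop_nhds_zero_of_lt_one (by norm_num : (0 : ℝ) ≤ 1 / 2) (by norm_num))
  exact le_of_tendsto ((u i).tendsto y) ((key i).mono fun n hn => hn.le)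

/-- The points of the cone that are limits of points of `P n`. -/
def coneSet (e : ℕ → W) (d : ScalingSequence ω) (P : ℕ → Set W) : Set (AsymptoticCone W ω e d) :=
  {z | ∃ x : PreCone W ω e d, SeparationQuotient.mk x = z ∧ ∀ᶠ n in ω, x.1 n ∈ P n}

theorem mk_mem_coneSet {P : ℕ → Set W} (x : PreCone W ω e d) {y : ℕ → W}
    (hy : ∀ᶠ n in ω, y n ∈ P n)
    (h : Tendsto (fun n => dist (y n) (x.1 n) / d.toFun n) ω (𝓝 0)) :
    SeparationQuotient.mk x ∈ coneSet e d P :=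
  ⟨x.ofNear y h.omegaBounded, PreCone.mk_eq_mk h, hy⟩

theorem isClosed_coneSet (P : ℕ → Set W) : IsClosed (coneSet e d P) := by
  refine isClosed_of_closure_subset fun z hz => ?_
  obtain ⟨w, rfl⟩ := SeparationQuotient.surjective_mk z
  have hex : ∀ k : ℕ, ∃ x : PreCone W ω e d, dist x w < 1 / (k + 1) ∧ ∀ᶠ n in ω, x.1 n ∈ P n := by
    intro k
    obtain ⟨_, ⟨x, rfl, hx⟩, hxw⟩ := Metric.mem_closure_iff.1 hz (1 / (k + 1)) (by positivity)
    rw [dist_comm, SeparationQuotient.dist_mk] at hxw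
    exact ⟨x, hxw, hx⟩
  choose x hx hxP using hex
  obtain ⟨κ, hκ, hκp⟩ := d.exists_diagonal fun k =>
    (((x k).tendsto w).eventually (gt_mem_nhds (hx k))).and (hxP k)
  refine mk_mem_coneSet w (y := fun n => (x (κ n)).1 n) (hκp.mono fun n hn => hn.2) ?_
  refine squeeze_zero' (Eventually.of_forall fun n => div_nonneg dist_nonneg (d.pos n).le)
    (hκp.mono fun n hn => hn.1.le) ?_
  exact (tendsto_one_div_add_atTop_nhds_zero_nat (𝕜 := ℝ)).comp hκ

theorem coneSet_union {P Q : ℕ → Set W} (h : ∀ n, P n ∪ Q n = univ) :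
    coneSet e d P ∪ coneSet e d Q = univ := by
  refine eq_univ_of_forall fun z => ?_
  obtain ⟨x, rfl⟩ := SeparationQuotient.surjective_mk z
  have : ∀ᶠ n in ω, x.1 n ∈ P n ∨ x.1 n ∈ Q n :=
    Eventually.of_forall fun n => (h n ▸ mem_univ (x.1 n) : x.1 n ∈ P n ∪ Q n)
  rcases Ultrafilter.eventually_or.1 this with h | h
  · exact Or.inl ⟨x, rfl, h⟩
  · exact Or.inr ⟨x, rfl, h⟩

theorem tendsto_div_of_le {c c' : ℕ → ℝ} (h0 : ∀ n, 0 ≤ c n)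
    (h : Tendsto (fun n => c' n / d.toFun n) ω (𝓝 0)) {D : ℝ} (hle : ∀ᶠ n in ω, c n ≤ c' n + D) :
    Tendsto (fun n => c n / d.toFun n) ω (𝓝 0) := by
  refine squeeze_zero' (Eventually.of_forall fun n => div_nonneg (h0 n) (d.pos n).le)
    (hle.mono fun n hn => ?_) (by simpa using h.add (d.tendsto_const_div D))
  rw [← add_div]
  exact div_le_div_of_nonneg_right hn (d.pos n).le

theorem coneSet_subset_of_near {P Q : ℕ → Set W} {D : ℝ}
    (h : ∀ n, ∀ x ∈ P n, ∃ y ∈ Q n, dist y x ≤ D) : coneSet e d P ⊆ coneSet e d Q := by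
  rintro _ ⟨x, rfl, hx⟩
  have hex : ∀ n, ∃ y, x.1 n ∈ P n → y ∈ Q n ∧ dist y (x.1 n) ≤ D := by
    intro n
    by_cases hn : x.1 n ∈ P n
    · obtain ⟨y, hy⟩ := h n _ hn
      exact ⟨y, fun _ => hy⟩
    · exact ⟨x.1 n, fun h => absurd h hn⟩
  choose y hy using hex
  refine mk_mem_coneSet x (hx.mono fun n hn => (hy n hn).1) ?_
  exact tendsto_div_of_le (fun _ => dist_nonneg) (c' := fun _ => 0) (by simp) (D := D)
    (hx.mono fun n hn => by simpa using (hy n hn).2)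

theorem coneSet_inter_subset {P Q Z : ℕ → Set W} {D : ℝ}
    (h : ∀ n, ∀ x ∈ P n, ∀ y ∈ Q n, ∃ z ∈ Z n, dist z x ≤ dist x y + D) :
    coneSet e d P ∩ coneSet e d Q ⊆ coneSet e d Z := by
  rintro _ ⟨⟨x, rfl, hx⟩, y, hxy, hy⟩
  have hlim := PreCone.tendsto_of_mk_eq hxy.symm
  have hex : ∀ n, ∃ z, x.1 n ∈ P n → y.1 n ∈ Q n →
      z ∈ Z n ∧ dist z (x.1 n) ≤ dist (x.1 n) (y.1 n) + D := by
    intro n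
    by_cases hn : x.1 n ∈ P n ∧ y.1 n ∈ Q n
    · obtain ⟨z, hz⟩ := h n _ hn.1 _ hn.2
      exact ⟨z, fun _ _ => hz⟩
    · exact ⟨x.1 n, fun h h' => absurd ⟨h, h'⟩ hn⟩
  choose z hz using hex
  refine mk_mem_coneSet x (y := z) ?_ ?_
  · filter_upwards [hx, hy] with n h1 h2 using (hz n h1 h2).1
  · refine tendsto_div_of_le (fun _ => dist_nonneg) hlim (D := D) ?_
    filter_upwards [hx, hy] with n h1 h2 using (hz n h1 h2).2

theorem tendsto_floor_sub_floor {m : ℕ → ℕ} {D : ℝ}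
    (hm : Tendsto (fun n => (m n : ℝ) / d.toFun n) ω (𝓝 D)) {s t : ℝ} (hs : 0 ≤ s) (ht : 0 ≤ t) :
    Tendsto (fun n => ((⌊t * m n⌋₊ : ℝ) - ⌊s * m n⌋₊) / d.toFun n) ω (𝓝 ((t - s) * D)) := by
  have h1 : ∀ r : ℝ, 0 ≤ r → Tendsto (fun n => (⌊r * m n⌋₊ : ℝ) / d.toFun n) ω (𝓝 (r * D)) := by
    intro r hr
    have hu := hm.const_mul r
    have hl := hu.sub (d.tendsto_const_div 1)
    rw [sub_zero] at hl
    refine tendsto_of_tendsto_of_tendsto_of_le_of_le hl hu (fun n => ?_) (fun n => ?_)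
    · simp only
      rw [← mul_div_assoc, ← sub_div]
      exact div_le_div_of_nonneg_right (Nat.sub_one_lt_floor _).le (d.pos n).le
    · simp only
      rw [← mul_div_assoc]
      exact div_le_div_of_nonneg_right (Nat.floor_le (by positivity)) (d.pos n).le
  have := (h1 t ht).sub (h1 s hs)
  rw [← sub_mul] at this
  exact this.congr fun n => (sub_div _ _ _).symm

/-- Discrete geodesics, run through at constant speed with rounded times, converge to a geodesic,
since rounding errors vanish after rescaling. -/
theorem AsymptoticCone.isGeodesicSpace (hW : IsDiscretelyGeodesic W) :
    IsGeodesicSpace (AsymptoticCone W ω e d) := by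
  intro a b
  obtain ⟨x, rfl⟩ := SeparationQuotient.surjective_mk a
  obtain ⟨y, rfl⟩ := SeparationQuotient.surjective_mk b
  choose m c hc0 hcm hc using fun n => hW (x.1 n) (y.1 n)
  have hm : Tendsto (fun n => (m n : ℝ) / d.toFun n) ω (𝓝 (dist x y)) := by
    refine (x.tendsto y).congr fun n => ?_
    have := hc n 0 (m n) (Nat.zero_le _) le_rfl
    rw [hc0, hcm] at this
    rw [this]
    simp
  have hfl : ∀ (t : I) n, ⌊(t : ℝ) * m n⌋₊ ≤ m n := fun t n =>
    Nat.floor_le_of_le (mul_le_of_le_one_left (Nat.cast_nonneg _) t.2.2)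
  have hdist : ∀ s t : I, s ≤ t → Tendsto (fun n => dist (c n ⌊(s : ℝ) * m n⌋₊)
      (c n ⌊(t : ℝ) * m n⌋₊) / d.toFun n) ω (𝓝 ((t - s) * dist x y)) := by
    intro s t hst
    refine (tendsto_floor_sub_floor hm s.2.1 t.2.1).congr fun n => ?_
    rw [hc n _ _ (Nat.floor_mono (mul_le_mul_of_nonneg_right (show (s : ℝ) ≤ t from hst)
      (Nat.cast_nonneg _))) (hfl t n)]
  let T : I → PreCone W ω e d := fun t => x.ofNear (fun n => c n ⌊(t : ℝ) * m n⌋₊) (by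
    refine (hdist 0 t t.2.1).omegaBounded.mono fun n => le_of_eq ?_
    rw [dist_comm]
    simp [hc0])
  have hT : ∀ s t : I, s ≤ t → dist (T s) (T t) = (t - s) * dist x y := fun s t hst =>
    PreCone.dist_eq_of_tendsto (hdist s t hst)
  have hT' : ∀ s t : I, dist (T s) (T t) = dist s t * dist x y := by
    intro s t
    rw [Subtype.dist_eq, Real.dist_eq]
    rcases le_total s t with h | h
    · rw [hT s t h, abs_of_nonpos (sub_nonpos.2 (show (s : ℝ) ≤ t from h))]
      ring
    · rw [dist_comm, hT t s h, abs_of_nonneg (sub_nonneg.2 (show (t : ℝ) ≤ s from h))]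
  have hTc : Continuous T := by
    refine (LipschitzWith.of_dist_le_mul (K := ⟨dist x y, dist_nonneg⟩) fun s t => ?_).continuous
    rw [hT', mul_comm]
    rfl
  refine ⟨⟨⟨fun t => SeparationQuotient.mk (T t), SeparationQuotient.continuous_mk.comp hTc⟩,
    ?_, ?_⟩, fun s t u hst htu => ?_⟩
  · refine congrArg SeparationQuotient.mk (Subtype.ext (funext fun n => ?_))
    simp [T, PreCone.ofNear, hc0]
  · refine congrArg SeparationQuotient.mk (Subtype.ext (funext fun n => ?_))
    simp [T, PreCone.ofNear, hcm]
  · change dist (SeparationQuotient.mk (T s)) (SeparationQuotient.mk (T t)) +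
      dist (SeparationQuotient.mk (T t)) (SeparationQuotient.mk (T u)) =
      dist (SeparationQuotient.mk (T s)) (SeparationQuotient.mk (T u))
    rw [SeparationQuotient.dist_mk, SeparationQuotient.dist_mk, SeparationQuotient.dist_mk,
      hT s t hst, hT t u htu, hT s u (hst.trans htu)]
    ring

end Cone

/-! ### Homogeneity -/

section GroupCone

variable {W : Type*} [Group W] [MetricSpace W] [IsIsometricSMul W W] {ω : Ultrafilter ℕ}
  {e : ℕ → W} {d : ScalingSequence ω}

/-- Left translation by a sequence that moves the observation sequence a bounded distance. -/
def PreCone.translate (g : ℕ → W) (hg : OmegaBounded ω fun n => dist (g n * e n) (e n) / d.toFun n)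
    (x : PreCone W ω e d) : PreCone W ω e d :=
  ⟨fun n => g n * x.1 n, (x.2.add hg).mono fun n => by
    rw [← add_div]
    refine div_le_div_of_nonneg_right ?_ (d.pos n).le
    refine (dist_triangle _ (g n * e n) _).trans ?_
    rw [dist_mul_left]⟩

theorem PreCone.dist_translate (g : ℕ → W) (hg) (x y : PreCone W ω e d) :
    dist (x.translate g hg) (y.translate g hg) = dist x y := by
  refine PreCone.dist_eq_of_tendsto ((x.tendsto y).congr fun n => ?_)
  change _ = dist (g n * x.1 n) (g n * y.1 n) / _
  rw [dist_mul_left]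

/-- Left translation of the cone. -/
noncomputable def AsymptoticCone.translate (g : ℕ → W)
    (hg : OmegaBounded ω fun n => dist (g n * e n) (e n) / d.toFun n) :
    AsymptoticCone W ω e d → AsymptoticCone W ω e d :=
  SeparationQuotient.lift (fun x => SeparationQuotient.mk (x.translate g hg)) fun x y h => by
    refine SeparationQuotient.mk_eq_mk.2 (Metric.inseparable_iff.2 ?_)
    rw [PreCone.dist_translate]
    exact Metric.inseparable_iff.1 h

/-- Left translation by `y n * (x n)⁻¹` moves `e n` by at most the sum of its distances to `x n` and
`y n`, so it acts on the cone even though `e` is arbitrary. -/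
theorem AsymptoticCone.isHomogeneousMetric : IsHomogeneousMetric (AsymptoticCone W ω e d) := by
  intro a b
  obtain ⟨x, rfl⟩ := SeparationQuotient.surjective_mk a
  obtain ⟨y, rfl⟩ := SeparationQuotient.surjective_mk b
  have hg : ∀ x y : PreCone W ω e d,
      OmegaBounded ω fun n => dist (y.1 n * (x.1 n)⁻¹ * e n) (e n) / d.toFun n := fun x y =>
    (x.2.add y.2).mono fun n => by
      rw [← add_div]
      refine div_le_div_of_nonneg_right ?_ (d.pos n).le
      refine (dist_triangle _ (y.1 n) _).trans (add_le_add_left (le_of_eq ?_) _)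
      have := dist_mul_left (y.1 n * (x.1 n)⁻¹) (e n) (x.1 n)
      rw [inv_mul_cancel_right] at this
      rw [this, dist_comm]
  have hiso : Isometry (AsymptoticCone.translate _ (hg x y)) := Isometry.of_dist_eq fun a b => by
    obtain ⟨u, rfl⟩ := SeparationQuotient.surjective_mk a
    obtain ⟨v, rfl⟩ := SeparationQuotient.surjective_mk b
    exact PreCone.dist_translate _ (hg x y) u v
  refine ⟨IsometryEquiv.mk' _ (AsymptoticCone.translate _ (hg y x)) (fun a => ?_) hiso, ?_⟩
  · obtain ⟨u, rfl⟩ := SeparationQuotient.surjective_mk a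
    refine congrArg SeparationQuotient.mk (Subtype.ext (funext fun n => ?_))
    change y.1 n * (x.1 n)⁻¹ * (x.1 n * (y.1 n)⁻¹ * u.1 n) = u.1 n
    group
  · refine congrArg SeparationQuotient.mk (Subtype.ext (funext fun n => ?_))
    exact inv_mul_cancel_right _ _

end GroupCone


/-! ### Half-spaces and their limits -/

section HalfSpaces

open Set unitInterval

variable {W : Type*} [Group W] [MetricSpace W]

/-- The translates of `P` by the observation sequence. -/
def translates (e : ℕ → W) (P : Set W) (n : ℕ) : Set W := {x | (e n)⁻¹ * x ∈ P}

variable [IsIsometricSMul W W]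

theorem dist_inv_mul (g x y : W) : dist (g⁻¹ * x) y = dist x (g * y) := by
  rw [← dist_mul_left g, mul_inv_cancel_left]

/-- `P` is a union of right cosets of `H` and paths that leave `P` pass near `H`. -/
structure IsHalfSpace (H : Subgroup W) (P : Set W) : Prop where
  mul_mem_iff : ∀ h ∈ H, ∀ g, h * g ∈ P ↔ g ∈ P
  near : ∃ D : ℝ, ∀ x ∈ P, ∀ y ∉ P, ∃ h ∈ H, dist x h + dist h y ≤ dist x y + D
  deep : ∀ R : ℝ, ∃ x ∈ P, ∀ h ∈ H, R ≤ dist x h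

/-- On a geodesic from a deep point `x` to a nearest point `h₀` of `H`, take the point at distance
`m` from `h₀` and translate by `h₀⁻¹`. From `x` to the complement one passes near `H`, hence travels
at least the distance of `x` and `H`, up to `D`. -/
theorem IsHalfSpace.exists_deep {H : Subgroup W} {P : Set W} (hP : IsHalfSpace H P)
    (hW : IsDiscretelyGeodesic W) :
    ∃ D : ℝ, ∀ m : ℕ, ∃ g : W, dist g 1 = m ∧ ∀ q ∉ P, (m : ℝ) ≤ dist g q + D := by
  classical
  obtain ⟨D, hD⟩ := hP.near
  refine ⟨D, fun m => ?_⟩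
  obtain ⟨x, hx, hxm⟩ := hP.deep m
  have hnat : ∀ y : W, ∃ k : ℕ, dist y x = k := fun y => by
    obtain ⟨k, c, hc0, hck, hc⟩ := hW y x
    refine ⟨k, ?_⟩
    have := hc 0 k k.zero_le le_rfl
    rw [hc0, hck] at this
    simpa using this
  have hex : ∃ k : ℕ, ∃ h ∈ H, dist h x = k := by
    obtain ⟨k, hk⟩ := hnat 1
    exact ⟨k, 1, H.one_mem, hk⟩
  obtain ⟨h₀, hh₀, hk⟩ := Nat.find_spec hex
  have hmin : ∀ h ∈ H, (Nat.find hex : ℝ) ≤ dist x h := by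
    intro h hh
    obtain ⟨j, hj⟩ := hnat h
    rw [dist_comm, hj]
    exact_mod_cast Nat.find_min' hex ⟨h, hh, hj⟩
  obtain ⟨k, c, hc0, hck, hc⟩ := hW h₀ x
  have hkk : (k : ℝ) = Nat.find hex := by
    rw [← hk, ← hc0, ← hck, hc 0 k k.zero_le le_rfl]
    simp
  have hmk : m ≤ k := by
    have := hxm h₀ hh₀
    rw [dist_comm, hk, ← hkk] at this
    exact_mod_cast this
  refine ⟨h₀⁻¹ * c m, ?_, fun q hq => ?_⟩
  · rw [dist_inv_mul, mul_one, dist_comm, ← hc0, hc 0 m m.zero_le hmk]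
    simp
  · obtain ⟨h, hh, hle⟩ := hD x hx (h₀ * q) fun h => hq ((hP.mul_mem_iff h₀ hh₀ q).1 h)
    have h1 := hmin h hh
    have h2 := hc m k hmk le_rfl
    rw [hck, dist_comm] at h2
    have h3 := dist_triangle x (c m) (h₀ * q)
    rw [dist_inv_mul]
    have h4 : 0 ≤ dist h (h₀ * q) := dist_nonneg
    linarith

variable {ω : Ultrafilter ℕ} {e : ℕ → W} {d : ScalingSequence ω}

theorem ScalingSequence.tendsto_floor_div (d : ScalingSequence ω) :
    Tendsto (fun n => (⌊d.toFun n⌋₊ : ℝ) / d.toFun n) ω (𝓝 1) :=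
  (tendsto_nat_floor_div_atTop (R := ℝ)).comp d.divergent

/-- Points of depth `⌊d n⌋` converge to a point at distance at least `1` from the limit of the
complement. -/
theorem IsHalfSpace.exists_notMem_coneSet {H : Subgroup W} {P : Set W} (hP : IsHalfSpace H P)
    (hW : IsDiscretelyGeodesic W) :
    ∃ a : AsymptoticCone W ω e d, a ∉ coneSet e d (translates e Pᶜ) := by
  obtain ⟨D, hD⟩ := hP.exists_deep hW
  choose g hg hgD using hD
  have hlim : Tendsto (fun n => dist (e n * g ⌊d.toFun n⌋₊) (e n) / d.toFun n) ω (𝓝 1) := by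
    refine d.tendsto_floor_div.congr fun n => ?_
    rw [← hg ⌊d.toFun n⌋₊, ← dist_mul_left (e n) (g _), mul_one]
  refine ⟨SeparationQuotient.mk ⟨_, hlim.omegaBounded⟩, ?_⟩
  rintro ⟨y, hy, hyP⟩
  have h0 := PreCone.tendsto_of_mk_eq hy
  have h1 := h0.add (d.tendsto_const_div D)
  have := le_of_tendsto_of_tendsto d.tendsto_floor_div h1 (hyP.mono fun n hn => by
    change (⌊d.toFun n⌋₊ : ℝ) / d.toFun n ≤
      dist (y.1 n) (e n * g ⌊d.toFun n⌋₊) / d.toFun n + D / d.toFun n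
    rw [← add_div]
    refine div_le_div_of_nonneg_right ?_ (d.pos n).le
    have := hgD ⌊d.toFun n⌋₊ _ hn
    rwa [dist_comm, dist_inv_mul] at this)
  norm_num at this

/-- Close points on different sides have `H` nearby. Conversely `H` is within bounded distance of
each side, because each side contains a coset `H p`. -/
theorem IsHalfSpace.coneSet_inter {H : Subgroup W} {P : Set W} (hP : IsHalfSpace H P)
    (hP' : IsHalfSpace H Pᶜ) :
    coneSet e d (translates e P) ∩ coneSet e d (translates e Pᶜ) =
      coneSet e d (translates e (H : Set W)) := by
  have hsub : ∀ {Q : Set W}, IsHalfSpace H Q →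
      coneSet e d (translates e (H : Set W)) ⊆ coneSet e d (translates e Q) := by
    intro Q hQ
    obtain ⟨p, hp, -⟩ := hQ.deep 0
    refine coneSet_subset_of_near (D := dist p 1) fun n x hx => ⟨x * p, ?_, ?_⟩
    · change (e n)⁻¹ * (x * p) ∈ Q
      rw [← mul_assoc]
      exact (hQ.mul_mem_iff _ hx p).2 hp
    · rw [← dist_mul_left x p 1, mul_one]
  refine subset_antisymm ?_ (subset_inter (hsub hP) (hsub hP'))
  obtain ⟨D, hD⟩ := hP.near
  refine coneSet_inter_subset (D := D) fun n x hx y hy => ?_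
  obtain ⟨h, hh, hle⟩ := hD _ hx _ hy
  refine ⟨e n * h, ?_, ?_⟩
  · change (e n)⁻¹ * (e n * h) ∈ H
    rwa [inv_mul_cancel_left]
  · rw [dist_mul_left, dist_inv_mul] at hle
    rw [dist_comm]
    linarith [dist_nonneg (x := h) (y := (e n)⁻¹ * y)]

end HalfSpaces

/-! ### The logarithm of the intrinsic length -/

section LogLength

variable {W : Type*} [Group W]

open Classical in
/-- The logarithm of the intrinsic word length. -/
noncomputable def logLength {H : Subgroup W} (T : Set H) (g : W) : ℝ :=
  if hg : g ∈ H then Real.log (1 + wordLength T (⟨g, hg⟩ : H)) else 0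

variable {H : Subgroup W} {T : Set H}

theorem logLength_of_mem {g : W} (hg : g ∈ H) :
    logLength T g = Real.log (1 + wordLength T (⟨g, hg⟩ : H)) := dif_pos hg

theorem logLength_nonneg (g : W) : 0 ≤ logLength T g := by
  rw [logLength]
  split_ifs
  · exact Real.log_nonneg (by simp)
  · exact le_rfl

theorem logLength_inv (hT : Subgroup.closure T = ⊤) (g : W) :
    logLength T g⁻¹ = logLength T g := by
  by_cases hg : g ∈ H
  · rw [logLength_of_mem hg, logLength_of_mem (H.inv_mem hg), ← wordLength_inv hT ⟨g, hg⟩]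
    rfl
  · rw [logLength, logLength, dif_neg hg, dif_neg fun h => hg (H.inv_mem_iff.1 h)]

/-- The intrinsic length of a product is at most twice the larger length. -/
theorem logLength_mul_le (hT : Subgroup.closure T = ⊤) {g h : W} (hg : g ∈ H) (hh : h ∈ H) :
    logLength T (g * h) ≤ max (logLength T g) (logLength T h) + Real.log 2 := by
  rw [logLength_of_mem hg, logLength_of_mem hh, logLength_of_mem (H.mul_mem hg hh)]
  have h1 : (wordLength T (⟨g * h, H.mul_mem hg hh⟩ : H) : ℝ) ≤
      wordLength T (⟨g, hg⟩ : H) + wordLength T (⟨h, hh⟩ : H) := by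
    exact_mod_cast wordLength_mul_le hT (⟨g, hg⟩ : H) ⟨h, hh⟩
  set a := wordLength T (⟨g, hg⟩ : H)
  set b := wordLength T (⟨h, hh⟩ : H)
  have ha : (0 : ℝ) ≤ a := Nat.cast_nonneg _
  have hb : (0 : ℝ) ≤ b := Nat.cast_nonneg _
  have key : ∀ c : ℝ, 0 ≤ c → a ≤ c → b ≤ c →
      Real.log (1 + wordLength T (⟨g * h, H.mul_mem hg hh⟩ : H)) ≤ Real.log (1 + c) + Real.log 2 := by
    intro c hc hac hbc
    rw [← Real.log_mul (by positivity) two_ne_zero]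
    exact Real.log_le_log (by positivity) (by linarith)
  rcases le_total (a : ℝ) b with h | h
  · exact (key b hb h le_rfl).trans (add_le_add_left (le_max_right _ _) _)
  · exact (key a ha le_rfl h).trans (add_le_add_left (le_max_left _ _) _)

end LogLength

/-! ### Limits of logarithmic subgroups -/

section Distortion

open Set unitInterval

variable {W : Type*} [Group W] [MetricSpace W] [IsIsometricSMul W W]

/-- A subgroup whose intrinsic word length is exponential in the ambient distance. -/
structure IsLogarithmicSubgroup (H : Subgroup W) (T : Set H) (C : ℝ) : Prop where
  closure : Subgroup.closure T = ⊤
  pos : 0 < C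
  log_le : ∀ h : H, Real.log (1 + wordLength T h) ≤ C * dist 1 (h : W) + C
  dist_le : ∀ h : H, dist 1 (h : W) ≤ C * Real.log (1 + wordLength T h) + C

variable {H : Subgroup W} {T : Set H} {C : ℝ}

theorem IsLogarithmicSubgroup.logLength_le (hH : IsLogarithmicSubgroup H T C) {g h : W} (hg : g⁻¹ * h ∈ H) :
    logLength T (g⁻¹ * h) ≤ C * dist g h + C := by
  rw [logLength_of_mem hg]
  have := hH.log_le ⟨_, hg⟩
  rwa [dist_comm, dist_inv_mul, mul_one, dist_comm] at this

theorem IsLogarithmicSubgroup.dist_le_logLength (hH : IsLogarithmicSubgroup H T C) {g h : W} (hg : g⁻¹ * h ∈ H) :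
    dist g h ≤ C * logLength T (g⁻¹ * h) + C := by
  rw [logLength_of_mem hg]
  have := hH.dist_le ⟨_, hg⟩
  rwa [dist_comm, dist_inv_mul, mul_one, dist_comm] at this

variable {ω : Ultrafilter ℕ} {e : ℕ → W} {d : ScalingSequence ω}

/-- The ultrametric is the limit of `logLength / d n`: the error `log 2` in the strong triangle
inequality and the additive constants in the comparison with the metric tend to `0`. -/
theorem IsLogarithmicSubgroup.isUltrametricSet_coneSet (hH : IsLogarithmicSubgroup H T C) :
    IsUltrametricSet (coneSet e d (translates e (H : Set W))) := by
  have hrep : ∀ z : AsymptoticCone W ω e d, ∃ x : PreCone W ω e d, SeparationQuotient.mk x = z ∧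
      (z ∈ coneSet e d (translates e (H : Set W)) → ∀ᶠ n in ω, (e n)⁻¹ * x.1 n ∈ H) := by
    intro z
    by_cases hz : z ∈ coneSet e d (translates e (H : Set W))
    · obtain ⟨x, hx, hxP⟩ := hz
      exact ⟨x, hx, fun _ => hxP⟩
    · obtain ⟨x, hx⟩ := SeparationQuotient.surjective_mk z
      exact ⟨x, hx, fun h => absurd h hz⟩
  choose x hx hxH using hrep
  have hmem : ∀ z ∈ coneSet e d (translates e (H : Set W)), ∀ w ∈ coneSet e d (translates e (H : Set W)),
      ∀ᶠ n in ω, ((x z).1 n)⁻¹ * (x w).1 n ∈ H := by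
    intro z hz w hw
    filter_upwards [hxH z hz, hxH w hw] with n h1 h2
    have := H.mul_mem (H.inv_mem h1) h2
    rwa [mul_inv_rev, inv_inv, mul_assoc, mul_inv_cancel_left] at this
  let f : AsymptoticCone W ω e d → AsymptoticCone W ω e d → ℕ → ℝ := fun z w n =>
    logLength T (((x z).1 n)⁻¹ * (x w).1 n) / d.toFun n
  have hdist : ∀ z w, Tendsto (fun n => dist ((x z).1 n) ((x w).1 n) / d.toFun n) ω
      (𝓝 (dist z w)) := by
    intro z w
    conv => rhs; rw [← hx z, ← hx w, SeparationQuotient.dist_mk]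
    exact (x z).tendsto (x w)
  have hle : ∀ z ∈ coneSet e d (translates e (H : Set W)), ∀ w ∈ coneSet e d (translates e (H : Set W)),
      ∀ᶠ n in ω, f z w n ≤ C * (dist ((x z).1 n) ((x w).1 n) / d.toFun n) + C / d.toFun n := by
    intro z hz w hw
    filter_upwards [hmem z hz w hw] with n hn
    rw [← mul_div_assoc, ← add_div]
    exact div_le_div_of_nonneg_right (hH.logLength_le hn) (d.pos n).le
  have hf : ∀ z ∈ coneSet e d (translates e (H : Set W)), ∀ w ∈ coneSet e d (translates e (H : Set W)),
      Tendsto (f z w) ω (𝓝 (omegaLim ω (f z w))) := by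
    intro z hz w hw
    refine OmegaBounded.tendsto ?_ fun n => div_nonneg (logLength_nonneg _) (d.pos n).le
    obtain ⟨M, hM⟩ := (((hdist z w).const_mul C).add (d.tendsto_const_div C)).omegaBounded
    refine ⟨M, ?_⟩
    filter_upwards [hM, hle z hz w hw] with n h1 h2 using h2.trans_lt h1
  refine ⟨C, hH.pos, fun z w => omegaLim ω (f z w), fun z hz w hw => ⟨?_, ?_⟩,
    fun z hz w hw => ?_, fun z hz w hw v hv => ?_⟩
  · have := le_of_tendsto_of_tendsto (hf z hz w hw)
      (((hdist z w).const_mul C).add (d.tendsto_const_div C)) (hle z hz w hw)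
    simpa using this
  · have := le_of_tendsto_of_tendsto (hdist z w)
      (((hf z hz w hw).const_mul C).add (d.tendsto_const_div C)) ((hmem z hz w hw).mono fun n hn => by
        change _ ≤ C * (_ / _) + _
        rw [← mul_div_assoc, ← add_div]
        exact div_le_div_of_nonneg_right (hH.dist_le_logLength hn) (d.pos n).le)
    simpa using this
  · refine congrArg (omegaLim ω) (funext fun n => ?_)
    simp only [f]
    rw [← logLength_inv hH.closure, mul_inv_rev, inv_inv]
  · have := le_of_tendsto_of_tendsto (hf z hz v hv)
      (((hf z hz w hw).max (hf w hw v hv)).add (d.tendsto_const_div (Real.log 2))) (by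
        filter_upwards [hmem z hz w hw, hmem w hw v hv] with n h1 h2
        simp only [f]
        rw [max_div_div_right (d.pos n).le, ← add_div]
        refine div_le_div_of_nonneg_right ?_ (d.pos n).le
        have := logLength_mul_le hH.closure h1 h2
        rwa [mul_assoc, mul_inv_cancel_left] at this)
    simpa using this

/-- Were intrinsic length bounded on `H`, so would be the ambient distance, and the limit set would
be a single point. -/
theorem IsLogarithmicSubgroup.exists_wordLength_ge (hH : IsLogarithmicSubgroup H T C)
    (hZ : (coneSet e d (translates e (H : Set W))).Nontrivial) (m : ℕ) :
    ∃ h : H, m ≤ wordLength T h := by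
  by_contra! hlt
  obtain ⟨_, ⟨x, rfl, hx⟩, _, ⟨y, rfl, hy⟩, hxy⟩ := hZ
  apply hxy
  refine PreCone.mk_eq_mk (tendsto_div_of_le (fun _ => dist_nonneg) (c' := fun _ => 0) (by simp)
    (D := C * Real.log (1 + m) + C) ?_)
  filter_upwards [hx, hy] with n h1 h2
  have h3 : (x.1 n)⁻¹ * y.1 n ∈ H := by
    have := H.mul_mem (H.inv_mem h1) h2
    rwa [mul_inv_rev, inv_inv, mul_assoc, mul_inv_cancel_left] at this
  have h4 := hH.dist_le_logLength h3
  rw [logLength_of_mem h3] at h4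
  have h5 : (wordLength T (⟨_, h3⟩ : H) : ℝ) ≤ m := by exact_mod_cast (hlt _).le
  have h6 := Real.log_le_log (by positivity) (add_le_add_right h5 1)
  have := mul_le_mul_of_nonneg_left h6 hH.pos.le
  linarith

/-- An unbounded logarithmic subgroup makes the cone contain uncountable sets of points that are far
from each other. -/
theorem IsLogarithmicSubgroup.exists_separated (hH : IsLogarithmicSubgroup H T C)
    (hZ : (coneSet e d (translates e (H : Set W))).Nontrivial) (R : ℝ) :
    ∃ u : I → AsymptoticCone W ω e d, ∀ r s, r ≠ s → R ≤ dist (u r) (u s) := by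
  have hpre : ∀ m : ℕ, ∃ c : ℕ → H, c 0 = 1 ∧
      ∀ i j, i ≤ j → j ≤ m → wordLength T ((c i)⁻¹ * c j) = j - i := by
    intro m
    obtain ⟨h, hm⟩ := hH.exists_wordLength_ge hZ m
    obtain ⟨c, hc0, -, hc⟩ := exists_geodesic_prefixes hH.closure h
    exact ⟨c, hc0, fun i j hij hj => hc i j hij (hj.trans hm)⟩
  choose c hc0 hc using hpre
  have hC := hH.pos
  -- Two points whose intrinsic distance is a fixed proportion of `exp (K * d n)` have rescaled
  -- ambient distance at least `K / C` in the limit, and `K / C = max R 1 ≥ R`. Fractions `r` of one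
  -- intrinsic geodesic of that length give the points.
  set K := C * max R 1 with hK
  have hK0 : 0 < K := mul_pos hC (lt_max_of_lt_right one_pos)
  let m : ℕ → ℕ := fun n => ⌊Real.exp (K * d.toFun n)⌋₊
  have hm : ∀ n, (m n : ℝ) ≤ Real.exp (K * d.toFun n) := fun n => Nat.floor_le (Real.exp_pos _).le
  have hm' : ∀ n, Real.exp (K * d.toFun n) < m n + 1 := fun n => Nat.lt_floor_add_one _
  have hfl : ∀ (r : I) n, ⌊(r : ℝ) * m n⌋₊ ≤ m n := fun r n =>
    Nat.floor_le_of_le (mul_le_of_le_one_left (Nat.cast_nonneg _) r.2.2)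
  let x : I → ℕ → W := fun r n => e n * (c (m n) ⌊(r : ℝ) * m n⌋₊ : H)
  have hxe : ∀ r, OmegaBounded ω fun n => dist (x r n) (e n) / d.toFun n := by
    intro r
    have hlim : Tendsto (fun n => C * K + (C * Real.log 2 + C) / d.toFun n) ω (𝓝 (C * K + 0)) :=
      (d.tendsto_const_div _).const_add _
    refine hlim.omegaBounded.mono fun n => ?_
    rw [div_le_iff₀ (d.pos n), add_mul, div_mul_cancel₀ _ (d.pos n).ne', dist_comm]
    have h1 := hH.dist_le (c (m n) ⌊(r : ℝ) * m n⌋₊)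
    rw [← dist_mul_left (e n), mul_one] at h1
    have h2 := hc (m n) 0 _ (Nat.zero_le _) (hfl r n)
    rw [hc0, inv_one, one_mul, Nat.sub_zero] at h2
    rw [h2] at h1
    have h3 : (⌊(r : ℝ) * m n⌋₊ : ℝ) ≤ Real.exp (K * d.toFun n) :=
      (Nat.cast_le.2 (hfl r n)).trans (hm n)
    have h4 : Real.log (1 + ⌊(r : ℝ) * m n⌋₊) ≤ Real.log 2 + K * d.toFun n := by
      rw [← Real.log_exp (K * d.toFun n), ← Real.log_mul two_ne_zero (Real.exp_pos _).ne']
      refine Real.log_le_log (by positivity) ?_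
      have := Real.one_le_exp (mul_pos hK0 (d.pos n)).le
      linarith
    have h5 := mul_le_mul_of_nonneg_left h4 hC.le
    change dist (e n) (x r n) ≤ _
    linarith
  have hlt : ∀ r s : I, r < s → R ≤ omegaLim ω fun n => dist (x r n) (x s n) / d.toFun n := by
    intro r s hrs
    have hrs' : (0 : ℝ) < s - r := sub_pos.2 hrs
    have hlim : Tendsto (fun n => K / C + ((Real.log (s - r) - Real.log 2) / C - 1) / d.toFun n) ω
        (𝓝 (K / C + 0)) := (d.tendsto_const_div _).const_add _
    have hKC : K / C + 0 = max R 1 := by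
      rw [hK]
      field_simp
      ring
    rw [hKC] at hlim
    refine (le_max_left R 1).trans (le_of_tendsto_of_tendsto hlim
      (PreCone.tendsto (⟨x r, hxe r⟩ : PreCone W ω e d) ⟨x s, hxe s⟩) ?_)
    -- Then rounding down `exp (K * d n)` to `m n` loses at most a factor `2`.
    have hlarge : ∀ᶠ n in ω, 2 ≤ Real.exp (K * d.toFun n) :=
      (Real.tendsto_exp_atTop.comp (d.divergent.const_mul_atTop hK0)).eventually_ge_atTop 2
    filter_upwards [hlarge] with n hn
    change _ ≤ dist (x r n) (x s n) / d.toFun n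
    rw [le_div_iff₀ (d.pos n), add_mul, div_mul_cancel₀ _ (d.pos n).ne']
    have hle : ⌊(r : ℝ) * m n⌋₊ ≤ ⌊(s : ℝ) * m n⌋₊ :=
      Nat.floor_mono (mul_le_mul_of_nonneg_right (show (r : ℝ) ≤ s from hrs.le) (Nat.cast_nonneg _))
    have h1 := hH.log_le ((c (m n) ⌊(r : ℝ) * m n⌋₊)⁻¹ * c (m n) ⌊(s : ℝ) * m n⌋₊)
    rw [hc (m n) _ _ hle (hfl s n), Nat.cast_sub hle, Subgroup.coe_mul, Subgroup.coe_inv, dist_comm,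
      dist_inv_mul, mul_one, ← dist_mul_left (e n), dist_comm] at h1
    have h2 : (s : ℝ) * m n - 1 < ⌊(s : ℝ) * m n⌋₊ := Nat.sub_one_lt_floor _
    have h3 : (⌊(r : ℝ) * m n⌋₊ : ℝ) ≤ r * m n :=
      Nat.floor_le (mul_nonneg r.2.1 (Nat.cast_nonneg _))
    have h4 : (s - r : ℝ) * (Real.exp (K * d.toFun n) / 2) ≤
        1 + (⌊(s : ℝ) * m n⌋₊ - ⌊(r : ℝ) * m n⌋₊) := by
      have := mul_le_mul_of_nonneg_left
        (show Real.exp (K * d.toFun n) / 2 ≤ m n by linarith [hm' n]) hrs'.le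
      linarith
    have h5 := Real.log_le_log (by positivity) h4
    rw [Real.log_mul hrs'.ne' (by positivity), Real.log_div (Real.exp_pos _).ne' two_ne_zero,
      Real.log_exp] at h5
    have h6 := h5.trans h1
    have h7 : (K * d.toFun n + (Real.log (s - r) - Real.log 2) - C) / C ≤ dist (x r n) (x s n) := by
      rw [div_le_iff₀ hC]
      change _ ≤ C * dist (x r n) (x s n) + C at h6
      linarith
    refine le_trans (le_of_eq ?_) h7
    field_simp
    ring
  refine ⟨fun r => SeparationQuotient.mk ⟨x r, hxe r⟩, fun r s hrs => ?_⟩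
  rcases hrs.lt_or_gt with h | h
  · exact hlt r s h
  · rw [dist_comm]
    exact hlt s r h

/-- The cone of a group that is separated by a logarithmic subgroup. -/
theorem IsLogarithmicSubgroup.simplyConnectedSpace_or_uncountable
    (hH : IsLogarithmicSubgroup H T C) (hW : IsDiscretelyGeodesic W) {P : Set W}
    (hP : IsHalfSpace H P) (hP' : IsHalfSpace H Pᶜ) :
    SimplyConnectedSpace (AsymptoticCone W ω e d) ∨
      ∀ x : AsymptoticCone W ω e d, Uncountable (FundamentalGroup (AsymptoticCone W ω e d) x) := by
  obtain ⟨a, ha⟩ := hP.exists_notMem_coneSet hW (ω := ω) (e := e) (d := d)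
  obtain ⟨b, hb⟩ := hP'.exists_notMem_coneSet hW (ω := ω) (e := e) (d := d)
  rw [compl_compl] at hb
  have hZ := hP.coneSet_inter hP' (ω := ω) (e := e) (d := d)
  refine simplyConnectedSpace_or_uncountable_of_ultrametric_separation
    (AsymptoticCone.isGeodesicSpace hW) AsymptoticCone.isHomogeneousMetric
    (isClosed_coneSet (translates e P)) (isClosed_coneSet (translates e Pᶜ))
    (coneSet_union fun n => ?_) ha hb ?_ ?_
  · exact eq_univ_of_forall fun x => em _
  · rw [hZ]
    exact hH.isUltrametricSet_coneSet
  · rw [hZ]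
    exact hH.exists_separated

end Distortion


/-! ### Wall functions and the half-spaces that they define -/

section Walls

variable {G : Type*} [Group G]

/-- A two-valued function on `G` that is invariant under `H` on both sides and that changes along
the edges of a Cayley graph only near `H`; the powers of `b` go to both of its sides. -/
structure IsWallFunction (H : Subgroup G) (n : G → ZMod 2) (b : G) : Prop where
  left_mul : ∀ h ∈ H, ∀ g, n (h * g) = n g
  mul_right : ∀ h ∈ H, ∀ g, n (g * h) = n g
  step : ∃ L : Set G, Subgroup.closure L = ⊤ ∧ ∀ x ∈ L, ∀ g, n (x * g) ≠ n g → g ∈ H ∨ x * g ∈ H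
  pow : ∀ k : ℕ, n (b ^ (k + 1)) = n b
  inv_pow : ∀ k : ℕ, n (b⁻¹ ^ (k + 1)) = n b⁻¹
  ne : n b ≠ n b⁻¹

namespace IsWallFunction

variable {H : Subgroup G} {n : G → ZMod 2} {b : G}

theorem inv (hn : IsWallFunction H n b) : IsWallFunction H n b⁻¹ where
  left_mul := hn.left_mul
  mul_right := hn.mul_right
  step := hn.step
  pow := hn.inv_pow
  inv_pow := by simpa using hn.pow
  ne := by simpa using hn.ne.symm

theorem map (hn : IsWallFunction H n b) {G' : Type*} [Group G'] (f : G ≃* G') :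
    IsWallFunction (H.map f.toMonoidHom) (n ∘ f.symm) (f b) := by
  have hmem : ∀ g, g ∈ H.map f.toMonoidHom ↔ f.symm g ∈ H := fun g => Subgroup.mem_map_equiv
  refine ⟨fun h hh g => ?_, fun h hh g => ?_, ?_, fun k => ?_, fun k => ?_, ?_⟩
  · simpa using hn.left_mul _ ((hmem h).1 hh) (f.symm g)
  · simpa using hn.mul_right _ ((hmem h).1 hh) (f.symm g)
  · obtain ⟨L, hL, hstep⟩ := hn.step
    refine ⟨f.toMonoidHom '' L, ?_, ?_⟩
    · rw [← MonoidHom.map_closure, hL]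
      exact Subgroup.map_top_of_surjective _ f.surjective
    · rintro _ ⟨x, hx, rfl⟩ g hg
      rw [hmem, hmem]
      have := hstep x hx (f.symm g)
      simpa using this (by simpa using hg)
  · simpa using hn.pow k
  · simpa [← map_inv] using hn.inv_pow k
  · simpa [← map_inv] using hn.ne

theorem notMem (hn : IsWallFunction H n b) (k : ℕ) : b ^ (k + 1) ∉ H := by
  intro h
  have h1 := hn.left_mul _ h 1
  have h2 := hn.left_mul _ (H.inv_mem h) 1
  rw [mul_one] at h1 h2
  rw [← _root_.inv_pow] at h2
  rw [hn.pow] at h1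
  rw [hn.inv_pow] at h2
  exact hn.ne (h1.trans h2.symm)

theorem injective_cosets (hn : IsWallFunction H n b) {i j : ℕ} (h : b ^ i * (b ^ j)⁻¹ ∈ H) :
    i = j := by
  by_contra hne
  rcases Nat.lt_or_gt_of_ne hne with hlt | hlt
  · obtain ⟨k, rfl⟩ := Nat.exists_eq_add_of_lt hlt
    refine hn.notMem k ?_
    have := H.inv_mem h
    rw [mul_inv_rev, inv_inv] at this
    have e : b ^ (i + k + 1) * (b ^ i)⁻¹ = b ^ (k + 1) := by
      rw [mul_inv_eq_iff_eq_mul, ← pow_add]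
      congr 1
      omega
    rwa [e] at this
  · obtain ⟨k, rfl⟩ := Nat.exists_eq_add_of_lt hlt
    refine hn.notMem k ?_
    have e : b ^ (j + k + 1) * (b ^ j)⁻¹ = b ^ (k + 1) := by
      rw [mul_inv_eq_iff_eq_mul, ← pow_add]
      congr 1
      omega
    rwa [e] at h

theorem step_or {L : Set G} (hL : ∀ x ∈ L, ∀ g, n (x * g) ≠ n g → g ∈ H ∨ x * g ∈ H) {x : G}
    (hx : x ∈ L ∨ x⁻¹ ∈ L) (g : G) (h : n (x⁻¹ * g) ≠ n g) : g ∈ H ∨ x⁻¹ * g ∈ H := by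
  rcases hx with hx | hx
  · have := hL x hx (x⁻¹ * g)
    rw [mul_inv_cancel_left] at this
    exact (this h.symm).symm
  · exact hL _ hx g h

theorem exists_change {p : ℕ → Prop} {N : ℕ} (h0 : ¬ p 0) (hN : p N) :
    ∃ i < N, ¬ p i ∧ p (i + 1) := by
  induction N with
  | zero => exact absurd hN h0
  | succ N ih =>
    by_cases h : p N
    · obtain ⟨i, hi, hi'⟩ := ih h
      exact ⟨i, hi.trans N.lt_succ_self, hi'⟩
    · exact ⟨N, N.lt_succ_self, h, hN⟩

/-- A path from `H` to a power of `b` visits many cosets of `H`. -/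
theorem le_wordLength (hn : IsWallFunction H n b) {L : Set G} (hLg : Subgroup.closure L = ⊤)
    (hL : ∀ x ∈ L, ∀ g, n (x * g) ≠ n g → g ∈ H ∨ x * g ∈ H) (m : ℕ) {h : G} (hh : h ∈ H) :
    m ≤ wordLength L (h⁻¹ * b⁻¹ ^ (m + 1)) + 1 := by
  obtain ⟨l, hl, hlp, hll⟩ := exists_word hLg (h⁻¹ * b⁻¹ ^ (m + 1))
  rw [← hll]
  let v : ℕ → G := fun i => h * (l.take i).prod
  have hv0 : v 0 = h := by simp [v]
  have hvN : v l.length = b⁻¹ ^ (m + 1) := by simp [v, hlp]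
  have hvs : ∀ i, (hi : i < l.length) → v (i + 1) = v i * l[i] := fun i hi => by
    simp only [v]
    rw [List.prod_take_succ _ _ hi, mul_assoc]
  -- The wall function translated by `b ^ (j + 1)` differs at the two ends of the path, so the path
  -- visits the coset `b ^ (-(j + 1)) H`. These cosets are distinct, so they are visited at
  -- different times.
  have key : ∀ j : ℕ, j < m → ∃ i ≤ l.length, (v i)⁻¹ * (b ^ (j + 1))⁻¹ ∈ H := by
    intro j hj
    obtain ⟨i, hi, h1, h2⟩ := exists_change (p := fun i => n ((v i)⁻¹ * (b ^ (j + 1))⁻¹) = n b)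
      (N := l.length) (by
        rw [hv0, hn.left_mul _ (H.inv_mem hh), ← _root_.inv_pow, hn.inv_pow]
        exact hn.ne.symm) (by
        rw [hvN]
        obtain ⟨k, rfl⟩ := Nat.exists_eq_add_of_lt hj
        rw [_root_.inv_pow, inv_inv, show j + k + 1 + 1 = (k + 1) + (j + 1) by omega, pow_add,
          mul_inv_cancel_right, hn.pow])
    rw [hvs i hi, mul_inv_rev, mul_assoc] at h2
    rcases step_or hL (hl _ (List.getElem_mem hi)) ((v i)⁻¹ * (b ^ (j + 1))⁻¹)
      (fun e => h1 (e.symm.trans h2)) with h3 | h3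
    · exact ⟨i, hi.le, h3⟩
    · refine ⟨i + 1, hi, ?_⟩
      rwa [hvs i hi, mul_inv_rev, mul_assoc]
  choose! i hi hiH using key
  have hcard := Finset.card_le_card_of_injOn (s := Finset.range m)
    (t := Finset.range (l.length + 1)) i
    (fun j hj => Finset.mem_coe.2 (Finset.mem_range.2 (Nat.lt_succ_of_le
      (hi j (Finset.mem_range.1 (Finset.mem_coe.1 hj)))))) (fun j hj j' hj' e => by
      have h1 := hiH j (Finset.mem_range.1 (Finset.mem_coe.1 hj))
      have h2 := hiH j' (Finset.mem_range.1 (Finset.mem_coe.1 hj'))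
      rw [← e] at h2
      have h3 := H.mul_mem (H.inv_mem h1) h2
      have e2 : ((v (i j))⁻¹ * (b ^ (j + 1))⁻¹)⁻¹ * ((v (i j))⁻¹ * (b ^ (j' + 1))⁻¹) =
          b ^ (j + 1) * (b ^ (j' + 1))⁻¹ := by group
      rw [e2] at h3
      exact Nat.succ_injective (hn.injective_cosets h3))
  simpa using hcard

/-- A change of the wall function between `g` and `s * g` happens near `g`. -/
theorem exists_near (hn : IsWallFunction H n b) (S : Set G) (hS : Subgroup.closure S = ⊤) (s : G) :
    ∃ D : ℝ, ∀ g, n (s * g) ≠ n g → ∃ p, (wordLength S p : ℝ) ≤ D ∧ p * g ∈ H := by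
  obtain ⟨L, hL, hstep⟩ := hn.step
  have hs : s ∈ Subgroup.closure L := hL ▸ Subgroup.mem_top s
  induction hs using Subgroup.closure_induction with
  | mem x hx =>
    refine ⟨wordLength S x, fun g hg => ?_⟩
    rcases hstep x hx g hg with h | h
    · exact ⟨1, by simp [wordLength_one], by simpa using h⟩
    · exact ⟨x, le_rfl, h⟩
  | one => exact ⟨0, fun g hg => absurd (by simp) hg⟩
  | mul x y _ _ hx hy =>
    obtain ⟨D, hD⟩ := hx
    obtain ⟨D', hD'⟩ := hy
    refine ⟨max D' (D + wordLength S y), fun g hg => ?_⟩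
    by_cases h : n (y * g) = n g
    · obtain ⟨p, hp, hpH⟩ := hD (y * g) (by rwa [h, ← mul_assoc])
      refine ⟨p * y, le_max_of_le_right ?_, by rwa [mul_assoc]⟩
      have : (wordLength S (p * y) : ℝ) ≤ wordLength S p + wordLength S y := by
        exact_mod_cast wordLength_mul_le hS p y
      linarith
    · obtain ⟨p, hp, hpH⟩ := hD' g h
      exact ⟨p, le_max_of_le_left hp, hpH⟩
  | inv x _ hx =>
    obtain ⟨D, hD⟩ := hx
    refine ⟨D + wordLength S x, fun g hg => ?_⟩
    obtain ⟨p, hp, hpH⟩ := hD (x⁻¹ * g) (by rw [mul_inv_cancel_left]; exact hg.symm)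
    refine ⟨p * x⁻¹, ?_, by rwa [mul_assoc]⟩
    have : (wordLength S (p * x⁻¹) : ℝ) ≤ wordLength S p + wordLength S x⁻¹ := by
      exact_mod_cast wordLength_mul_le hS p x⁻¹
    rw [wordLength_inv hS] at this
    linarith

/-- On a geodesic from `x` to `y` the value changes across some letter, and near that edge there is
a point of `H`. The distance is bounded uniformly because there are finitely many letters, and the
detour costs it twice. -/
theorem exists_near_of_finite (hn : IsWallFunction H n b) {S : Set G} (hSfin : S.Finite)
    (hS : Subgroup.closure S = ⊤) :
    ∃ D : ℝ, 0 ≤ D ∧ ∀ x y : G, n x⁻¹ ≠ n y⁻¹ → ∃ h ∈ H,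
      (wordLength S (x⁻¹ * h) : ℝ) + wordLength S (h⁻¹ * y) ≤ wordLength S (x⁻¹ * y) + D := by
  choose D hD using fun s => hn.exists_near S hS s
  obtain ⟨c, hc0, hc⟩ := exists_bound_on_letters hSfin D
  refine ⟨2 * c, by linarith, fun x y hxy => ?_⟩
  obtain ⟨u, hu0, hu1, hu⟩ := exists_geodesic_prefixes hS (x⁻¹ * y)
  set N := wordLength S (x⁻¹ * y)
  obtain ⟨i, hi, h1, h2⟩ := exists_change (p := fun i => n (x * u i)⁻¹ = n y⁻¹) (N := N)
    (by rw [hu0, mul_one]; exact hxy) (by rw [hu1, mul_inv_cancel_left])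
  have h3 : wordLength S ((u i)⁻¹ * u (i + 1)) = 1 := by
    rw [hu i (i + 1) (Nat.le_succ i) hi]
    omega
  obtain ⟨l, hl, hlp, hll⟩ := exists_word hS ((u i)⁻¹ * u (i + 1))
  rw [h3, List.length_eq_one_iff] at hll
  obtain ⟨s, rfl⟩ := hll
  have hs := hl s (by simp)
  rw [List.prod_singleton] at hlp
  have hs' : s⁻¹ ∈ S ∨ s⁻¹⁻¹ ∈ S := by
    rw [inv_inv]
    exact hs.symm
  obtain ⟨p, hp, hpH⟩ := hD s⁻¹ (x * u i)⁻¹ (fun e => h1 (e.symm.trans (by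
    rw [← h2, hlp]
    congr 1
    group)))
  have hpc := hp.trans (hc _ hs')
  refine ⟨(p * (x * u i)⁻¹)⁻¹, H.inv_mem hpH, ?_⟩
  have e1 : x⁻¹ * (p * (x * u i)⁻¹)⁻¹ = ((u 0)⁻¹ * u i) * p⁻¹ := by rw [hu0]; group
  have e2 : (p * (x * u i)⁻¹)⁻¹⁻¹ * y = p * ((u i)⁻¹ * u N) := by rw [hu1]; group
  rw [e1, e2]
  have h4 := wordLength_mul_le hS ((u 0)⁻¹ * u i) p⁻¹
  have h5 := wordLength_mul_le hS p ((u i)⁻¹ * u N)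
  rw [hu 0 i (Nat.zero_le i) hi.le, wordLength_inv hS] at h4
  rw [hu i N hi.le le_rfl] at h5
  have h6 : wordLength S ((u 0)⁻¹ * u i * p⁻¹) + wordLength S (p * ((u i)⁻¹ * u N)) ≤
      N + 2 * wordLength S p := by omega
  have h7 : (wordLength S ((u 0)⁻¹ * u i * p⁻¹) : ℝ) + wordLength S (p * ((u i)⁻¹ * u N)) ≤
      N + 2 * wordLength S p := by exact_mod_cast h6
  linarith

/-- A subgroup of `G` as a subgroup of `G` with its word metric. -/
def _root_.WordMetricSpace.subgroup (S : Set G) (hS : Subgroup.closure S = ⊤) (H : Subgroup G) :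
    Subgroup (WordMetricSpace S hS) := H

/-- The wall function controls left multiplication by letters, whereas edges of the word metric are
right multiplications; hence the inverse. The powers of `b⁻¹` leave every neighbourhood of `H`. -/
theorem isHalfSpace (hn : IsWallFunction H n b) {S : Set G} (hSfin : S.Finite)
    (hS : Subgroup.closure S = ⊤) :
    IsHalfSpace (WordMetricSpace.subgroup S hS H) {g | n (g : G)⁻¹ = n b} where
  mul_mem_iff (h : G) hh (g : G) := by
    change n (h * g)⁻¹ = n b ↔ n g⁻¹ = n b
    rw [mul_inv_rev, hn.mul_right _ (H.inv_mem hh)]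
  near := by
    obtain ⟨D, -, hD⟩ := hn.exists_near_of_finite hSfin hS
    exact ⟨D, fun x (hx : n (x : G)⁻¹ = n b) y (hy : ¬ n (y : G)⁻¹ = n b) =>
      hD x y fun e => hy (e.symm.trans hx)⟩
  deep R := by
    obtain ⟨L, hLg, hL⟩ := hn.step
    obtain ⟨c, hc0, hc⟩ := exists_wordLength_le_mul hLg hSfin hS
    obtain ⟨m, hm⟩ := exists_nat_ge (c * R + 1)
    refine ⟨(b⁻¹ ^ (m + 1) : G), ?_, fun (h : G) hh => ?_⟩
    · change n (b⁻¹ ^ (m + 1))⁻¹ = n b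
      rw [← _root_.inv_pow, inv_inv, hn.pow]
    · refine le_of_le_of_eq ?_ (dist_comm _ _)
      change R ≤ (wordLength S (h⁻¹ * b⁻¹ ^ (m + 1)) : ℝ)
      have h1 : (m : ℝ) ≤ wordLength L (h⁻¹ * b⁻¹ ^ (m + 1)) + 1 := by
        exact_mod_cast hn.le_wordLength hLg hL m hh
      have h2 := hc (h⁻¹ * b⁻¹ ^ (m + 1))
      refine le_of_mul_le_mul_left ?_ hc0
      linarith

theorem isHalfSpace_compl (hn : IsWallFunction H n b) {S : Set G} (hSfin : S.Finite)
    (hS : Subgroup.closure S = ⊤) :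
    IsHalfSpace (WordMetricSpace.subgroup S hS H) {g | n (g : G)⁻¹ = n b}ᶜ := by
  have : {g : WordMetricSpace S hS | n (g : G)⁻¹ = n b}ᶜ = {g | n (g : G)⁻¹ = n b⁻¹} := by
    ext g
    have key : ∀ x y z : ZMod 2, y ≠ z → (¬ x = y ↔ x = z) := by decide
    exact key _ _ _ hn.ne
  rw [this]
  exact hn.inv.isHalfSpace hSfin hS

end IsWallFunction

theorem ExponentiallyDistorted.exists_isLogarithmicSubgroup {H : Subgroup G}
    (hH : ExponentiallyDistorted H) {S : Set G} (hSfin : S.Finite) (hS : Subgroup.closure S = ⊤) :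
    ∃ (T : Set (WordMetricSpace.subgroup S hS H)) (C : ℝ),
      IsLogarithmicSubgroup (WordMetricSpace.subgroup S hS H) T C := by
  obtain ⟨S₀, T, hS₀fin, hS₀, -, hT, C, hC, hlog⟩ := hH
  obtain ⟨c, hc0, hc⟩ := exists_wordLength_le_mul hS hS₀fin hS₀
  obtain ⟨c', hc0', hc'⟩ := exists_wordLength_le_mul hS₀ hSfin hS
  have hnn : ∀ h : H, 0 ≤ Real.log (1 + wordLength T h) := fun h => Real.log_nonneg (by simp)
  set M := max (max (C * c') (C * C)) (c * C) with hM
  have h1 : C * c' ≤ M := (le_max_left _ _).trans (le_max_left _ _)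
  have h2 : C * C ≤ M := (le_max_right _ _).trans (le_max_left _ _)
  have h3 : c * C ≤ M := le_max_right _ _
  refine ⟨T, M, ⟨hT, lt_of_lt_of_le (mul_pos hc0 hC) h3, fun (h : H) => ?_, fun (h : H) => ?_⟩⟩
  · change Real.log (1 + wordLength T h) ≤ M * (wordLength S (1⁻¹ * (h : G)) : ℝ) + M
    rw [inv_one, one_mul]
    have h4 := (hlog h).1
    have h5 := hc' h
    have h6 : Real.log (1 + wordLength T h) ≤ C * (wordLength S₀ (h : G)) + C * C := by
      have : Real.log (1 + wordLength T h) / C ≤ wordLength S₀ (h : G) + C := by linarith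
      rw [div_le_iff₀ hC] at this
      linarith
    have h7 := mul_le_mul_of_nonneg_left h5 hC.le
    have h8 : C * c' * (wordLength S (h : G) : ℝ) ≤ M * wordLength S (h : G) :=
      mul_le_mul_of_nonneg_right h1 (Nat.cast_nonneg _)
    linarith
  · change (wordLength S (1⁻¹ * (h : G)) : ℝ) ≤ M * Real.log (1 + wordLength T h) + M
    rw [inv_one, one_mul]
    have h4 := mul_le_mul_of_nonneg_left (hlog h).2 hc0.le
    have h5 := hc h
    have h6 : c * C * Real.log (1 + wordLength T h) ≤ M * Real.log (1 + wordLength T h) :=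
      mul_le_mul_of_nonneg_right h3 (hnn h)
    linarith

theorem IsWallFunction.simplyConnectedSpace_or_uncountable {H : Subgroup G} {n : G → ZMod 2} {b : G}
    (hn : IsWallFunction H n b) (hH : ExponentiallyDistorted H) {S : Set G} (hSfin : S.Finite)
    (hS : Subgroup.closure S = ⊤) (ω : Ultrafilter ℕ) (e : ℕ → WordMetricSpace S hS)
    (d : ScalingSequence ω) :
    SimplyConnectedSpace (AsymptoticCone (WordMetricSpace S hS) ω e d) ∨
      ∀ x : AsymptoticCone (WordMetricSpace S hS) ω e d,
        Uncountable (FundamentalGroup (AsymptoticCone (WordMetricSpace S hS) ω e d) x) := by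
  obtain ⟨T, C, hT⟩ := hH.exists_isLogarithmicSubgroup hSfin hS
  exact hT.simplyConnectedSpace_or_uncountable (WordMetricSpace.isDiscretelyGeodesic S hS)
    (hn.isHalfSpace hSfin hS) (hn.isHalfSpace_compl hSfin hS)

end Walls


/-! ### Cocycles from actions on `Γ × ZMod 2` -/

section Cocycles

variable {Γ : Type*} [Group Γ]

/-- The permutation of `Γ × ZMod 2` that translates by `g` and shifts the fibre of `u` by `b u`. -/
def skewPerm (g : Γ) (b : Γ → ZMod 2) : Equiv.Perm (Γ × ZMod 2) where
  toFun p := (g * p.1, p.2 + b p.1)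
  invFun p := (g⁻¹ * p.1, p.2 - b (g⁻¹ * p.1))
  left_inv p := by simp
  right_inv p := by simp

theorem skewPerm_apply (g : Γ) (b : Γ → ZMod 2) (u : Γ) (ε : ZMod 2) :
    skewPerm g b (u, ε) = (g * u, ε + b u) := rfl

theorem skewPerm_mul (g h : Γ) (b c : Γ → ZMod 2) :
    skewPerm g b * skewPerm h c = skewPerm (g * h) fun u => c u + b (h * u) := by
  ext1 ⟨u, ε⟩
  simp [skewPerm_apply, mul_assoc, add_assoc]

/-- A cocycle on a group that acts on `Γ` by translations gives an action on `Γ × ZMod 2`. -/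
def skewHom {A : Type*} [Group A] (i : A →* Γ) (b : A → Γ → ZMod 2)
    (hb : ∀ x y u, b (x * y) u = b y u + b x (i y * u)) : A →* Equiv.Perm (Γ × ZMod 2) :=
  MonoidHom.mk' (fun a => skewPerm (i a) (b a)) fun x y => by
    rw [skewPerm_mul, map_mul]
    congr 1
    funext u
    exact hb x y u

/-- A `ZMod 2`-valued cocycle for the left translation action. -/
def IsTranslationCocycle (c : Γ → Γ → ZMod 2) : Prop :=
  ∀ g h u, c (g * h) u = c h u + c g (h * u)

/-- A cocycle is the same as a homomorphism to skew permutations. It can thus be prescribed on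
generators as soon as the defining relations of the group hold among the permutations. -/
theorem exists_cocycle {L : Set Γ} (hL : Subgroup.closure L = ⊤)
    (ρ : Γ →* Equiv.Perm (Γ × ZMod 2)) (hρ : ∀ x ∈ L, ∃ b, ρ x = skewPerm x b) :
    ∃ c : Γ → Γ → ZMod 2, IsTranslationCocycle c ∧ ∀ x b, ρ x = skewPerm x b → c x = b := by
  have key : ∀ g, ∃ b, ρ g = skewPerm g b := by
    intro g
    have hg : g ∈ Subgroup.closure L := hL ▸ Subgroup.mem_top g
    induction hg using Subgroup.closure_induction with
    | mem x hx => exact hρ x hx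
    | one =>
      refine ⟨fun _ => 0, ?_⟩
      ext1 ⟨u, ε⟩
      simp [skewPerm_apply]
    | mul x y _ _ hx hy =>
      obtain ⟨b, hb⟩ := hx
      obtain ⟨c, hc⟩ := hy
      exact ⟨_, by rw [map_mul, hb, hc, skewPerm_mul]⟩
    | inv x _ hx =>
      obtain ⟨b, hb⟩ := hx
      refine ⟨fun u => - b (x⁻¹ * u), ?_⟩
      rw [map_inv, hb, inv_eq_iff_mul_eq_one, skewPerm_mul]
      ext1 ⟨u, ε⟩
      simp [skewPerm_apply, CharTwo.add_self_eq_zero]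
  choose c hc using key
  have huniq : ∀ {g : Γ} {b b' : Γ → ZMod 2}, skewPerm g b = skewPerm g b' → b = b' := by
    intro g b b' h
    funext u
    have := DFunLike.congr_fun h (u, 0)
    simpa [skewPerm_apply] using this
  refine ⟨c, fun g h u => ?_, fun x b hb => huniq ((hc x).symm.trans hb)⟩
  have : skewPerm (g * h) (c (g * h)) = skewPerm (g * h) fun u => c h u + c g (h * u) := by
    rw [← hc, map_mul, hc g, hc h, skewPerm_mul]
  exact congrFun (huniq this) u

namespace IsTranslationCocycle

variable {c : Γ → Γ → ZMod 2}

theorem one (hc : IsTranslationCocycle c) (u : Γ) : c 1 u = 0 := by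
  have := hc 1 1 u
  simpa using this

theorem inv (hc : IsTranslationCocycle c) (g u : Γ) : c g⁻¹ u = c g (g⁻¹ * u) := by
  have := hc g g⁻¹ u
  rw [mul_inv_cancel, hc.one] at this
  have key : ∀ x y : ZMod 2, 0 = x + y → x = y := by decide
  exact key _ _ this

theorem mul_right (hc : IsTranslationCocycle c) {L : Set Γ} (hL : Subgroup.closure L = ⊤) {k : Γ}
    (hk : ∀ x ∈ L, ∀ u, c x (u * k) = c x u) (g u : Γ) : c g (u * k) = c g u := by
  have hg : g ∈ Subgroup.closure L := hL ▸ Subgroup.mem_top g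
  induction hg using Subgroup.closure_induction generalizing u with
  | mem x hx => exact hk x hx u
  | one => rw [hc.one, hc.one]
  | mul x y _ _ hx hy => rw [hc, hc, hy, ← mul_assoc, hx]
  | inv x _ hx => rw [hc.inv, hc.inv, ← mul_assoc, hx]

end IsTranslationCocycle

open Classical in
/-- The indicator function of a subgroup. -/
noncomputable def subgroupIndicator (B : Subgroup Γ) (u : Γ) : ZMod 2 := if u ∈ B then 1 else 0

variable {B : Subgroup Γ}

theorem subgroupIndicator_of_mem {u : Γ} (h : u ∈ B) : subgroupIndicator B u = 1 := if_pos h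

theorem subgroupIndicator_of_notMem {u : Γ} (h : u ∉ B) : subgroupIndicator B u = 0 := if_neg h

theorem subgroupIndicator_mul_right {k : Γ} (hk : k ∈ B) (u : Γ) :
    subgroupIndicator B (u * k) = subgroupIndicator B u := by
  by_cases h : u ∈ B
  · rw [subgroupIndicator_of_mem h, subgroupIndicator_of_mem (B.mul_mem h hk)]
  · rw [subgroupIndicator_of_notMem h,
      subgroupIndicator_of_notMem (mt (B.mul_mem_cancel_right hk).1 h)]

theorem subgroupIndicator_mul_left {k : Γ} (hk : k ∈ B) (u : Γ) :
    subgroupIndicator B (k * u) = subgroupIndicator B u := by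
  by_cases h : u ∈ B
  · rw [subgroupIndicator_of_mem h, subgroupIndicator_of_mem (B.mul_mem hk h)]
  · rw [subgroupIndicator_of_notMem h,
      subgroupIndicator_of_notMem (mt (B.mul_mem_cancel_left hk).1 h)]

end Cocycles

/-! ### The wall of an HNN extension -/

section HNN

variable {A : Type*} [Group A] {H K : Subgroup A} {φ : H ≃* K}

theorem HNNExtension.closure_letters :
    Subgroup.closure (Set.range (of : A →* HNNExtension A H K φ) ∪ {t}) = ⊤ := by
  refine eq_top_iff.2 fun x _ => ?_
  induction x using HNNExtension.induction_on with
  | of g => exact Subgroup.subset_closure (Or.inl ⟨g, rfl⟩)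
  | t => exact Subgroup.subset_closure (Or.inr rfl)
  | mul x y hx hy => exact mul_mem (hx trivial) (hy trivial)
  | inv x hx => exact inv_mem (hx trivial)

/-- With `B` the image of `K`, the function `c g 1` counts modulo `2` how often the products
obtained by building a word for `g` from the right cross an edge between `t⁻¹ B` and `B` labelled
`t`. The relation `t h = φ(h) t` is respected since the indicator of `B` is invariant under `B` from
the left. -/
theorem HNNExtension.exists_isWallFunction :
    ∃ (n : HNNExtension A H K φ → ZMod 2), IsWallFunction (K.map of) n t := by
  set B : Subgroup (HNNExtension A H K φ) := K.map of with hB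
  have hofK : ∀ k : K, (of (k : A) : HNNExtension A H K φ) ∈ B := fun k =>
    Subgroup.mem_map_of_mem _ k.2
  let ρ : HNNExtension A H K φ →* Equiv.Perm (HNNExtension A H K φ × ZMod 2) :=
    lift (skewHom of (fun _ _ => 0) (by simp)) (skewPerm t fun u => subgroupIndicator B (t * u)) (by
      intro a
      change skewPerm _ _ * skewPerm _ _ = skewPerm _ _ * skewPerm _ _
      rw [skewPerm_mul, skewPerm_mul, t_mul_of]
      congr 1
      funext u
      rw [← mul_assoc, t_mul_of, mul_assoc, subgroupIndicator_mul_left (hofK _)]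
      simp)
  have hρof : ∀ a, ρ (of a) = skewPerm (of a) fun _ => 0 := fun a => lift_of _ _ _ a
  have hρt : ρ t = skewPerm t fun u => subgroupIndicator B (t * u) := lift_t _ _ _
  obtain ⟨c, hc, hcρ⟩ := exists_cocycle closure_letters ρ (by
    rintro _ (⟨a, rfl⟩ | rfl)
    exacts [⟨_, hρof a⟩, ⟨_, hρt⟩])
  have hcof : ∀ a u, c (of a) u = 0 := fun a u => congrFun (hcρ _ _ (hρof a)) u
  have hct : ∀ u, c t u = subgroupIndicator B (t * u) := fun u => congrFun (hcρ _ _ hρt) u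
  have hleft : ∀ h ∈ B, ∀ g, c (h * g) 1 = c g 1 := by
    rintro _ ⟨k, -, rfl⟩ g
    rw [hc, hcof, add_zero]
  have hB0 : ∀ h ∈ B, c h 1 = 0 := fun h hh => by
    rw [← mul_one h, hleft h hh, hc.one]
  have htmul : ∀ g, c (t * g) 1 = c g 1 + subgroupIndicator B (t * g) := fun g => by
    rw [hc, hct, mul_one]
  -- The first `t⁻¹` crosses the wall. Afterwards the value is `1`, whereas it is `0` on `B`, so
  -- negative powers never return to `B` and never cross again.
  have hinv : ∀ k : ℕ, c (t⁻¹ ^ (k + 1)) 1 = 1 := by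
    intro k
    induction k with
    | zero =>
      have := htmul t⁻¹
      rw [mul_inv_cancel, hc.one, subgroupIndicator_of_mem B.one_mem] at this
      have key : ∀ x : ZMod 2, 0 = x + 1 → x = 1 := by decide
      simpa using key _ this
    | succ k ih =>
      have := htmul (t⁻¹ ^ (k + 1 + 1))
      rw [pow_succ' _ (k + 1), mul_inv_cancel_left, ih, subgroupIndicator_of_notMem, add_zero] at this
      · rw [pow_succ' _ (k + 1), ← this]
      · intro h
        rw [hB0 _ h] at ih
        exact zero_ne_one ih
  have hnot : ∀ k : ℕ, (t : HNNExtension A H K φ) ^ (k + 1) ∉ B := by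
    intro k h
    have h1 := hinv k
    rw [inv_pow, hB0 _ (B.inv_mem h)] at h1
    exact zero_ne_one h1
  have hpow : ∀ k : ℕ, c (t ^ k) 1 = 0 := by
    intro k
    induction k with
    | zero => rw [pow_zero, hc.one]
    | succ k ih => rw [pow_succ', htmul, ih, ← pow_succ', subgroupIndicator_of_notMem (hnot k), add_zero]
  have ht : c t 1 = 0 := by simpa using hpow 1
  have hti : c t⁻¹ 1 = 1 := by simpa using hinv 0
  refine ⟨fun g => c g 1, hleft, ?_, ⟨_, closure_letters, ?_⟩, fun k => ?_, fun k => ?_, ?_⟩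
  · rintro h hh g
    have h1 := hc.mul_right closure_letters (k := h) (by
      rintro _ (⟨a, rfl⟩ | rfl) u
      · rw [hcof, hcof]
      · rw [hct, hct, ← mul_assoc, subgroupIndicator_mul_right hh]) g 1
    rw [one_mul] at h1
    rw [hc, hB0 h hh, zero_add, mul_one, h1]
  · rintro _ (⟨a, rfl⟩ | rfl) g hg
    · exact absurd (by rw [hc, hcof, add_zero]) hg
    · right
      by_contra h
      exact hg (by rw [htmul, subgroupIndicator_of_notMem h, add_zero])
  · exact (hpow _).trans ht.symm
  · exact (hinv k).trans hti.symm
  · rw [ht, hti]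
    exact zero_ne_one

end HNN


/-! ### The wall of an amalgamated product -/

namespace Monoid.PushoutI

section General

variable {ι : Type*} {A : ι → Type*} {C : Type*} [∀ i, Group (A i)] [Group C] {φ : ∀ i, C →* A i}

theorem induction_letters [Nonempty ι] {P : PushoutI φ → Prop} (one : P 1)
    (letter_mul : ∀ (i : ι) (a : A i) (g : PushoutI φ), P g → P (of i a * g)) (g : PushoutI φ) :
    P g := by
  have key : ∀ x g : PushoutI φ, P g → P (x * g) := by
    intro x
    induction x using PushoutI.induction_on with
    | of i a => exact letter_mul i a
    | base h =>
      obtain ⟨i⟩ := ‹Nonempty ι›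
      rw [← of_apply_eq_base φ i]
      exact letter_mul i _
    | mul x y hx hy =>
      intro g hg
      rw [mul_assoc]
      exact hx _ (hy _ hg)
  simpa using key g 1 one

theorem closure_letters [Nonempty ι] :
    Subgroup.closure {x : PushoutI φ | ∃ i a, of i a = x} = ⊤ :=
  eq_top_iff.2 fun x _ => induction_letters
    (P := (· ∈ Subgroup.closure {x : PushoutI φ | ∃ i a, of i a = x})) (one_mem _)
    (fun i a _ hg => mul_mem (Subgroup.subset_closure ⟨i, a, rfl⟩) hg) x

open Classical in
/-- The function `n` detects the elements whose reduced words end in a letter from `A i`. -/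
theorem exists_lastLetter (φ : ∀ i, C →* A i) (i : ι) :
    ∃ n : PushoutI φ → ZMod 2, n 1 = 0 ∧
      (∀ j a g, n (of j a * g) = n g + if j = i then
        subgroupIndicator (base φ).range g + subgroupIndicator (base φ).range (of j a * g) else 0) ∧
      ∀ k ∈ (base φ).range, ∀ g, n (g * k) = n g := by
  have : Nonempty ι := ⟨i⟩
  set B := (base φ).range
  have hbase : ∀ h, base φ h ∈ B := fun h => ⟨h, rfl⟩
  -- On `A i` this is the coboundary of the indicator of `B`, on the other factors it is `0`. The
  -- two agree on the amalgamated subgroup, where the coboundary vanishes by left invariance under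
  -- `B`.
  let β : ∀ j, A j → PushoutI φ → ZMod 2 := fun j a u => if j = i then
    subgroupIndicator B u + subgroupIndicator B (of j a * u) else 0
  have hβ : ∀ j x y u, β j (x * y) u = β j y u + β j x (of j y * u) := by
    intro j x y u
    by_cases hj : j = i
    · have key : ∀ p q r : ZMod 2, p + r = p + q + (q + r) := by decide
      simp only [β, if_pos hj, map_mul, mul_assoc]
      exact key _ _ _
    · simp only [β, if_neg hj, add_zero]
  have hβ0 : ∀ j h u, β j (φ j h) u = 0 := by
    intro j h u
    simp only [β]
    rw [of_apply_eq_base, subgroupIndicator_mul_left (hbase h), CharTwo.add_self_eq_zero, ite_self]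
  let ρ : PushoutI φ →* Equiv.Perm (PushoutI φ × ZMod 2) :=
    lift (fun j => skewHom (of j) (β j) (hβ j)) (skewHom (base φ) (fun _ _ => 0) (by simp)) (by
      intro j
      ext1 h
      change skewPerm (of j (φ j h)) (β j (φ j h)) = skewPerm (base φ h) fun _ => 0
      rw [of_apply_eq_base]
      congr 1
      funext u
      exact hβ0 j h u)
  have hρ : ∀ j a, ρ (of j a) = skewPerm (of j a) (β j a) := fun j a => lift_of _ _ _ a
  obtain ⟨c, hc, hcρ⟩ := exists_cocycle closure_letters ρ (by
    rintro _ ⟨j, a, rfl⟩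
    exact ⟨_, hρ j a⟩)
  have hcof : ∀ j a u, c (of j a) u = β j a u := fun j a => congrFun (hcρ _ _ (hρ j a))
  refine ⟨fun g => c g 1, hc.one 1, fun j a g => ?_, ?_⟩
  · change c (of j a * g) 1 = c g 1 + β j a g
    rw [hc, hcof, mul_one]
  · rintro _ ⟨h, rfl⟩ g
    have h1 := hc.mul_right closure_letters (k := base φ h) (by
      rintro _ ⟨j, a, rfl⟩ u
      rw [hcof, hcof]
      simp only [β]
      rw [← mul_assoc, subgroupIndicator_mul_right (hbase h), subgroupIndicator_mul_right (hbase h)])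
      g 1
    rw [one_mul] at h1
    change c (g * base φ h) 1 = c g 1
    rw [hc, ← of_apply_eq_base φ i, hcof, hβ0, zero_add, mul_one, of_apply_eq_base, h1]

theorem of_mem_range_base (hφ : ∀ i, Function.Injective (φ i)) {i : ι} {a : A i} :
    of i a ∈ (base φ).range ↔ a ∈ (φ i).range := by
  constructor
  · rintro ⟨h, hh⟩
    rw [← of_apply_eq_base φ i] at hh
    exact ⟨h, of_injective hφ i hh⟩
  · rintro ⟨h, rfl⟩
    exact ⟨h, (of_apply_eq_base φ i h).symm⟩

end General

variable {A : Fin 2 → Type*} {C : Type*} [∀ i, Group (A i)] [Group C] {φ : ∀ i, C →* A i}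

/-- The wall is `n 0`, which tells whether the last letter is in the first factor. For letters
outside the common subgroup, the powers of `b = a₁ a₀` end in `a₀` and those of `b⁻¹` end in `a₁⁻¹`;
a ping-pong argument proves this without normal forms. -/
theorem exists_isWallFunction (hφ : ∀ i, Function.Injective (φ i)) (hne : ∀ i, (φ i).range ≠ ⊤) :
    ∃ (n : PushoutI φ → ZMod 2) (b : PushoutI φ), IsWallFunction (base φ).range n b := by
  classical
  set B := (base φ).range
  have hbase : ∀ h, base φ h ∈ B := fun h => ⟨h, rfl⟩
  choose n hn1 hnmul hnright using exists_lastLetter φ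
  have hletter : ∀ i a g, n i (of i a * g) =
      n i g + (subgroupIndicator B g + subgroupIndicator B (of i a * g)) := fun i a g => by
    rw [hnmul, if_pos rfl]
  have hletter' : ∀ {i j} a g, j ≠ i → n i (of j a * g) = n i g := fun a g h => by
    rw [hnmul, if_neg h, add_zero]
  have hleft : ∀ i, ∀ k ∈ B, ∀ g, n i (k * g) = n i g := by
    rintro i _ ⟨h, rfl⟩ g
    rw [← of_apply_eq_base φ i, hletter, of_apply_eq_base, subgroupIndicator_mul_left (hbase h),
      CharTwo.add_self_eq_zero, add_zero]
  have hB0 : ∀ i, ∀ k ∈ B, n i k = 0 := fun i k hk => by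
    rw [← mul_one k, hleft i k hk, hn1]
  have hof : ∀ i a, of i a ∉ B → n i (of i a) = 1 := fun i a ha => by
    have := hletter i a 1
    rwa [mul_one, hn1, subgroupIndicator_of_mem B.one_mem, subgroupIndicator_of_notMem ha, zero_add,
      add_zero] at this
  -- Off `B` exactly one of the two functions is `1`; on `B` both vanish.
  have hsum : ∀ g, n 0 g + n 1 g = 1 + subgroupIndicator B g := by
    intro g
    have key : ∀ p q r s : ZMod 2, p + q = 1 + r → p + (r + s) + q = 1 + s := by decide
    induction g using induction_letters with
    | one =>
      rw [hn1, hn1, subgroupIndicator_of_mem B.one_mem]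
      decide
    | letter_mul j a g ih =>
      obtain rfl | rfl : j = 0 ∨ j = 1 := by omega
      · rw [hletter, hletter' a g (by decide)]
        exact key _ _ _ _ ih
      · rw [hletter, hletter' a g (by decide), add_comm]
        exact key _ _ _ _ (by rwa [add_comm])
  have hother : ∀ i i', i ≠ i' → ∀ g, n i g = 1 → n i' g = 0 := by
    intro i i' hi g hg
    have hg' := hsum g
    rw [subgroupIndicator_of_notMem fun h => zero_ne_one ((hB0 i g h).symm.trans hg),
      add_zero] at hg'
    obtain ⟨rfl, rfl⟩ | ⟨rfl, rfl⟩ : i = 0 ∧ i' = 1 ∨ i = 1 ∧ i' = 0 := by omega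
    · rwa [hg, add_eq_left] at hg'
    · rwa [hg, add_eq_right] at hg'
  -- Induction on `w` by letters added on the left. Only a letter of the same factor `A i` can
  -- change the value, and only by a crossing of `B`.
  have hpong : ∀ i a, of i a ∉ B → ∀ w, n i w = 0 → n i (w * of i a) = 1 := by
    intro i a ha w
    induction w using induction_letters with
    | one => exact fun _ => by rw [one_mul, hof i a ha]
    | letter_mul j x w ih =>
      intro hw
      have hcases : ∀ p : ZMod 2, p = 0 ∨ p = 1 := by decide
      by_cases hj : j = i
      · subst hj
        rcases hcases (n j w) with h0 | h1
        · have h2 := ih h0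
          have h3 : w * of j a ∉ B := fun h => zero_ne_one ((hB0 j _ h).symm.trans h2)
          have h4 : of j x * w * of j a ∉ B := by
            intro h
            rw [hletter, h0, zero_add] at hw
            by_cases hwB : w ∈ B
            · rw [subgroupIndicator_of_mem hwB] at hw
              have hxw : of j x * w ∈ B := by
                by_contra hxw
                rw [subgroupIndicator_of_notMem hxw] at hw
                exact one_ne_zero hw
              exact ha ((B.mul_mem_cancel_left hxw).1 h)
            -- If `w` is not in `B` but the product is, then `w` itself is a letter of `A j` outside
            -- `B`, so `n j w` would be `1`.
            · obtain ⟨k, hk⟩ := h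
              have hwj : w = of j (x⁻¹ * φ j k * a⁻¹) := by
                rw [map_mul, map_mul, of_apply_eq_base, hk, map_inv, map_inv]
                group
              rw [hwj] at hwB h0
              exact zero_ne_one (h0.symm.trans (hof j _ hwB))
          rw [mul_assoc, hletter, h2, ← mul_assoc, subgroupIndicator_of_notMem h3,
            subgroupIndicator_of_notMem h4, add_zero, add_zero]
        · have hwB : w ∉ B := fun h => zero_ne_one ((hB0 j _ h).symm.trans h1)
          have hxw : of j x * w ∈ B := by
            by_contra hxw
            rw [hletter, h1, subgroupIndicator_of_notMem hxw, subgroupIndicator_of_notMem hwB] at hw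
            exact one_ne_zero hw
          rw [hleft j _ hxw, hof j a ha]
      · rw [hletter' _ _ hj] at hw
        rw [mul_assoc, hletter' _ _ hj, ih hw]
  have halt : ∀ i i' a a', i ≠ i' → of i a ∉ B → of i' a' ∉ B → ∀ k : ℕ,
      n i' ((of i' a' * of i a) ^ k) = 0 ∧ n i ((of i' a' * of i a) ^ (k + 1)) = 1 := by
    intro i i' a a' hi ha ha' k
    have step : ∀ k : ℕ, n i' ((of i' a' * of i a) ^ k) = 0 →
        n i ((of i' a' * of i a) ^ (k + 1)) = 1 := fun k hk => by
      rw [pow_succ, ← mul_assoc]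
      exact hpong i a ha _ (hother i' i hi.symm _ (hpong i' a' ha' _ hk))
    have h0 : n i' ((of i' a' * of i a) ^ k) = 0 := by
      induction k with
      | zero => rw [pow_zero, hn1]
      | succ k ih => exact hother i i' hi _ (step k ih)
    exact ⟨h0, step k h0⟩
  have hex : ∀ i, ∃ a, of i a ∉ B := fun i => by
    by_contra! h
    exact hne i (eq_top_iff.2 fun a _ => (of_mem_range_base hφ).1 (h a))
  choose a ha using hex
  have hpos := halt 0 1 (a 0) (a 1) (by decide) (ha 0) (ha 1)
  have hneg := halt 1 0 (a 1)⁻¹ (a 0)⁻¹ (by decide) (by simpa using ha 1) (by simpa using ha 0)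
  have hinv : (of 1 (a 1) * of 0 (a 0))⁻¹ = (of 0 (a 0)⁻¹ * of 1 (a 1)⁻¹ : PushoutI φ) := by
    rw [mul_inv_rev, map_inv, map_inv]
  have h1 : n 0 (of 1 (a 1) * of 0 (a 0)) = 1 := by simpa using (hpos 0).2
  have h2 : n 0 (of 1 (a 1) * of 0 (a 0))⁻¹ = 0 := by
    rw [hinv]
    simpa using (hneg 1).1
  refine ⟨n 0, of 1 (a 1) * of 0 (a 0), hleft 0, hnright 0, ⟨_, closure_letters, ?_⟩,
    fun k => (hpos k).2.trans h1.symm, fun k => ?_, ?_⟩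
  · rintro _ ⟨j, x, rfl⟩ g hg
    by_contra! h
    refine hg ?_
    rw [hnmul, subgroupIndicator_of_notMem h.1, subgroupIndicator_of_notMem h.2, add_zero, ite_self,
      add_zero]
  · rw [h2, hinv]
    exact (hneg (k + 1)).1
  · rw [h1, h2]
    exact one_ne_zero

end Monoid.PushoutI

theorem mainTheorem8 {G : Type*} [Group G]
    (hG : IsHNNExtensionWith G ExponentiallyDistorted ∨
      IsAmalgamatedProductWith G ExponentiallyDistorted)
    (S : Set G) (hSfin : S.Finite) (hS : Subgroup.closure S = ⊤)
    (ω : Ultrafilter ℕ) (e : ℕ → WordMetricSpace S hS) (d : ScalingSequence ω) :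
    SimplyConnectedSpace (AsymptoticCone (WordMetricSpace S hS) ω e d) ∨
      ∀ x : AsymptoticCone (WordMetricSpace S hS) ω e d,
        Uncountable (FundamentalGroup (AsymptoticCone (WordMetricSpace S hS) ω e d) x) := by
  rcases hG with ⟨A, _, H, K, φ, f, -, hK⟩ | ⟨A, _, C, _, φ, f, hφ, hne, hC⟩
  · obtain ⟨n, hn⟩ := HNNExtension.exists_isWallFunction (φ := φ)
    rw [← Subgroup.map_map] at hK
    exact (hn.map f).simplyConnectedSpace_or_uncountable hK hSfin hS ω e d
  · obtain ⟨n, b, hn⟩ := Monoid.PushoutI.exists_isWallFunction hφ hne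
    rw [MonoidHom.range_comp] at hC
    exact (hn.map f).simplyConnectedSpace_or_uncountable hC hSfin hS ω e d
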